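/- Let $G=\mathrm{SL}_3(4)$, let $K$ be a finite extension of $\mathbf{Q}_2$ containing all $|G|$-th roots of unity, and let $\mathcal{O}$ be the ring of integers of $K$ (the integral closure of $\mathbf{Z}_2$ in $K$). A block idempotent of $\mathcal{O}G$ is a primitive idempotent $b$ of the centre $Z(\mathcal{O}G)$, and the corresponding block is $\mathcal{O}Gb$. The principal block $\mathcal{O}Gb_0$ is the one for which $b_0$ does not act by $0$ on the trivial representation. A defect group of $\mathcal{O}Gb$ is a minimal subgroup $D$ of $G$ such that $b=\mathrm{Tr}_D^G(a)=\sum_{x\in G/D}xax^{-1}$ for some $a\in(\mathcal{O}G)^D$. The block has positive defect if its defect groups are non-trivial. Given a prime $p$, finite groups $G$, $H$, a finite extension $K$ of $\mathbf{Q}_p$ containing all $|G|$-th and $|H|$-th roots of unity, with ring of integers $\mathcal{O}$, and block idempotents $b$ of $\mathcal{O}G$ and $b'$ of $\mathcal{O}H$, write $\mathrm{Irr}(KGb)$ for the set of characters of the irreducible $KG$-modules on which $b$ acts as the identity, and similarly for $H$. A perfect isometry from $\mathcal{O}Gb$ to $\mathcal{O}Hb'$ is an isomorphism of abelian groups $I:\mathbf{Z}\,\mathrm{Irr}(KGb)\to\mathbf{Z}\,\mathrm{Irr}(KHb')$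 preserving the usual scalar products of characters and such that, setting $$\eta(g,h)=\sum_{\chi\in\mathrm{Irr}(KGb)}\chi(g)\,I(\chi)(h),$$ one has, for all $g\in G$ and $h\in H$, that $\eta(g,h)/|C_G(g)|\in\mathcal{O}$ and $\eta(g,h)/|C_H(h)|\in\mathcal{O}$, and that $\eta(g,h)=0$ if exactly one of $g$ and $h$ has order prime to $p$. Let $\mathcal{O}Gb_0$ be the principal block of $\mathcal{O}G$ for $G=\mathrm{SL}_3(4)$ and $p=2$, and let $\mathcal{O}Gb$ be a non-principal block of positive defect. Then: 1. there is no perfect isometry from $\mathcal{O}Gb_0$ to $\mathcal{O}Gb$; 2. $\mathcal{O}Gb_0$ and $\mathcal{O}Gb$ are not derived equivalent over $\mathcal{O}$: there is no $\mathcal{O}$-linear equivalence of triangulated categories $D^b(\mathcal{O}Gb_0)\simeq D^b(\mathcal{O}Gb)$ between the bounded derived categories of finitely generated modules. -/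

import Mathlib

open CategoryTheory

universe u

/-! ### Blocks of group algebras and their defect groups -/

/-- A block of `O G`: a primitive idempotent `e` of the centre of the group algebra `O G`. -/
structure GroupBlock (O G : Type*) [CommRing O] [Group G] where
  /-- The block idempotent. -/
  e : MonoidAlgebra O G
  central : e ∈ Subring.center (MonoidAlgebra O G)
  idem : IsIdempotentElem e
  ne_zero : e ≠ 0
  primitive : ∀ f ∈ Subring.center (MonoidAlgebra O G), IsIdempotentElem f →
    f * e = f → f = 0 ∨ f = e

namespace GroupBlock

section Defect

variable {O G : Type*} [CommRing O] [Group G]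

/-- The principal block is the one whose idempotent does not act by `0` on the trivial
representation. -/
def IsPrincipal (B : GroupBlock O G) : Prop :=
  (Representation.trivial O G O).asAlgebraHom B.e ≠ 0

/-- The set `(O G)^D` of elements of `O G` fixed under conjugation by the subgroup `D`. -/
def fixedBy (O : Type*) [CommRing O] (D : Subgroup G) : Set (MonoidAlgebra O G) :=
  {a | ∀ d ∈ D, MonoidAlgebra.single d 1 * a * MonoidAlgebra.single d⁻¹ 1 = a}

/-- The relative trace `Tr_D^G(a) = ∑_{x ∈ G/D} x a x⁻¹`; for `a ∈ (O G)^D` it does not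
depend on the choice of representatives. -/
noncomputable def relTrace (D : Subgroup G) (a : MonoidAlgebra O G) : MonoidAlgebra O G :=
  ∑ᶠ x : G ⧸ D, MonoidAlgebra.single x.out 1 * a * MonoidAlgebra.single x.out⁻¹ 1

/-- A defect group of a block is a minimal subgroup `D` of `G` such that the block idempotent
lies in the image of `Tr_D^G : (O G)^D → Z(O G)`. -/
def IsDefectGroup (B : GroupBlock O G) (D : Subgroup G) : Prop :=
  Minimal (fun D : Subgroup G => ∃ a ∈ fixedBy O D, relTrace D a = B.e) D

/-- A block has positive defect if its defect groups are non-trivial. -/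
def HasPositiveDefect (B : GroupBlock O G) : Prop :=
  ∀ D : Subgroup G, B.IsDefectGroup D → D ≠ ⊥

end Defect

/-! ### The block algebra -/

section Algebra

variable {O G : Type*} [CommRing O] [Group G] (B : GroupBlock O G)

/-- The block algebra `O G e = e O G e`, with identity element `e`. -/
abbrev Alg : Type _ := B.idem.Corner

lemma smul_mem_corner (r : O) (x : B.Alg) :
    r • (x.1 : MonoidAlgebra O G) ∈ Subsemigroup.corner B.e := by
  have h := (Subsemigroup.mem_corner_iff B.idem).1 x.2
  refine (Subsemigroup.mem_corner_iff B.idem).2 ⟨?_, ?_⟩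
  · rw [mul_smul_comm, h.1]
  · rw [smul_mul_assoc, h.2]

noncomputable instance : Module O B.Alg where
  smul r x := ⟨r • (x.1 : MonoidAlgebra O G), B.smul_mem_corner r x⟩
  one_smul x := Subtype.ext (one_smul O (x.1 : MonoidAlgebra O G))
  mul_smul r s x := Subtype.ext (mul_smul r s (x.1 : MonoidAlgebra O G))
  smul_zero r := Subtype.ext (smul_zero (A := MonoidAlgebra O G) r)
  smul_add r x y := Subtype.ext (smul_add r (x.1 : MonoidAlgebra O G) y.1)
  add_smul r s x := Subtype.ext (add_smul r s (x.1 : MonoidAlgebra O G))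
  zero_smul x := Subtype.ext (zero_smul O (x.1 : MonoidAlgebra O G))

/-- The `O`-algebra structure of the block algebra, with `(r • x : O G) = r • (x : O G)`. -/
noncomputable instance : Algebra O B.Alg :=
  Algebra.ofModule
    (fun r x y => Subtype.ext (smul_mul_assoc r (x.1 : MonoidAlgebra O G) y.1))
    (fun r x y => Subtype.ext (mul_smul_comm r (x.1 : MonoidAlgebra O G) y.1))

instance [Finite G] [IsNoetherianRing O] : IsNoetherianRing B.Alg := by
  let f : B.Alg →ₗ[O] MonoidAlgebra O G :=
    { toFun := fun x => x.1
      map_add' := fun _ _ => rfl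
      map_smul' := fun _ _ => rfl }
  have h1 : Module.Finite O (MonoidAlgebra O G) := inferInstance
  have h2 : IsNoetherian O (MonoidAlgebra O G) := inferInstance
  have h3 : IsNoetherian O B.Alg := isNoetherian_of_injective f Subtype.val_injective
  exact isNoetherian_of_tower O h3

end Algebra

/-! ### Characters and perfect isometries -/

section Characters

variable {O G H : Type*} [CommRing O] [Group G] [Group H]

/-- `Irr(K G e)`: the characters of the irreducible representations of `G` over `K` on which
the block idempotent acts as the identity. -/
def irr (B : GroupBlock O G) (K : Type*) [Field K] [Algebra O K] : Set (G → K) :=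
  {χ | ∃ (n : ℕ) (ρ : Representation K G (Fin n → K)), ρ.IsIrreducible ∧
    ρ.asAlgebraHom (MonoidAlgebra.mapRingHom G (algebraMap O K) B.e) = 1 ∧
    ρ.character = χ}

/-- `ℤ Irr(K G e)`: the group of generalised characters in the block. -/
def charLattice (B : GroupBlock O G) (K : Type*) [Field K] [Algebra O K] :
    AddSubgroup (G → K) :=
  AddSubgroup.closure (B.irr K)

/-- The scalar product `|G|⁻¹ ∑_g φ(g) ψ(g⁻¹)` of class functions on a finite group. -/
noncomputable def scalarProduct {K : Type*} [Field K] (φ ψ : G → K) : K :=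
  (Nat.card G : K)⁻¹ * ∑ᶠ g : G, φ g * ψ g⁻¹

variable {K : Type*} [Field K] [Algebra O K]

/-- The generalised character `η = ∑_{χ ∈ Irr(K G e)} χ ⊗ I(χ)` of `G × H`. -/
noncomputable def isometryCharacter {B : GroupBlock O G} {B' : GroupBlock O H}
    (I : B.charLattice K ≃+ B'.charLattice K) (g : G) (h : H) : K :=
  ∑ᶠ χ : B.irr K, χ.1 g * (I ⟨χ.1, AddSubgroup.subset_closure χ.2⟩).1 h

/-- A bijective isometry `ℤ Irr(K G e) ≃ ℤ Irr(K H e')` is perfect (with respect to the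
prime `p`) if the associated character `η` of `G × H` satisfies
* integrality: `η(g,h) / |C_G(g)|` and `η(g,h) / |C_H(h)|` lie in `O`;
* separation: `η(g,h) = 0` if exactly one of `g`, `h` has order prime to `p`. -/
structure IsPerfectIsometry (p : ℕ) {B : GroupBlock O G} {B' : GroupBlock O H}
    (I : B.charLattice K ≃+ B'.charLattice K) : Prop where
  isometry : ∀ φ ψ : B.charLattice K,
    scalarProduct (I φ).1 (I ψ).1 = scalarProduct φ.1 ψ.1
  integral_left : ∀ (g : G) (h : H),
    isometryCharacter I g h / (Nat.card (Subgroup.centralizer {g}) : K) ∈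
      Set.range (algebraMap O K)
  integral_right : ∀ (g : G) (h : H),
    isometryCharacter I g h / (Nat.card (Subgroup.centralizer {h}) : K) ∈
      Set.range (algebraMap O K)
  separation : ∀ (g : G) (h : H),
    ¬ ((orderOf g).Coprime p ↔ (orderOf h).Coprime p) → isometryCharacter I g h = 0

end Characters

end GroupBlock

/-! ### Derived equivalences -/

/-- The `R`-linear structure on modules over an `R`-algebra `A`: a scalar `r` acts on
morphisms through the central element `algebraMap R A r` of `A`. -/
@[reducible] noncomputable def moduleCatLinear (R A : Type u) [CommRing R] [Ring A]
    [Algebra R A] : Linear R (ModuleCat.{u} A) where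
  homModule M N :=
    letI : Module R N := Module.restrictScalars R A N
    haveI : IsScalarTower R A N := IsScalarTower.restrictScalars R A N
    haveI : SMulCommClass A R N := IsScalarTower.to_smulCommClass'
    inferInstance
  smul_comp M N P r f g := by
    ext x
    exact g.hom.map_smul (algebraMap R A r) (f.hom x)
  comp_smul M N P f r g := rfl

/-- The bounded derived category `D^b(A)` of finitely generated modules over the (left)
noetherian ring `A`. -/
abbrev BoundedDerived (A : Type u) [Ring A] [IsNoetherianRing A]
    [HasDerivedCategory.{u + 1} (FGModuleCat.{u} A)] :=
  DerivedCategory.Bounded (FGModuleCat.{u} A)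

/-- Two noetherian `R`-algebras `A` and `A'` are derived equivalent over `R` if there is an
`R`-linear equivalence of triangulated categories `D^b(A) ≃ D^b(A')`. -/
def DerivedEquivalentOver (R A A' : Type u) [CommRing R] [Ring A] [Ring A'] [Algebra R A]
    [Algebra R A'] [IsNoetherianRing A] [IsNoetherianRing A'] : Prop :=
  letI := moduleCatLinear R A
  letI := moduleCatLinear R A'
  letI := HasDerivedCategory.standard (FGModuleCat.{u} A)
  letI := HasDerivedCategory.standard (FGModuleCat.{u} A')
  ∃ (F : BoundedDerived A ≌ BoundedDerived A')
    (_ : F.functor.CommShift ℤ), F.functor.IsTriangulated ∧ F.functor.Linear R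

/-! ### The ring of integers of a `p`-adic field -/

/-- The ring of integers of a finite extension of `ℚ_p` is noetherian. -/
instance padicIntegralClosure_isNoetherianRing (p : ℕ) [Fact p.Prime] (K : Type*) [Field K]
    [Algebra ℚ_[p] K] [FiniteDimensional ℚ_[p] K] [Algebra ℤ_[p] K]
    [IsScalarTower ℤ_[p] ℚ_[p] K] : IsNoetherianRing (integralClosure ℤ_[p] K) :=
  integralClosure.isNoetherianRing (A := ℤ_[p]) (K := ℚ_[p]) (L := K)

/-! The two blocks are told apart by an invariant of the centre: `HasCongruentTriple`, the existence
of three distinct O-algebra homomorphisms Φ : Z(OG) → O that are non-zero on the block and pairwise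
congruent modulo 64, the order of a Sylow 2-subgroup.

The principal block has such a triple, coming from the trivial character and the two characters of
degree 63 with values in ℤ[(1+√5)/2]. These are induced from the stabiliser of a point, which maps
onto SL₂(4) ≅ A₅, along the two icosahedral representations of degree 3. The congruence
(`Ico.sum_trace_mat_sub`) holds because a Sylow 2-subgroup acts freely by conjugation on the
elements that are not scalar multiples of unipotents, while on the scalar multiples of unipotents
the character of degree 63 is 63 or -1.

A non-principal block has none (`GroupBlock.not_hasCongruentTriple`). Structure constants of the
class algebra, counted by machine, give polynomial equations for the values of a central character.
Their solutions (`faithful_relations`, `trivial_relations`) fall into a short list of keys that are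
distinct modulo 64 once the trivial character is excluded. So congruent characters have the same
key. Characters with the same key and central action lie on a line, and three distinct central
characters are never collinear.

The invariant passes along both kinds of equivalence. A perfect isometry sends characters of norm
one to characters of norm one up to sign, and its kernel η induces maps between the centres that
intertwine the Φ up to mutually congruent units (`IsPerfectIsometry.hasCongruentTriple`). A derived
equivalence gives a surjection of centres (`exists_surjective_center_hom`): the action of a central
element, transported through the equivalence, agrees with that of a central element z of the other
algebra on all shifts of the regular module. The difference is therefore nilpotent on bounded
objects, and it vanishes because the centre is reduced. The triple is pulled back along this
surjection. -/

set_option linter.constructorNameAsVariable false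
set_option exponentiation.threshold 400

/-! ### The field with four elements -/

/-- The field with four elements. -/
inductive F4 : Type
  | q0 | q1 | q2 | q3
  deriving DecidableEq

namespace F4

def add : F4 → F4 → F4
  | q0, y => y
  | x, q0 => x
  | q1, q1 => q0 | q1, q2 => q3 | q1, q3 => q2
  | q2, q1 => q3 | q2, q2 => q0 | q2, q3 => q1
  | q3, q1 => q2 | q3, q2 => q1 | q3, q3 => q0

def mul : F4 → F4 → F4
  | q0, _ => q0
  | _, q0 => q0
  | q1, y => y
  | x, q1 => x
  | q2, q2 => q3 | q2, q3 => q1 | q3, q2 => q1 | q3, q3 => q2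

/-- Evaluate `x` before passing it on. -/
def strict {α : Type} (x : F4) (k : F4 → α) : α :=
  match x with
  | q0 => k q0
  | q1 => k q1
  | q2 => k q2
  | q3 => k q3

def sumAll (f : F4 → ℕ) : ℕ := Nat.add (f q0) (Nat.add (f q1) (Nat.add (f q2) (f q3)))
def minor (x y z w : F4) : F4 := add (mul x w) (mul y z)
def dot (a b c x y z : F4) : F4 := add (mul a x) (add (mul b y) (mul c z))
def det (a b c d e f g h i : F4) : F4 :=
   add (mul a (minor e f h i)) (add (mul b (minor d f g i)) (mul c (minor d e g h)))

instance : Zero F4 := ⟨q0⟩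
instance : One F4 := ⟨q1⟩
instance : Add F4 := ⟨add⟩
instance : Mul F4 := ⟨mul⟩
instance : Neg F4 := ⟨id⟩
instance : Inv F4 := ⟨fun x => mul x x⟩

instance : Fintype F4 := ⟨{q0, q1, q2, q3}, fun x => by cases x <;> decide⟩

instance : Field F4 where
  add_assoc a b c := by cases a <;> cases b <;> cases c <;> rfl
  zero_add a := by cases a <;> rfl
  add_zero a := by cases a <;> rfl
  nsmul := nsmulRec
  zsmul := zsmulRec
  neg_add_cancel a := by cases a <;> rfl
  add_comm a b := by cases a <;> cases b <;> rfl
  mul_assoc a b c := by cases a <;> cases b <;> cases c <;> rfl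
  one_mul a := by cases a <;> rfl
  mul_one a := by cases a <;> rfl
  left_distrib a b c := by cases a <;> cases b <;> cases c <;> rfl
  right_distrib a b c := by cases a <;> cases b <;> cases c <;> rfl
  zero_mul a := by cases a <;> rfl
  mul_zero a := by cases a <;> rfl
  mul_comm a b := by cases a <;> cases b <;> rfl
  exists_pair_ne := ⟨q0, q1, by decide⟩
  mul_inv_cancel a h := by cases a <;> first | rfl | exact absurd rfl h
  inv_zero := rfl
  nnqsmul := _
  nnqsmul_def := fun _ _ => rfl
  qsmul := _
  qsmul_def := fun _ _ => rfl

theorem add_def (x y : F4) : add x y = x + y := rfl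
theorem q0_eq : q0 = 0 := rfl
theorem q1_eq : q1 = 1 := rfl
theorem sub_eq_add (x y : F4) : x - y = x + y := by cases x <;> cases y <;> rfl
theorem two_eq_zero : (2 : F4) = 0 := by rw [← one_add_one_eq_two]; rfl
theorem pow_three {x : F4} (h : x ≠ 0) : x * x * x = 1 := by
  cases x <;> first | rfl | exact absurd rfl h

theorem strict_eq {α : Type} (x : F4) (k : F4 → α) : x.strict k = k x := by cases x <;> rfl
theorem sumAll_eq (f : F4 → ℕ) : sumAll f = ∑ x, f x := by
  change _ = ∑ x ∈ {q0, q1, q2, q3}, f x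
  rw [Finset.sum_insert (by decide), Finset.sum_insert (by decide), Finset.sum_insert (by decide),
    Finset.sum_singleton]
  rfl
theorem minor_eq (x y z w : F4) : minor x y z w = x * w + y * z := rfl
theorem dot_eq (a b c x y z : F4) : dot a b c x y z = a * x + (b * y + c * z) := rfl
theorem det_eq (a b c d e f g h i : F4) : det a b c d e f g h i =
    a * (e * i + f * h) + (b * (d * i + f * g) + c * (d * h + e * g)) := rfl

end F4
open F4

/-! ### Matrices over the field, class labels and tallies of products -/

structure M3 where
  (a b c d e f g h i : F4)

namespace M3
-- Every entry is evaluated before the matrix is formed, so long products do not pile up unevaluated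
-- expressions.
def mk' (a b c d e f g h i : F4) : M3 :=
  a.strict fun a => b.strict fun b => c.strict fun c => d.strict fun d => e.strict fun e =>
  f.strict fun f => g.strict fun g => h.strict fun h => i.strict fun i => ⟨a,b,c,d,e,f,g,h,i⟩

def mul : M3 → M3 → M3
  | ⟨a,b,c,d,e,f,g,h,i⟩, ⟨a',b',c',d',e',f',g',h',i'⟩ =>
    mk' (dot a b c a' d' g') (dot a b c b' e' h') (dot a b c c' f' i')
        (dot d e f a' d' g') (dot d e f b' e' h') (dot d e f c' f' i')
        (dot g h i a' d' g') (dot g h i b' e' h') (dot g h i c' f' i')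

def adj : M3 → M3
  | ⟨a,b,c,d,e,f,g,h,i⟩ =>
   mk' (minor e f h i) (minor b c h i) (minor b c e f) (minor d f g i) (minor a c g i)
    (minor a c d f) (minor d e g h) (minor a b g h) (minor a b d e)

def tr : M3 → F4
  | ⟨a,_,_,_,e,_,_,_,i⟩ => add a (add e i)
def e2 : M3 → F4
  | ⟨a,b,c,d,e,f,g,h,i⟩ => add (minor a b d e) (add (minor a c g i) (minor e f h i))

/-- det (v, m v, m² v) -/
def cyc (m : M3) (x y z : F4) : F4 :=
  match m with
  | ⟨a,b,c,d,e,f,g,h,i⟩ =>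
    (dot a b c x y z).strict fun x1 => (dot d e f x y z).strict fun y1 =>
    (dot g h i x y z).strict fun z1 =>
    (dot a b c x1 y1 z1).strict fun x2 => (dot d e f x1 y1 z1).strict fun y2 =>
    (dot g h i x1 y1 z1).strict fun z2 =>
    det x x1 x2 y y1 y2 z z1 z2

/-- Whether the matrix is scalar. -/
def isScalar : M3 → Bool
  | ⟨a,q0,q0,q0,e,q0,q0,q0,i⟩ => match add a e, add e i with
    | q0, q0 => true
    | _, _ => false
  | _ => false

/-- The class label of an element `ω ^ s * u` with `u` unipotent. -/
def uni (s : ℕ) (m : M3) : ℕ :=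
  -- (1 + N)² = 1 + N² in characteristic 2, so a scalar square means N² = 0: a scalar or a multiple
  -- of a transvection.
  match isScalar (mul m m) with
  | true => match isScalar m with
    | true => s
    | false => Nat.add 3 s
  -- Replacing a cyclic vector v by p(m)v multiplies `cyc` by det p(m), which is the cube of the
  -- single eigenvalue of p(m) and hence 1. So the non-zero value is an invariant of the class. The
  -- value 28 is a fallback for the case that no basis vector is cyclic.
  | false => match cyc m q1 q0 q0 with
    | q1 => Nat.add 6 s
    | q2 => Nat.add 9 s
    | q3 => Nat.add 12 s
    | q0 => match cyc m q0 q1 q0 with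
      | q1 => Nat.add 6 s
      | q2 => Nat.add 9 s
      | q3 => Nat.add 12 s
      | q0 => match cyc m q0 q0 q1 with
        | q1 => Nat.add 6 s
        | q2 => Nat.add 9 s
        | q3 => Nat.add 12 s
        | q0 => 28

/-- The label of the conjugacy class of a matrix of determinant one. -/
def lab (m : M3) : ℕ :=
  match tr m, e2 m with
  -- Eigenvalues 1, ω, ω²: this class is stable under scalars and has a single label.
  | q0, q0 => 27
  -- (X - λ)³ has the coefficients 3λ = λ and 3λ² = λ².
  | q1, q1 => uni 0 m
  | q2, q3 => uni 1 m
  | q3, q2 => uni 2 m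
  -- Multiplication by ω multiplies `tr` by ω and `e2` by ω². Three consecutive labels therefore
  -- belong to one class of PSL₃(4).
  | q3, q3 => 15
  | q1, q2 => 16
  | q2, q1 => 17
  | q2, q2 => 18
  | q3, q1 => 19
  | q1, q3 => 20
  | q0, q1 => 21
  | q0, q3 => 22
  | q0, q2 => 23
  | q1, q0 => 24
  | q2, q0 => 25
  | q3, q0 => 26

/-- One unit in the digit number `lab m` in base 2048. Adding codes counts all classes at once; at
most 1260 of them are added, so there is no carry. -/
def code (m : M3) : ℕ := Nat.pow 2 (Nat.mul 11 (lab m))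

/-- The first columns of `X1`, `X2`, `X3` are the 21 points (1:b:c), (0:1:c), (0:0:1) of the
projective plane. `Y1` and `Y2` give the five lines through the base point. -/
def X1 (b c : F4) : M3 := ⟨q1,q0,q0,b,q1,q0,c,q0,q1⟩
def X2 (c : F4) : M3 := ⟨q0,q0,q1,q1,q0,q0,c,q1,q0⟩
def X3 : M3 := ⟨q0,q1,q0,q0,q0,q1,q1,q0,q0⟩
def sumPt (f : M3 → ℕ) : ℕ := Nat.add (sumAll fun b => sumAll fun c => f (X1 b c))
  (Nat.add (sumAll fun c => f (X2 c)) (f X3))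
def Y1 (c : F4) : M3 := ⟨q1,q0,q0,q0,q1,q0,q0,c,q1⟩
def Y2 : M3 := ⟨q1,q0,q0,q0,q0,q1,q0,q1,q0⟩
def bind (m : M3) (f : M3 → ℕ) : ℕ := match m with
  | ⟨a,b,c,d,e,f',g,h,i⟩ => f ⟨a,b,c,d,e,f',g,h,i⟩
def sumFl (f : M3 → ℕ) : ℕ :=
  sumPt fun x => Nat.add (sumAll fun c => bind (mul x (Y1 c)) f) (bind (mul x Y2) f)

def conj (x t : M3) : M3 := mul (mul x t) (adj x)
def uu (a b c : F4) : M3 := ⟨q1,a,b,q0,q1,c,q0,q0,q1⟩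
def tallyT (g : M3) : ℕ := sumFl fun x =>
   Nat.add (code (mul g (conj x (uu q0 q1 q0))))
   (Nat.add (code (mul g (conj x (uu q0 q2 q0)))) (code (mul g (conj x (uu q0 q3 q0)))))
/-- elements with a c^2 = d -/
def tallyU (d : F4) (g : M3) : ℕ := sumFl fun x => sumAll fun b =>
   Nat.add (code (mul g (conj x (uu (F4.mul d q1) b q1))))
   (Nat.add (code (mul g (conj x (uu (F4.mul d q2) b q2))))
     (code (mul g (conj x (uu (F4.mul d q3) b q3)))))
-- For d ≠ 0 this has trace t, second coefficient e and determinant d³ = 1, and its first basis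
-- vector is cyclic with `cyc` equal to d.
def rep (t e d : F4) : M3 :=
   ⟨q0,q0, F4.mul d d, q1, q0, F4.mul (F4.mul d d) e, q0, d, t⟩

theorem mk'_eq (a b c d e f g h i : F4) : mk' a b c d e f g h i = ⟨a, b, c, d, e, f, g, h, i⟩ := by
  simp only [mk', strict_eq]

/-- The determinant. -/
def det (m : M3) : F4 := F4.det m.a m.b m.c m.d m.e m.f m.g m.h m.i

/-- The matrix with the given entries. -/
def toM (m : M3) : Matrix (Fin 3) (Fin 3) F4 := !![m.a, m.b, m.c; m.d, m.e, m.f; m.g, m.h, m.i]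

/-- The entries of a matrix. -/
def ofM (A : Matrix (Fin 3) (Fin 3) F4) : M3 :=
  ⟨A 0 0, A 0 1, A 0 2, A 1 0, A 1 1, A 1 2, A 2 0, A 2 1, A 2 2⟩

theorem ofM_toM (m : M3) : ofM (toM m) = m := rfl

theorem toM_ofM (A : Matrix (Fin 3) (Fin 3) F4) : toM (ofM A) = A := by
  ext i j
  fin_cases i <;> fin_cases j <;> rfl

theorem mul_eq (m n : M3) : mul m n =
    ⟨dot m.a m.b m.c n.a n.d n.g, dot m.a m.b m.c n.b n.e n.h, dot m.a m.b m.c n.c n.f n.i,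
     dot m.d m.e m.f n.a n.d n.g, dot m.d m.e m.f n.b n.e n.h, dot m.d m.e m.f n.c n.f n.i,
     dot m.g m.h m.i n.a n.d n.g, dot m.g m.h m.i n.b n.e n.h, dot m.g m.h m.i n.c n.f n.i⟩ :=
  mk'_eq ..

theorem toM_mul (m n : M3) : toM (mul m n) = toM m * toM n := by
  rw [mul_eq]
  ext i j
  fin_cases i <;> fin_cases j <;>
    simp [toM, Matrix.mul_apply, Fin.sum_univ_three, dot_eq, add_assoc]

theorem det_toM (m : M3) : (toM m).det = m.det := by
  rw [Matrix.det_fin_three]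
  simp only [toM, det, det_eq, Matrix.of_apply, Matrix.cons_val', Matrix.cons_val_zero,
    Matrix.cons_val_one, Matrix.cons_val, sub_eq_add]
  ring

theorem toM_adj_mul (m : M3) (h : m.det = 1) : toM (adj m) * toM m = 1 := by
  have h2 := two_eq_zero
  rw [← toM_mul, adj, mk'_eq, mul_eq]
  simp only [det, det_eq] at h
  ext i j
  fin_cases i <;> fin_cases j <;>
    simp [toM, dot_eq, minor_eq]
  · linear_combination h
  · linear_combination (m.b * m.e * m.i + m.b * m.f * m.h + m.c * m.e * m.h) * h2
  · linear_combination (m.c * m.e * m.i + m.b * m.f * m.i + m.c * m.f * m.h) * h2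
  · linear_combination (m.a * m.d * m.i + m.a * m.f * m.g + m.c * m.d * m.g) * h2
  · linear_combination h
  · linear_combination (m.c * m.d * m.i + m.a * m.f * m.i + m.c * m.f * m.g) * h2
  · linear_combination (m.a * m.d * m.h + m.a * m.e * m.g + m.b * m.d * m.g) * h2
  · linear_combination (m.b * m.d * m.h + m.a * m.e * m.h + m.b * m.e * m.g) * h2
  · linear_combination h

end M3

/-! ### The group SL₃(4) in terms of matrix entries -/

/-- The special linear group of degree three over `F4`. -/
abbrev SL34 : Type := Matrix.SpecialLinearGroup (Fin 3) F4

namespace SL34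

/-- The entries of an element of the group. -/
def raw (s : SL34) : M3 := M3.ofM s.1

theorem raw_det (s : SL34) : s.raw.det = 1 := by
  rw [← M3.det_toM, raw, M3.toM_ofM]
  exact s.2

theorem raw_injective : Function.Injective raw := fun s t h => by
  apply Subtype.ext
  rw [← M3.toM_ofM s.1, ← M3.toM_ofM t.1]
  exact congrArg M3.toM h

theorem raw_mul (s t : SL34) : (s * t).raw = M3.mul s.raw t.raw := by
  have : M3.toM (s * t).raw = M3.toM (M3.mul s.raw t.raw) := by
    rw [M3.toM_mul, raw, raw, raw, M3.toM_ofM, M3.toM_ofM, M3.toM_ofM]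
    rfl
  rw [← M3.ofM_toM (s * t).raw, this, M3.ofM_toM]

/-- The element of the group with the given entries. -/
def mk (m : M3) (h : m.det = 1) : SL34 := ⟨M3.toM m, by rw [M3.det_toM, h]⟩

theorem raw_mk (m : M3) (h : m.det = 1) : (mk m h).raw = m := rfl

theorem raw_inv (s : SL34) : (s⁻¹).raw = M3.adj s.raw := by
  have h1 : M3.toM (M3.adj s.raw) * s.1 = 1 := by
    have := M3.toM_adj_mul s.raw s.raw_det
    rwa [raw, M3.toM_ofM] at this
  have h2 : (s⁻¹ : SL34).1 = M3.toM (M3.adj s.raw) := by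
    have h3 : s.1 * (s⁻¹ : SL34).1 = 1 := by
      exact congrArg Subtype.val (mul_inv_cancel s)
    calc (s⁻¹ : SL34).1 = (M3.toM (M3.adj s.raw) * s.1) * (s⁻¹ : SL34).1 := by rw [h1, one_mul]
      _ = _ := by rw [mul_assoc, h3, mul_one]
  rw [raw, h2, M3.ofM_toM]

theorem raw_conj (x t : SL34) : (x * t * x⁻¹).raw = M3.conj x.raw t.raw := by
  rw [raw_mul, raw_mul, raw_inv, M3.conj]

theorem raw_one : (1 : SL34).raw = ⟨q1, q0, q0, q0, q1, q0, q0, q0, q1⟩ := by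
  simp [raw, M3.ofM]
  decide

end SL34

/-! ### Normalised central characters -/

/-- A normalised central character of a finite group: a class function `ψ` with `ψ 1 = 1` such that
`ψ h * ψ g` is the average of `ψ (x * h * x⁻¹ * g)`. -/
structure IsCentralChar {G K : Type*} [Group G] [Fintype G] [Field K] (ψ : G → K) : Prop where
  one : ψ 1 = 1
  conj : ∀ x g, ψ (x * g * x⁻¹) = ψ g
  mul : ∀ h g, ∑ x, ψ (x * h * x⁻¹ * g) = (Fintype.card G : K) * (ψ h * ψ g)

namespace IsCentralChar

section

variable {G K : Type*} [Group G] [Fintype G] [Field K] [CharZero K] {ψ : G → K}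

theorem card_ne_zero : (Fintype.card G : K) ≠ 0 := Nat.cast_ne_zero.2 Fintype.card_ne_zero

theorem map_mul_of_commute (hψ : IsCentralChar ψ) {z : G} (hz : ∀ x, x * z = z * x) (g : G) :
    ψ (z * g) = ψ z * ψ g := by
  have h := hψ.mul z g
  have h2 : ∀ x : G, x * z * x⁻¹ * g = z * g := fun x => by rw [hz, mul_inv_cancel_right]
  simp only [h2, Finset.sum_const, Finset.card_univ, nsmul_eq_mul] at h
  exact mul_left_cancel₀ card_ne_zero h

/-- Three distinct normalised central characters are not collinear. -/
theorem eq_or_eq_of_affine {ψ₁ ψ₂ ψ₃ : G → K} (h₁ : IsCentralChar ψ₁) (h₂ : IsCentralChar ψ₂)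
    (h₃ : IsCentralChar ψ₃) (α : K) (h : ∀ g, ψ₃ g = α * ψ₁ g + (1 - α) * ψ₂ g) :
    ψ₁ = ψ₂ ∨ ψ₃ = ψ₁ ∨ ψ₃ = ψ₂ := by
  -- For an affine combination, the multiplication rule fails exactly by the mixed term
  -- α(1-α)(ψ₁(a)-ψ₂(a))(ψ₁(g)-ψ₂(g)).
  have key : ∀ a g, α * (1 - α) * ((ψ₁ a - ψ₂ a) * (ψ₁ g - ψ₂ g)) = 0 := fun a g => by
    have e := h₃.mul a g
    simp only [h, Finset.sum_add_distrib, ← Finset.mul_sum, h₁.mul, h₂.mul] at e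
    apply mul_left_cancel₀ (card_ne_zero (G := G) (K := K))
    linear_combination e
  by_cases hd : ψ₁ = ψ₂
  · exact Or.inl hd
  obtain ⟨a, ha⟩ := Function.ne_iff.1 hd
  have ha' : ψ₁ a - ψ₂ a ≠ 0 := sub_ne_zero.2 ha
  have := key a a
  simp only [mul_eq_zero, ha', or_self, or_false] at this
  rcases this with h0 | h0
  · right; right; funext g; rw [h, h0]; ring
  · right; left; funext g; rw [h, h0]; linear_combination (-ψ₁ g) * h0

end

end IsCentralChar

/-! ### Cyclic vectors and conjugacy -/

namespace M3

/-- The matrix with columns `v`, `m v`, `m² v`. -/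
def krylov (m : M3) (x y z : F4) : M3 :=
  let x1 := dot m.a m.b m.c x y z
  let y1 := dot m.d m.e m.f x y z
  let z1 := dot m.g m.h m.i x y z
  ⟨x, x1, dot m.a m.b m.c x1 y1 z1, y, y1, dot m.d m.e m.f x1 y1 z1,
    z, z1, dot m.g m.h m.i x1 y1 z1⟩

theorem det_krylov (m : M3) (x y z : F4) : (krylov m x y z).det = cyc m x y z := by
  simp only [cyc, strict_eq]; rfl

/-- The companion matrix of the characteristic polynomial. -/
def companion (m : M3) : M3 := ⟨q0, q0, q1, q1, q0, e2 m, q0, q1, tr m⟩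

/-- Cayley–Hamilton: m³v is the combination of v, mv, m²v prescribed by the last column of
`companion`. -/
theorem mul_krylov {m : M3} (hm : m.det = 1) (x y z : F4) :
    mul m (krylov m x y z) = mul (krylov m x y z) (companion m) := by
  have h2 := two_eq_zero
  obtain ⟨a, b, c, d, e, f, g, h, i⟩ := m
  simp only [det, det_eq] at hm
  rw [mul_eq, mul_eq]
  simp only [krylov, companion, dot_eq, e2, tr, add_def, minor_eq, q0_eq, q1_eq]
  have cayley : ∀ a b c d e f g h i x y z : F4,
      (a * (a * (a*x+(b*y+c*z)) + (b * (d*x+(e*y+f*z)) + c * (g*x+(h*y+i*z))))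
      + (b * (d * (a*x+(b*y+c*z)) + (e * (d*x+(e*y+f*z)) + f * (g*x+(h*y+i*z))))
      + c * (g * (a*x+(b*y+c*z)) + (h * (d*x+(e*y+f*z)) + i * (g*x+(h*y+i*z))))))
      - (a + e + i) * (a * (a*x+(b*y+c*z)) + (b * (d*x+(e*y+f*z)) + c * (g*x+(h*y+i*z))))
      + ((a*e-b*d)+((a*i-c*g)+(e*i-f*h))) * (a*x+(b*y+c*z))
      - (a*(e*i-f*h)+(b*(f*g-d*i)+c*(d*h-e*g))) * x = 0 := by intros; ring
  simp only [sub_eq_add] at cayley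
  simp only [M3.mk.injEq]
  refine ⟨by ring, by ring, ?_, by ring, by ring, ?_, by ring, by ring, ?_⟩
  · have := cayley a b c d e f g h i x y z
    linear_combination this - x * hm - ((a + e + i) * (a * (a*x+(b*y+c*z)) + (b * (d*x+(e*y+f*z))
      + c * (g*x+(h*y+i*z)))) + ((a*e+b*d)+((a*i+c*g)+(e*i+f*h))) * (a*x+(b*y+c*z)) + x) * h2
  · have := cayley e d f b a c h g i y x z
    linear_combination this - y * hm - ((a + e + i) * (d * (a*x+(b*y+c*z)) + (e * (d*x+(e*y+f*z))
      + f * (g*x+(h*y+i*z)))) + ((a*e+b*d)+((a*i+c*g)+(e*i+f*h))) * (d*x+(e*y+f*z)) + y) * h2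
  · have := cayley i h g f e d c b a z y x
    linear_combination this - z * hm - ((a + e + i) * (g * (a*x+(b*y+c*z)) + (h * (d*x+(e*y+f*z))
      + i * (g*x+(h*y+i*z)))) + ((a*e+b*d)+((a*i+c*g)+(e*i+f*h))) * (g*x+(h*y+i*z)) + z) * h2

end M3

namespace SL34

/-- Both elements are conjugate to c, by P and by Q. Equal determinants put the conjugating matrix
PQ⁻¹ into the special linear group. -/
theorem exists_conj_of_intertwines {s t : SL34} (p q : M3) (c : M3) (hpq : p.det = q.det)
    (hq : q.det ≠ 0) (hp : M3.mul s.raw p = M3.mul p c) (hq' : M3.mul t.raw q = M3.mul q c) :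
    ∃ x : SL34, s = x * t * x⁻¹ := by
  set P := M3.toM p
  set Q := M3.toM q
  have hQ : IsUnit Q.det := by rw [M3.det_toM]; exact isUnit_iff_ne_zero.2 hq
  have h1 : s.1 * P = P * M3.toM c := by
    have := congrArg M3.toM hp
    rwa [M3.toM_mul, M3.toM_mul, raw, M3.toM_ofM] at this
  have h2 : t.1 * Q = Q * M3.toM c := by
    have := congrArg M3.toM hq'
    rwa [M3.toM_mul, M3.toM_mul, raw, M3.toM_ofM] at this
  refine ⟨⟨P * Q⁻¹, ?_⟩, eq_mul_inv_of_mul_eq (Subtype.ext ?_)⟩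
  · rw [Matrix.det_mul, Matrix.det_nonsing_inv, M3.det_toM, hpq, ← M3.det_toM]
    exact Ring.mul_inverse_cancel _ hQ
  · change s.1 * (P * Q⁻¹) = P * Q⁻¹ * t.1
    calc s.1 * (P * Q⁻¹) = P * M3.toM c * Q⁻¹ := by rw [← mul_assoc, h1]
      _ = P * (Q⁻¹ * (Q * M3.toM c)) * Q⁻¹ := by
        rw [← mul_assoc Q⁻¹, Matrix.nonsing_inv_mul _ hQ, one_mul]
      _ = P * Q⁻¹ * t.1 * (Q * Q⁻¹) := by rw [← h2]; simp only [mul_assoc]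
      _ = _ := by rw [Matrix.mul_nonsing_inv _ hQ, mul_one]

/-- Elements with the same characteristic polynomial and cyclic vectors of the same determinant are
conjugate. -/
theorem exists_conj_of_cyc {s t : SL34} (htr : M3.tr s.raw = M3.tr t.raw)
    (he : M3.e2 s.raw = M3.e2 t.raw) (x y z x' y' z' : F4)
    (h : M3.cyc s.raw x y z = M3.cyc t.raw x' y' z') (h0 : M3.cyc t.raw x' y' z' ≠ 0) :
    ∃ u : SL34, s = u * t * u⁻¹ := by
  refine exists_conj_of_intertwines (M3.krylov s.raw x y z) (M3.krylov t.raw x' y' z')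
    (M3.companion t.raw) (by rw [M3.det_krylov, M3.det_krylov, h]) (by rwa [M3.det_krylov]) ?_
    (M3.mul_krylov t.raw_det _ _ _)
  rw [M3.mul_krylov s.raw_det, M3.companion, htr, he]
  rfl

end SL34

/-! ### Classification of the conjugacy classes of SL₃(4) -/

namespace F4

/-- Universal quantification over the field. -/
def all (p : F4 → Bool) : Bool := p q0 && (p q1 && (p q2 && p q3))

theorem all_eq_true {p : F4 → Bool} (h : all p = true) (x : F4) : p x = true := by
  simp only [all, Bool.and_eq_true] at h
  cases x
  exacts [h.1, h.2.1, h.2.2.1, h.2.2.2]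

/-- Existential quantification over the field. -/
def any (p : F4 → Bool) : Bool := p q0 || (p q1 || (p q2 || p q3))

theorem exists_of_any {p : F4 → Bool} (h : any p = true) : ∃ x, p x = true := by
  simp only [any, Bool.or_eq_true] at h
  rcases h with h | h | h | h
  exacts [⟨_, h⟩, ⟨_, h⟩, ⟨_, h⟩, ⟨_, h⟩]

/-- Whether two elements are equal. -/
def beq : F4 → F4 → Bool
  | q0, q0 => true
  | q1, q1 => true
  | q2, q2 => true
  | q3, q3 => true
  | _, _ => false

theorem eq_of_beq {x y : F4} (h : beq x y = true) : x = y := by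
  cases x <;> cases y <;> first | rfl | exact absurd h (by decide)

end F4

namespace M3

theorem isScalar_iff {m : M3} : isScalar m = true ↔ ∃ a, m = ⟨a, q0, q0, q0, a, q0, q0, q0, a⟩ := by
  constructor
  · obtain ⟨a, b, c, d, e, f, g, h, i⟩ := m
    intro hm
    cases b <;> try (exact absurd hm Bool.false_ne_true)
    cases c <;> try (exact absurd hm Bool.false_ne_true)
    cases d <;> try (exact absurd hm Bool.false_ne_true)
    cases f <;> try (exact absurd hm Bool.false_ne_true)
    cases g <;> try (exact absurd hm Bool.false_ne_true)
    cases h <;> try (exact absurd hm Bool.false_ne_true)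
    refine ⟨a, ?_⟩
    cases a <;> cases e <;> cases i <;> first | rfl | exact absurd hm (by decide)
  · rintro ⟨a, rfl⟩
    cases a <;> rfl

theorem exists_third (x y z x1 y1 z1 : F4)
    (h : ¬ (y * z1 + z * y1 = 0 ∧ x * z1 + z * x1 = 0 ∧ x * y1 + y * x1 = 0)) :
    ∃ u1 u2 u3, (⟨x, x1, u1, y, y1, u2, z, z1, u3⟩ : M3).det = 1 := by
  simp only [det, det_eq]
  by_cases h1 : y * z1 + z * y1 = 0
  · by_cases h3 : x * z1 + z * x1 = 0
    · have h4 : x * y1 + y * x1 ≠ 0 := fun h4 => h ⟨h1, h3, h4⟩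
      refine ⟨0, 0, (x * y1 + y * x1)⁻¹, ?_⟩
      linear_combination inv_mul_cancel₀ h4
    · refine ⟨0, (x * z1 + z * x1)⁻¹, 0, ?_⟩
      linear_combination inv_mul_cancel₀ h3
  · refine ⟨(y * z1 + z * y1)⁻¹, 0, 0, ?_⟩
    linear_combination inv_mul_cancel₀ h1

/-- The product of a matrix and a column vector is not collinear with the vector. -/
def NotEigen (m : M3) (x y z : F4) : Prop :=
  ¬ (y * dot m.g m.h m.i x y z + z * dot m.d m.e m.f x y z = 0 ∧
    x * dot m.g m.h m.i x y z + z * dot m.a m.b m.c x y z = 0 ∧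
    x * dot m.d m.e m.f x y z + y * dot m.a m.b m.c x y z = 0)

/-- A matrix having e₁, e₂, e₃ as eigenvectors is diagonal; e₁+e₂ and e₂+e₃ then make its diagonal
entries equal. -/
theorem exists_notEigen {m : M3} (hm : isScalar m ≠ true) : ∃ x y z, NotEigen m x y z := by
  by_contra! hc
  have h1 := hc 1 0 0
  have h2 := hc 0 1 0
  have h3 := hc 0 0 1
  have h4 := hc 1 1 0
  have h5 := hc 0 1 1
  obtain ⟨a, b, c, d, e, f, g, h, i⟩ := m
  simp only [NotEigen, dot_eq, not_not, mul_zero, mul_one, zero_mul, one_mul, add_zero, zero_add,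
    true_and] at h1 h2 h3 h4 h5
  obtain ⟨rfl, rfl⟩ := h1
  obtain ⟨rfl, -, rfl⟩ := h2
  obtain ⟨rfl, rfl, -⟩ := h3
  apply hm
  rw [isScalar_iff]
  have hs : ∀ u v : F4, u + v = 0 → u = v := by
    intro u v; cases u <;> cases v <;> first | (intro _; rfl) | (intro h; exact absurd h (by decide))
  have e1 : e = a := hs _ _ (by simpa using h4.2.2)
  have e2 : i = e := hs _ _ (by simpa using h5.1)
  subst e1 e2
  exact ⟨_, rfl⟩

end M3

namespace SL34

/-- A non-scalar element is conjugate to one sending the first basis vector to the second. -/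
theorem exists_conj_first_column {s : SL34} (hs : M3.isScalar s.raw ≠ true) :
    ∃ x c : SL34, s = x * c * x⁻¹ ∧ c.raw.a = q0 ∧ c.raw.d = q1 ∧ c.raw.g = q0 := by
  obtain ⟨x, y, z, hv⟩ := M3.exists_notEigen hs
  obtain ⟨u1, u2, u3, hu⟩ := M3.exists_third _ _ _ _ _ _ hv
  set P := mk _ hu with hP
  have hcol : ∀ j, (s.1 * P.1) j 0 = P.1 j 1 := by
    have : (s * P).raw.a = P.raw.b ∧ (s * P).raw.d = P.raw.e ∧ (s * P).raw.g = P.raw.h := by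
      rw [raw_mul, M3.mul_eq, hP, raw_mk]
      exact ⟨rfl, rfl, rfl⟩
    intro j
    fin_cases j
    exacts [this.1, this.2.1, this.2.2]
  have hc : ∀ i, (P⁻¹ * (s * P)).1 i 0 = (1 : Matrix (Fin 3) (Fin 3) F4) i 1 := fun i => by
    change (P⁻¹.1 * (s.1 * P.1)) i 0 = _
    rw [Matrix.mul_apply]
    simp only [hcol]
    rw [← Matrix.mul_apply]
    exact congrFun (congrFun (congrArg Subtype.val (inv_mul_cancel P)) i) 1
  exact ⟨P, P⁻¹ * (s * P), by group, hc 0, hc 1, hc 2⟩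

theorem tr_conj (x c : SL34) : M3.tr (x * c * x⁻¹).raw = M3.tr c.raw := by
  have h : ∀ s : SL34, M3.tr s.raw = Matrix.trace s.1 := fun s => by
    rw [Matrix.trace_fin_three, add_assoc]; rfl
  rw [h, h]
  change Matrix.trace (x.1 * c.1 * (x⁻¹).1) = _
  rw [Matrix.trace_mul_comm, ← mul_assoc]
  have : (x⁻¹).1 * x.1 = 1 := congrArg Subtype.val (inv_mul_cancel x)
  rw [this, one_mul]

theorem e2_eq (s : SL34) : M3.e2 s.raw = M3.tr (s⁻¹).raw := by
  rw [raw_inv, M3.adj, M3.mk'_eq]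
  simp only [M3.e2, M3.tr, add_def]
  ring

theorem e2_conj (x c : SL34) : M3.e2 (x * c * x⁻¹).raw = M3.e2 c.raw := by
  rw [e2_eq, e2_eq, ← tr_conj x c⁻¹]
  congr 2
  group

theorem krylov_conj {m c p : M3} (h : M3.mul m p = M3.mul p c) (x y z : F4) :
    M3.krylov m (dot p.a p.b p.c x y z) (dot p.d p.e p.f x y z) (dot p.g p.h p.i x y z) =
      M3.mul p (M3.krylov c x y z) := by
  rw [M3.mul_eq, M3.mul_eq] at h
  simp only [M3.mk.injEq] at h
  obtain ⟨h1, h2, h3, h4, h5, h6, h7, h8, h9⟩ := h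
  have act1 : ∀ x y z, dot m.a m.b m.c (dot p.a p.b p.c x y z) (dot p.d p.e p.f x y z)
      (dot p.g p.h p.i x y z) = dot p.a p.b p.c (dot c.a c.b c.c x y z) (dot c.d c.e c.f x y z)
      (dot c.g c.h c.i x y z) := fun x y z => by
    simp only [dot_eq] at *
    linear_combination x * h1 + y * h2 + z * h3
  have act2 : ∀ x y z, dot m.d m.e m.f (dot p.a p.b p.c x y z) (dot p.d p.e p.f x y z)
      (dot p.g p.h p.i x y z) = dot p.d p.e p.f (dot c.a c.b c.c x y z) (dot c.d c.e c.f x y z)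
      (dot c.g c.h c.i x y z) := fun x y z => by
    simp only [dot_eq] at *
    linear_combination x * h4 + y * h5 + z * h6
  have act3 : ∀ x y z, dot m.g m.h m.i (dot p.a p.b p.c x y z) (dot p.d p.e p.f x y z)
      (dot p.g p.h p.i x y z) = dot p.g p.h p.i (dot c.a c.b c.c x y z) (dot c.d c.e c.f x y z)
      (dot c.g c.h c.i x y z) := fun x y z => by
    simp only [dot_eq] at *
    linear_combination x * h7 + y * h8 + z * h9
  rw [M3.mul_eq]
  simp only [M3.krylov, act1, act2, act3]

/-- The vector xv has, for the conjugate by x, the Krylov matrix of v multiplied by x, whose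
determinant is 1. -/
theorem exists_cyc_conj {x c : SL34} {d : F4} (h : ∃ a b e, M3.cyc c.raw a b e = d) :
    ∃ a b e, M3.cyc (x * c * x⁻¹).raw a b e = d := by
  obtain ⟨a, b, e, h⟩ := h
  have hm : M3.mul (x * c * x⁻¹).raw x.raw = M3.mul x.raw c.raw := by
    rw [← raw_mul, ← raw_mul]
    congr 1
    group
  refine ⟨_, _, _, (M3.det_krylov ..).symm.trans ((congrArg M3.det (krylov_conj hm a b e)).trans ?_)⟩
  rw [← M3.det_toM, M3.toM_mul, Matrix.det_mul, M3.det_toM, M3.det_toM, raw_det, M3.det_krylov,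
    one_mul, h]

/-- The central element `ω`. -/
def omega : SL34 := mk ⟨q2, q0, q0, q0, q2, q0, q0, q0, q2⟩ (by decide)

/-- Representatives of the conjugacy classes modulo the centre. -/
def rep : ℕ → SL34
  | 0 => 1
  | 1 => mk (M3.uu q0 q1 q0) (by decide)
  | 2 => mk (M3.rep q1 q1 q1) (by decide)
  | 3 => mk (M3.rep q1 q1 q2) (by decide)
  | 4 => mk (M3.rep q1 q1 q3) (by decide)
  | 5 => mk (M3.rep q3 q3 q1) (by decide)
  | 6 => mk (M3.rep q2 q2 q1) (by decide)
  | 7 => mk (M3.rep q0 q1 q1) (by decide)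
  | 8 => mk (M3.rep q1 q0 q1) (by decide)
  | _ => mk (M3.rep q0 q0 q1) (by decide)

theorem omega_mul_raw (s : SL34) : (omega * s).raw = ⟨q2 * s.raw.a, q2 * s.raw.b, q2 * s.raw.c,
    q2 * s.raw.d, q2 * s.raw.e, q2 * s.raw.f, q2 * s.raw.g, q2 * s.raw.h, q2 * s.raw.i⟩ := by
  rw [raw_mul, M3.mul_eq]
  simp [omega, raw_mk, dot_eq, q0_eq]

/-- Representative of the class with a given label. -/
def ofLabel (j : ℕ) : SL34 := omega ^ (j % 3) * rep (j / 3)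

/-- The scalar `ω ^ k`. -/
def scal : ℕ → F4
  | 0 => q1
  | 1 => q2
  | _ => q3

theorem raw_ofLabel (j : ℕ) : (ofLabel j).raw =
    M3.mul ⟨scal (j % 3), q0, q0, q0, scal (j % 3), q0, q0, q0, scal (j % 3)⟩ (rep (j / 3)).raw := by
  rw [ofLabel, raw_mul]
  congr 1
  have := Nat.mod_lt j (by norm_num : 3 > 0)
  interval_cases j % 3
  · rw [pow_zero, raw_one]; rfl
  · rw [pow_one]; rfl
  · rw [pow_two, raw_mul]; rfl

end SL34

namespace M3

/-- The assertion about matrices sending the first basis vector to the second that is needed for the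
classification of conjugacy classes. -/
def columnCheck (m : M3) : Bool :=
  match F4.beq m.det q1 with
  | false => true
  | true =>
    let scalarCase (s : F4) : Bool := match isScalar (mul m m) with
      | true => F4.any fun x => F4.any fun y => F4.any fun z =>
          -- Conjugation into s times a transvection with third column e₁ forces the first column
          -- s⁻¹(m - s)e₁ = (1, s², 0). Only the second column has to be searched for.
          let p : M3 := ⟨q1, x, q1, F4.mul s s, y, q0, q0, z, q0⟩
          F4.beq p.det q1 && (match mul m p, mul p ⟨s, q0, s, q0, s, q0, q0, q0, s⟩ with
            | ⟨a, b, c, d, e, f, g, h, i⟩, ⟨a', b', c', d', e', f', g', h', i'⟩ =>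
              F4.beq a a' && (F4.beq b b' && (F4.beq c c' && (F4.beq d d' && (F4.beq e e' &&
                (F4.beq f f' && (F4.beq g g' && (F4.beq h h' && F4.beq i i'))))))))
      | false => Nat.blt (lab m) 28
    match tr m, e2 m with
    | q1, q1 => scalarCase q1
    | q2, q3 => scalarCase q2
    | q3, q2 => scalarCase q3
    | _, _ => F4.any fun x => F4.any fun y => F4.any fun z => F4.beq (cyc m x y z) q1

/-- These 4096 matrices are enough, since every non-scalar element is conjugate to one that maps e₁
to e₂. -/
theorem columnCheck_all : (F4.all fun b => F4.all fun c => F4.all fun e => F4.all fun f =>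
    F4.all fun h => F4.all fun i => columnCheck ⟨q0, b, c, q1, e, f, q0, h, i⟩) = true := by
  decide +kernel

end M3

namespace SL34

/-- The pairs of coefficients of the characteristic polynomials of scalar multiples of unipotent
elements. -/
def UniPair (s : ℕ) (m : M3) : Prop := M3.tr m = scal s ∧ M3.e2 m = scal (2 * s % 3)

theorem columnCheck_eq_true {c : SL34} (ha : c.raw.a = q0) (hd : c.raw.d = q1) (hg : c.raw.g = q0) :
    M3.columnCheck c.raw = true := by
  have h := M3.columnCheck_all
  have h1 := all_eq_true (all_eq_true (all_eq_true (all_eq_true (all_eq_true (all_eq_true h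
    c.raw.b) c.raw.c) c.raw.e) c.raw.f) c.raw.h) c.raw.i
  rw [← ha, ← hd] at h1
  have h2 : (⟨c.raw.a, c.raw.b, c.raw.c, c.raw.d, c.raw.e, c.raw.f, c.raw.a, c.raw.h, c.raw.i⟩ : M3)
      = c.raw := by
    have : c.raw.a = c.raw.g := ha.trans hg.symm
    nth_rw 2 [this]
  rwa [h2] at h1

theorem beq_det (c : SL34) : F4.beq c.raw.det q1 = true := by rw [raw_det]; rfl

theorem uniPair_of_isScalar {s : SL34} (h : M3.isScalar s.raw = true) :
    UniPair 0 s.raw ∨ UniPair 1 s.raw ∨ UniPair 2 s.raw := by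
  obtain ⟨a, ha⟩ := M3.isScalar_iff.1 h
  have hd := s.raw_det
  rw [ha] at hd ⊢
  cases a
  · exact absurd hd (by decide)
  · exact Or.inl ⟨rfl, rfl⟩
  · exact Or.inr (Or.inl ⟨rfl, rfl⟩)
  · exact Or.inr (Or.inr ⟨rfl, rfl⟩)

/-- Conjugation to first column e₂ reduces this to the finite check. With a cyclic vector of
determinant 1, trace and second coefficient alone determine the class. -/
theorem exists_cyc_eq_one {s : SL34}
    (h : ¬ (UniPair 0 s.raw ∨ UniPair 1 s.raw ∨ UniPair 2 s.raw)) :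
    ∃ a b e, M3.cyc s.raw a b e = q1 := by
  obtain ⟨x, c, rfl, ha, hd, hg⟩ := exists_conj_first_column (fun hs => h (uniPair_of_isScalar hs))
  apply exists_cyc_conj
  simp only [UniPair, tr_conj, e2_conj] at h
  have hc := columnCheck_eq_true ha hd hg
  rw [M3.columnCheck, beq_det] at hc
  have hc' : (F4.any fun x => F4.any fun y => F4.any fun z =>
      F4.beq (M3.cyc c.raw x y z) q1) = true := by
    revert hc h
    cases M3.tr c.raw <;> cases M3.e2 c.raw <;> intro h hc <;>
      first | exact hc | exact absurd h (by decide)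
  obtain ⟨a, hc'⟩ := exists_of_any hc'
  obtain ⟨b, hc'⟩ := exists_of_any hc'
  obtain ⟨e, hc'⟩ := exists_of_any hc'
  exact ⟨a, b, e, eq_of_beq hc'⟩

theorem uni_columnCheck {c : SL34} {k : ℕ} (hk : k < 3) (ha : c.raw.a = q0) (hd : c.raw.d = q1)
    (hg : c.raw.g = q0) (hu : UniPair k c.raw) :
    (match M3.isScalar (M3.mul c.raw c.raw) with
      | true => F4.any fun x => F4.any fun y => F4.any fun z =>
          let p : M3 := ⟨q1, x, q1, F4.mul (scal k) (scal k), y, q0, q0, z, q0⟩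
          F4.beq p.det q1 && (match M3.mul c.raw p,
              M3.mul p ⟨scal k, q0, scal k, q0, scal k, q0, q0, q0, scal k⟩ with
            | ⟨a, b, c, d, e, f, g, h, i⟩, ⟨a', b', c', d', e', f', g', h', i'⟩ =>
              F4.beq a a' && (F4.beq b b' && (F4.beq c c' && (F4.beq d d' && (F4.beq e e' &&
                (F4.beq f f' && (F4.beq g g' && (F4.beq h h' && F4.beq i i'))))))))
      | false => Nat.blt (M3.lab c.raw) 28) = true := by
  have hc := columnCheck_eq_true ha hd hg
  rw [M3.columnCheck, beq_det] at hc
  obtain ⟨h1, h2⟩ := hu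
  interval_cases k <;> rw [h1, h2] at hc <;> exact hc

theorem isScalar_sq_conj (x c : SL34) (h : M3.isScalar (M3.mul (x * c * x⁻¹).raw (x * c * x⁻¹).raw)
    = true) : M3.isScalar (M3.mul c.raw c.raw) = true := by
  rw [← raw_mul] at h ⊢
  obtain ⟨a, ha⟩ := M3.isScalar_iff.1 h
  refine M3.isScalar_iff.2 ⟨a, ?_⟩
  have key : (x * c * x⁻¹ * (x * c * x⁻¹)).1 = a • (1 : Matrix (Fin 3) (Fin 3) F4) := by
    rw [← M3.toM_ofM (x * c * x⁻¹ * (x * c * x⁻¹)).1]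
    change M3.toM (x * c * x⁻¹ * (x * c * x⁻¹)).raw = _
    rw [ha]
    ext i j
    fin_cases i <;> fin_cases j <;> simp [M3.toM, q0_eq]
  have h2 : (c * c).1 = a • (1 : Matrix (Fin 3) (Fin 3) F4) := by
    have : c * c = x⁻¹ * (x * c * x⁻¹ * (x * c * x⁻¹)) * x := by group
    rw [this]
    change (x⁻¹).1 * (x * c * x⁻¹ * (x * c * x⁻¹)).1 * x.1 = _
    rw [key, Matrix.mul_smul, Matrix.smul_mul, mul_one]
    congr 1
    exact congrArg Subtype.val (inv_mul_cancel x)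
  rw [raw, h2]
  simp [M3.ofM, q0_eq]

/-- Non-scalar elements with scalar square are multiples of transvections. -/
theorem exists_conj_transvection {s : SL34} {k : ℕ} (hk : k < 3) (hu : UniPair k s.raw)
    (h1 : M3.isScalar (M3.mul s.raw s.raw) = true) (h2 : M3.isScalar s.raw ≠ true) :
    ∃ x : SL34, s = x * ofLabel (3 + k) * x⁻¹ := by
  obtain ⟨x, c, rfl, ha, hd, hg⟩ := exists_conj_first_column h2
  simp only [UniPair, tr_conj, e2_conj] at hu
  have hc := uni_columnCheck hk ha hd hg hu
  rw [isScalar_sq_conj x c h1] at hc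
  obtain ⟨p1, hc⟩ := exists_of_any hc
  obtain ⟨p2, hc⟩ := exists_of_any hc
  obtain ⟨p3, hc⟩ := exists_of_any hc
  simp only [Bool.and_eq_true] at hc
  obtain ⟨hp, e1, e2, e3, e4, e5, e6, e7, e8, e9⟩ := hc
  have hdet := eq_of_beq hp
  set p : M3 := ⟨q1, p1, q1, F4.mul (scal k) (scal k), p2, q0, q0, p3, q0⟩
  have hm : M3.mul c.raw p =
      M3.mul p ⟨scal k, q0, scal k, q0, scal k, q0, q0, q0, scal k⟩ := by
    rw [M3.mul_eq, M3.mul_eq] at *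
    simp only [M3.mk.injEq]
    exact ⟨eq_of_beq e1, eq_of_beq e2, eq_of_beq e3, eq_of_beq e4, eq_of_beq e5, eq_of_beq e6,
      eq_of_beq e7, eq_of_beq e8, eq_of_beq e9⟩
  have ht : (ofLabel (3 + k)).raw = ⟨scal k, q0, scal k, q0, scal k, q0, q0, q0, scal k⟩ := by
    rw [raw_ofLabel]
    interval_cases k <;> rfl
  rw [← ht] at hm
  set P := mk p hdet
  have hP : c = P * ofLabel (3 + k) * P⁻¹ :=
    eq_mul_inv_of_mul_eq (raw_injective (by rw [raw_mul, raw_mul, raw_mk, hm]))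
  refine ⟨x * P, ?_⟩
  rw [hP]
  group

theorem conj_of_cyc_eq {s : SL34} {j : ℕ} {a b e d : F4} (h : M3.cyc s.raw a b e = d) (hd : d ≠ q0)
    (h1 : M3.tr s.raw = M3.tr (ofLabel j).raw) (h2 : M3.e2 s.raw = M3.e2 (ofLabel j).raw)
    (h3 : M3.cyc (ofLabel j).raw q1 q0 q0 = d) : ∃ x : SL34, s = x * ofLabel j * x⁻¹ :=
  exists_conj_of_cyc h1 h2 a b e q1 q0 q0 (h.trans h3.symm) (h3 ▸ hd)

theorem conj_uni {s : SL34} {k : ℕ} (hk : k < 3) (hu : UniPair k s.raw)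
    (h : M3.uni k s.raw < 28) : ∃ x : SL34, s = x * ofLabel (M3.uni k s.raw) * x⁻¹ := by
  -- Labels 6 + 3i + k belong to ω^k times a regular unipotent with `cyc` equal to ω^i. The branches
  -- of `uni` below supply the cyclic vector.
  have key : ∀ a b e d, M3.cyc s.raw a b e = d → d ≠ q0 → ∀ i, scal i = d → i < 3 →
      ∃ x : SL34, s = x * ofLabel (Nat.add (6 + 3 * i) k) * x⁻¹ := by
    intro a b e d hc hd i hi hi3
    obtain ⟨h1, h2⟩ := hu
    refine conj_of_cyc_eq hc hd ?_ ?_ ?_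
    · rw [h1, raw_ofLabel]; interval_cases k <;> interval_cases i <;> rfl
    · rw [h2, raw_ofLabel]; interval_cases k <;> interval_cases i <;> rfl
    · rw [← hi, raw_ofLabel]; interval_cases k <;> interval_cases i <;> rfl
  rw [M3.uni] at h ⊢
  split at h
  next h1 =>
    split at h
    next h2 =>
      refine ⟨1, ?_⟩
      obtain ⟨a, ha⟩ := M3.isScalar_iff.1 h2
      obtain ⟨h3, h4⟩ := hu
      rw [one_mul, inv_one, mul_one]
      apply raw_injective
      rw [raw_ofLabel]
      rw [ha] at h3 ⊢
      interval_cases k <;> cases a <;> first | rfl | exact absurd h3 (by decide)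
    next h2 =>
      exact exists_conj_transvection hk hu h1 (by rw [h2]; decide)
  next h1 =>
    split at h
    next hc => exact key _ _ _ _ hc (by decide) 0 rfl (by decide)
    next hc => exact key _ _ _ _ hc (by decide) 1 rfl (by decide)
    next hc => exact key _ _ _ _ hc (by decide) 2 rfl (by decide)
    next =>
      split at h
      next hc => exact key _ _ _ _ hc (by decide) 0 rfl (by decide)
      next hc => exact key _ _ _ _ hc (by decide) 1 rfl (by decide)
      next hc => exact key _ _ _ _ hc (by decide) 2 rfl (by decide)
      next =>
        split at h
        next hc => exact key _ _ _ _ hc (by decide) 0 rfl (by decide)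
        next hc => exact key _ _ _ _ hc (by decide) 1 rfl (by decide)
        next hc => exact key _ _ _ _ hc (by decide) 2 rfl (by decide)
        next => exact absurd h (by decide)

/-- The label of an element determines its conjugacy class. -/
theorem exists_conj_ofLabel {s : SL34} (h : M3.lab s.raw < 28) :
    ∃ x : SL34, s = x * ofLabel (M3.lab s.raw) * x⁻¹ := by
  by_cases hu : UniPair 0 s.raw ∨ UniPair 1 s.raw ∨ UniPair 2 s.raw
  · rcases hu with hu | hu | hu
    · have hl : M3.lab s.raw = M3.uni 0 s.raw := by rw [M3.lab, hu.1, hu.2]; rfl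
      rw [hl] at h ⊢
      exact conj_uni (by norm_num) hu h
    · have hl : M3.lab s.raw = M3.uni 1 s.raw := by rw [M3.lab, hu.1, hu.2]; rfl
      rw [hl] at h ⊢
      exact conj_uni (by norm_num) hu h
    · have hl : M3.lab s.raw = M3.uni 2 s.raw := by rw [M3.lab, hu.1, hu.2]; rfl
      rw [hl] at h ⊢
      exact conj_uni (by norm_num) hu h
  · obtain ⟨a, b, e, hc⟩ := exists_cyc_eq_one hu
    have key : ∀ j, M3.lab s.raw = j → M3.tr s.raw = M3.tr (ofLabel j).raw →
        M3.e2 s.raw = M3.e2 (ofLabel j).raw → M3.cyc (ofLabel j).raw q1 q0 q0 = q1 →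
        ∃ x : SL34, s = x * ofLabel (M3.lab s.raw) * x⁻¹ := by
      rintro j rfl h1 h2 h3
      exact conj_of_cyc_eq hc (by decide) h1 h2 h3
    simp only [UniPair] at hu
    cases h1 : M3.tr s.raw <;> cases h2 : M3.e2 s.raw <;> rw [h1, h2] at hu <;>
      first
      | exact absurd hu (by decide)
      | exact key 15 (by rw [M3.lab, h1, h2])
          (by rw [raw_ofLabel, h1]; rfl) (by rw [raw_ofLabel, h2]; rfl) (by rw [raw_ofLabel]; rfl)
      | exact key 16 (by rw [M3.lab, h1, h2])
          (by rw [raw_ofLabel, h1]; rfl) (by rw [raw_ofLabel, h2]; rfl) (by rw [raw_ofLabel]; rfl)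
      | exact key 17 (by rw [M3.lab, h1, h2])
          (by rw [raw_ofLabel, h1]; rfl) (by rw [raw_ofLabel, h2]; rfl) (by rw [raw_ofLabel]; rfl)
      | exact key 18 (by rw [M3.lab, h1, h2])
          (by rw [raw_ofLabel, h1]; rfl) (by rw [raw_ofLabel, h2]; rfl) (by rw [raw_ofLabel]; rfl)
      | exact key 19 (by rw [M3.lab, h1, h2])
          (by rw [raw_ofLabel, h1]; rfl) (by rw [raw_ofLabel, h2]; rfl) (by rw [raw_ofLabel]; rfl)
      | exact key 20 (by rw [M3.lab, h1, h2])
          (by rw [raw_ofLabel, h1]; rfl) (by rw [raw_ofLabel, h2]; rfl) (by rw [raw_ofLabel]; rfl)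
      | exact key 21 (by rw [M3.lab, h1, h2])
          (by rw [raw_ofLabel, h1]; rfl) (by rw [raw_ofLabel, h2]; rfl) (by rw [raw_ofLabel]; rfl)
      | exact key 22 (by rw [M3.lab, h1, h2])
          (by rw [raw_ofLabel, h1]; rfl) (by rw [raw_ofLabel, h2]; rfl) (by rw [raw_ofLabel]; rfl)
      | exact key 23 (by rw [M3.lab, h1, h2])
          (by rw [raw_ofLabel, h1]; rfl) (by rw [raw_ofLabel, h2]; rfl) (by rw [raw_ofLabel]; rfl)
      | exact key 24 (by rw [M3.lab, h1, h2])
          (by rw [raw_ofLabel, h1]; rfl) (by rw [raw_ofLabel, h2]; rfl) (by rw [raw_ofLabel]; rfl)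
      | exact key 25 (by rw [M3.lab, h1, h2])
          (by rw [raw_ofLabel, h1]; rfl) (by rw [raw_ofLabel, h2]; rfl) (by rw [raw_ofLabel]; rfl)
      | exact key 26 (by rw [M3.lab, h1, h2])
          (by rw [raw_ofLabel, h1]; rfl) (by rw [raw_ofLabel, h2]; rfl) (by rw [raw_ofLabel]; rfl)
      | exact key 27 (by rw [M3.lab, h1, h2])
          (by rw [raw_ofLabel, h1]; rfl) (by rw [raw_ofLabel, h2]; rfl) (by rw [raw_ofLabel]; rfl)

/-- Every element is conjugate to one of the representatives. -/
theorem exists_label (s : SL34) : ∃ j < 28, ∃ x : SL34, s = x * ofLabel j * x⁻¹ := by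
  by_cases hl : M3.lab s.raw < 28
  · exact ⟨_, hl, exists_conj_ofLabel hl⟩
  by_cases hs : M3.isScalar s.raw = true
  · obtain ⟨a, ha⟩ := M3.isScalar_iff.1 hs
    rw [ha] at hl
    cases a <;> exact absurd hl (by decide)
  by_cases hu : UniPair 0 s.raw ∨ UniPair 1 s.raw ∨ UniPair 2 s.raw
  · obtain ⟨k, hk, hu⟩ : ∃ k < 3, UniPair k s.raw := by
      rcases hu with hu | hu | hu
      exacts [⟨0, by decide, hu⟩, ⟨1, by decide, hu⟩, ⟨2, by decide, hu⟩]
    by_cases h2 : M3.isScalar (M3.mul s.raw s.raw) = true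
    · exact ⟨3 + k, by omega, exists_conj_transvection hk hu h2 hs⟩
    -- The finite check bounds the label of the conjugate `c`, not that of the element itself.
    · obtain ⟨x, c, rfl, ha, hd, hg⟩ := exists_conj_first_column hs
      have hu' := hu
      simp only [UniPair, tr_conj, e2_conj] at hu'
      have hc := uni_columnCheck hk ha hd hg hu'
      by_cases h3 : M3.isScalar (M3.mul c.raw c.raw) = true
      · exfalso
        apply h2
        have := isScalar_sq_conj x⁻¹ (x * c * x⁻¹)
        rw [show x⁻¹ * (x * c * x⁻¹) * x⁻¹⁻¹ = c by group] at this
        exact this h3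
      · rw [Bool.not_eq_true] at h3
        rw [h3] at hc
        have hlt : M3.lab c.raw < 28 := Nat.blt_eq ▸ hc
        obtain ⟨y, hy⟩ := exists_conj_ofLabel hlt
        refine ⟨_, hlt, x * y, ?_⟩
        conv_lhs => rw [hy]
        group
  · exfalso
    apply hl
    simp only [UniPair] at hu
    rw [M3.lab]
    revert hu
    cases M3.tr s.raw <;> cases M3.e2 s.raw <;> intro hu <;>
      first | exact absurd hu (by decide) | exact Nat.le_of_ble_eq_true rfl

end SL34

/-! ### Transversals and sums over conjugates -/

/-- A family of representatives of the left cosets of a subgroup. -/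
def IsTransversal {G ι : Type*} [Group G] (H : Subgroup G) (x : ι → G) : Prop :=
  ∀ g, ∃! i, (x i)⁻¹ * g ∈ H

namespace IsTransversal

variable {G ι : Type*} [Group G] {H : Subgroup G} {x : ι → G}

theorem bijective (hx : IsTransversal H x) :
    Function.Bijective (fun p : ι × H => x p.1 * (p.2 : G)) := by
  constructor
  · rintro ⟨i, k⟩ ⟨j, l⟩ h
    simp only at h
    have hi : (x i)⁻¹ * (x i * (k : G)) ∈ H := by simp
    have hj : (x j)⁻¹ * (x i * (k : G)) ∈ H := by rw [h]; simp
    obtain rfl := (hx _).unique hi hj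
    simpa using h
  · intro g
    obtain ⟨i, hi, -⟩ := hx g
    exact ⟨(i, ⟨_, hi⟩), by simp⟩

theorem sum_eq [Fintype G] [Fintype ι] (hx : IsTransversal H x) {M : Type*} [AddCommMonoid M]
    (F : G → M) (hF : ∀ g, ∀ k ∈ H, F (g * k) = F g) :
    ∑ g, F g = Nat.card H • ∑ i, F (x i) := by
  classical
  have : Fintype H := Fintype.ofFinite H
  rw [← (Equiv.ofBijective _ hx.bijective).sum_comp, Fintype.sum_prod_type, Finset.smul_sum]
  refine Finset.sum_congr rfl fun i _ => ?_
  simp only [Equiv.ofBijective_apply]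
  rw [Finset.sum_congr rfl fun (k : H) _ => hF (x i) (k : G) k.2, Finset.sum_const, Finset.card_univ,
    Nat.card_eq_fintype_card]

theorem card_eq [Fintype G] [Fintype ι] (hx : IsTransversal H x) :
    Fintype.card G = Nat.card H * Fintype.card ι := by
  have := hx.sum_eq (fun _ => 1) (fun _ _ _ => rfl)
  simpa using this

theorem trans {κ : Type*} {H' : Subgroup G} {y : κ → G} (hx : IsTransversal H x) (hle : H' ≤ H)
    (hy : ∀ i, y i ∈ H) (hy' : ∀ g ∈ H, ∃! i, (y i)⁻¹ * g ∈ H') :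
    IsTransversal H' (fun p : ι × κ => x p.1 * y p.2) := by
  intro g
  obtain ⟨i, hi, hu⟩ := hx g
  obtain ⟨j, hj, hv⟩ := hy' _ hi
  refine ⟨(i, j), by simpa [mul_assoc] using hj, ?_⟩
  rintro ⟨i', j'⟩ h
  have h1 : (y j')⁻¹ * ((x i')⁻¹ * g) ∈ H' := by simpa [mul_assoc] using h
  have h2 : (x i')⁻¹ * g ∈ H := by
    have := H.mul_mem (hy j') (hle h1)
    simpa using this
  obtain rfl := hu _ h2
  obtain rfl := hv _ h1
  rfl

end IsTransversal

namespace IsCentralChar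

variable {G K : Type*} [Group G] [Fintype G] [Field K] [CharZero K] {ψ : G → K}

/-- The action of the sum of a union of conjugacy classes in the same fibre of a central
character, the union being the set of conjugates of a family stable under a subgroup. -/
theorem sum_conj {ι κ : Type*} [Fintype ι] [Fintype κ] {H : Subgroup G} {x : ι → G}
    (hψ : IsCentralChar ψ) (hx : IsTransversal H x) {f : κ → G} (hf : Function.Injective f)
    (hH : ∀ k ∈ H, ∀ i, ∃ j, k * f i * k⁻¹ = f j) {c : K} (hc : ∀ i, ψ (f i) = c) (g : G) :
    ∑ i, ∑ j, ψ (g * (x i * f j * (x i)⁻¹)) =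
      (Fintype.card ι * Fintype.card κ : K) * (c * ψ g) := by
  have hcomm : ∀ a b, ψ (a * b) = ψ (b * a) := fun a b => by
    rw [← hψ.conj b (a * b)]; congr 1; group
  -- H permutes the family f by conjugation, so the inner sum depends only on the coset of y. The
  -- average over the group thus becomes a sum over the transversal.
  have hF : ∀ y, ∀ k ∈ H, ∑ j, ψ (y * k * f j * (y * k)⁻¹ * g) = ∑ j, ψ (y * f j * y⁻¹ * g) := by
    intro y k hk
    choose σ hσ using hH k hk
    have hinj : Function.Injective σ := fun i j hij => by
      apply hf
      have := hσ i
      rw [hij, ← hσ j] at this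
      exact mul_left_cancel (mul_right_cancel this)
    rw [← (Equiv.ofBijective σ (Finite.injective_iff_bijective.1 hinj)).sum_comp
      (fun j => ψ (y * f j * y⁻¹ * g))]
    refine Finset.sum_congr rfl fun j _ => ?_
    rw [Equiv.ofBijective_apply, ← hσ]
    congr 1
    group
  have h1 := hx.sum_eq (fun y => ∑ j, ψ (y * f j * y⁻¹ * g)) hF
  rw [Finset.sum_comm] at h1
  simp only [hψ.mul, hc, Finset.sum_const, Finset.card_univ, nsmul_eq_mul] at h1
  have h2 : (Nat.card H : K) ≠ 0 := Nat.cast_ne_zero.2 Nat.card_pos.ne'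
  apply mul_left_cancel₀ h2
  simp only [hcomm g]
  rw [← h1, hx.card_eq]
  push_cast
  ring

end IsCentralChar

/-! ### Points, flags and the unipotent classes -/

namespace SL34

/-- The stabiliser of the line spanned by the first basis vector. -/
def parabolic : Subgroup SL34 where
  carrier := {s | s.raw.d = 0 ∧ s.raw.g = 0}
  one_mem' := by rw [Set.mem_ofPred_eq, raw_one]; exact ⟨rfl, rfl⟩
  mul_mem' {s t} hs ht := by
    simp only [Set.mem_ofPred_eq] at *
    rw [raw_mul, M3.mul_eq]
    simp [dot_eq, hs, ht]
  inv_mem' {s} hs := by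
    simp only [Set.mem_ofPred_eq] at *
    rw [raw_inv, M3.adj, M3.mk'_eq]
    simp [minor_eq, hs]

theorem mem_parabolic {s : SL34} : s ∈ parabolic ↔ s.raw.d = 0 ∧ s.raw.g = 0 := Iff.rfl

/-- The upper triangular matrices. -/
def borel : Subgroup SL34 where
  carrier := {s | s.raw.d = 0 ∧ s.raw.g = 0 ∧ s.raw.h = 0}
  one_mem' := by rw [Set.mem_ofPred_eq, raw_one]; exact ⟨rfl, rfl, rfl⟩
  mul_mem' {s t} hs ht := by
    simp only [Set.mem_ofPred_eq] at *
    rw [raw_mul, M3.mul_eq]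
    simp [dot_eq, hs, ht]
  inv_mem' {s} hs := by
    simp only [Set.mem_ofPred_eq] at *
    rw [raw_inv, M3.adj, M3.mk'_eq]
    simp [minor_eq, hs]

theorem mem_borel {s : SL34} : s ∈ borel ↔ s.raw.d = 0 ∧ s.raw.g = 0 ∧ s.raw.h = 0 := Iff.rfl

/-- The points of the projective plane. -/
abbrev Pt : Type := (F4 × F4) ⊕ (F4 ⊕ Unit)

/-- A matrix whose first column spans the given point. -/
def ptMat : Pt → M3
  | .inl (b, c) => M3.X1 b c
  | .inr (.inl c) => M3.X2 c
  | .inr (.inr _) => M3.X3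

theorem ptMat_det (p : Pt) : (ptMat p).det = 1 := by
  rcases p with ⟨b, c⟩ | c | _
  · cases b <;> cases c <;> rfl
  · cases c <;> rfl
  · rfl

/-- An element moving the first basis vector to the given point. -/
def ptRep (p : Pt) : SL34 := mk (ptMat p) (ptMat_det p)

/-- The part of the flag over a point. -/
def lineMat : F4 ⊕ Unit → M3
  | .inl c => M3.Y1 c
  | .inr _ => M3.Y2

theorem lineMat_det (p : F4 ⊕ Unit) : (lineMat p).det = 1 := by
  rcases p with c | _
  · cases c <;> rfl
  · rfl

/-- An element of the parabolic moving the standard flag to a given flag over the same point. -/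
def lineRep (p : F4 ⊕ Unit) : SL34 := mk (lineMat p) (lineMat_det p)

/-- Representatives of the flags. -/
def flagRep (p : Pt × (F4 ⊕ Unit)) : SL34 := ptRep p.1 * lineRep p.2

/-- The coset of s modulo the parabolic is the point spanned by the first column of s. -/
theorem ptRep_inv_mul_mem (s : SL34) : ∀ p : Pt, (ptRep p)⁻¹ * s ∈ parabolic ↔ match p with
    | .inl (b, c) => s.raw.d = b * s.raw.a ∧ s.raw.g = c * s.raw.a
    | .inr (.inl c) => s.raw.a = 0 ∧ s.raw.g = c * s.raw.d
    | .inr (.inr _) => s.raw.a = 0 ∧ s.raw.d = 0 := by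
  intro p
  rw [mem_parabolic, raw_mul, raw_inv, ptRep, raw_mk, M3.mul_eq]
  generalize s.raw.a = a, s.raw.d = d, s.raw.g = g
  rcases p with ⟨b, c⟩ | c | _
  · simp only [ptMat]; revert a b c d g; decide +kernel
  · simp only [ptMat]; revert a c d g; decide +kernel
  · simp only [ptMat]; revert a d g; decide +kernel

theorem raw_column_ne_zero (s : SL34) : ¬ (s.raw.a = 0 ∧ s.raw.d = 0 ∧ s.raw.g = 0) := by
  rintro ⟨h1, h2, h3⟩
  have := s.raw_det
  simp [M3.det, det_eq, h1, h2, h3] at this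

theorem ptRep_transversal : IsTransversal parabolic ptRep := by
  intro s
  simp only [ptRep_inv_mul_mem]
  have h := s.raw_column_ne_zero
  generalize s.raw.a = a, s.raw.d = d, s.raw.g = g at h
  by_cases ha : a = 0
  · subst ha
    by_cases hd : d = 0
    · subst hd
      have hg : g ≠ 0 := fun hg => h ⟨rfl, rfl, hg⟩
      refine ⟨.inr (.inr ()), ⟨rfl, rfl⟩, ?_⟩
      rintro (⟨b, c⟩ | c | _) hp
      · exact absurd (hp.2.trans (mul_zero _)) hg
      · exact absurd (hp.2.trans (mul_zero _)) hg
      · rfl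
    · refine ⟨.inr (.inl (g * d⁻¹)), ⟨rfl, by field_simp⟩, ?_⟩
      rintro (⟨b, c⟩ | c | _) hp
      · exact absurd (hp.1.trans (mul_zero _)) hd
      · congr 2; rw [hp.2]; field_simp
      · exact absurd hp.2 hd
  · refine ⟨.inl (d * a⁻¹, g * a⁻¹), ⟨by field_simp, by field_simp⟩, ?_⟩
    rintro (⟨b, c⟩ | c | _) hp
    · congr 1; rw [hp.1, hp.2]; field_simp
    · exact absurd hp.1 ha
    · exact absurd hp.1 ha

theorem flagRep_transversal : IsTransversal borel flagRep := by
  refine ptRep_transversal.trans (fun s hs => ⟨hs.1, hs.2.1⟩) (fun i => ?_) fun s hs => ?_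
  · rcases i with c | _ <;> exact ⟨rfl, rfl⟩
  have key : ∀ p : F4 ⊕ Unit, (lineRep p)⁻¹ * s ∈ borel ↔ match p with
      | .inl c => s.raw.h = c * s.raw.e
      | .inr _ => s.raw.e = 0 := by
    intro p
    rw [mem_borel, raw_mul, raw_inv, lineRep, raw_mk, M3.mul_eq]
    obtain ⟨h1, h2⟩ := hs
    rw [h1, h2]
    generalize s.raw.a = a, s.raw.b = b, s.raw.e = e, s.raw.h = h
    rcases p with c | _
    · simp only [lineMat]; revert a b c e h; decide +kernel
    · simp only [lineMat]; revert a b e h; decide +kernel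
  simp only [key]
  have hdet := s.raw_det
  simp only [M3.det, det_eq, hs.1, hs.2] at hdet
  by_cases he : s.raw.e = 0
  · refine ⟨.inr (), he, ?_⟩
    rintro (c | _) hp
    · simp [he, show s.raw.h = 0 by rw [hp, he, mul_zero]] at hdet
    · rfl
  · refine ⟨.inl (s.raw.h * s.raw.e⁻¹), by field_simp, ?_⟩
    rintro (c | _) hp
    · congr 1; rw [hp]; field_simp
    · exact absurd hp he

/-- The transvections in the centre of the unitriangular group. -/
def transv (k : Fin 3) : SL34 := mk (M3.uu q0 (scal k) q0) (by fin_cases k <;> rfl)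

/-- The regular unipotent upper triangular matrices of a given type `d`. -/
def regUni (d : F4) (p : F4 × Fin 3) : SL34 :=
  mk (M3.uu (d * scal p.2) p.1 (scal p.2)) (by
    obtain ⟨b, k⟩ := p
    cases d <;> cases b <;> fin_cases k <;> rfl)

theorem scal_injective {k l : Fin 3} (h : scal k = scal l) : k = l := by
  revert k l; decide

theorem exists_scal {x : F4} (h : x ≠ 0) : ∃ k : Fin 3, scal k = x := by
  revert x; decide

theorem transv_injective : Function.Injective transv := fun k l h => by
  have := congrArg (fun s => s.raw.c) h
  exact scal_injective this

theorem regUni_injective (d : F4) : Function.Injective (regUni d) := fun p q h => by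
  have h1 := congrArg (fun s => s.raw.c) h
  have h2 := congrArg (fun s => s.raw.f) h
  exact Prod.ext h1 (scal_injective h2)

theorem exists_raw_of_mem_borel {s : SL34} (hs : s ∈ borel) : ∃ a b c e f i,
    s.raw = ⟨a, b, c, 0, e, f, 0, 0, i⟩ ∧ a * (e * i) = 1 := by
  have hd := s.raw_det
  rw [mem_borel] at hs
  revert hd hs
  generalize s.raw = m
  rintro ⟨h1, h2, h3⟩ hd
  obtain ⟨a, b, c, d, e, f, g, h, i⟩ := m
  dsimp only at h1 h2 h3
  subst h1 h2 h3
  exact ⟨a, b, c, e, f, i, rfl, by simpa [M3.det, det_eq] using hd⟩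

/-- If the diagonal is (a, e, i), conjugation multiplies the corner entry by a/i, which is a²e
because aei = 1. -/
theorem conj_transv {s : SL34} (hs : s ∈ borel) (k : Fin 3) :
    ∃ j, s * transv k * s⁻¹ = transv j := by
  obtain ⟨a, b, c, e, f, i, h, hd⟩ := exists_raw_of_mem_borel hs
  have ha : a ≠ 0 := left_ne_zero_of_mul_eq_one hd
  have he : e ≠ 0 := by rintro rfl; simp at hd
  have hk : scal k ≠ 0 := by revert k; decide
  obtain ⟨j, hj⟩ := exists_scal (mul_ne_zero (mul_ne_zero (mul_ne_zero ha ha) he) hk)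
  refine ⟨j, raw_injective ?_⟩
  rw [raw_conj, h, transv, transv, raw_mk, raw_mk, hj, M3.conj, M3.adj, M3.mk'_eq, M3.mul_eq,
    M3.mul_eq]
  have h2 := two_eq_zero
  simp only [M3.uu, dot_eq, minor_eq, q0_eq, q1_eq, M3.mk.injEq]
  refine ⟨?_, ?_, ?_, ?_, ?_, ?_, ?_, ?_, ?_⟩ <;> try ring1
  · linear_combination hd
  · linear_combination a * b * i * h2
  · linear_combination (a * b * f + a * c * e) * h2
  · linear_combination hd
  · linear_combination a * e * f * h2
  · linear_combination hd

/-- The two superdiagonal entries are multiplied by a/e and e/i = ae². The type, the first entry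
times the square of the second, changes by (a/e)(e/i)² = aei/i³ = 1. -/
theorem conj_regUni (d : F4) {s : SL34} (hs : s ∈ borel) (p : F4 × Fin 3) :
    ∃ q, s * regUni d p * s⁻¹ = regUni d q := by
  obtain ⟨a, b, c, e, f, i, h, hd⟩ := exists_raw_of_mem_borel hs
  have ha : a ≠ 0 := left_ne_zero_of_mul_eq_one hd
  have he : e ≠ 0 := by rintro rfl; simp at hd
  have hi : i ≠ 0 := by rintro rfl; simp at hd
  obtain ⟨x, k⟩ := p
  have hk : scal k ≠ 0 := by revert k; decide
  obtain ⟨j, hj⟩ := exists_scal (mul_ne_zero (mul_ne_zero (mul_ne_zero ha he) he) hk)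
  have he3 := pow_three he
  have hx : a * (a * i) = a * e * e := by
    have : a * i = e * e := by linear_combination (e * e) * hd - a * i * he3
    rw [this]; ring
  refine ⟨((s * regUni d (x, k) * s⁻¹).raw.c, j), raw_injective ?_⟩
  rw [raw_conj, h, regUni, regUni, raw_mk, raw_mk]
  simp only [hj]
  rw [M3.conj, M3.adj, M3.mk'_eq, M3.mul_eq, M3.mul_eq]
  have h2 := two_eq_zero
  simp only [M3.uu, dot_eq, minor_eq, q0_eq, q1_eq, M3.mk.injEq]
  refine ⟨?_, ?_, trivial, ?_, ?_, ?_, ?_, ?_, ?_⟩ <;> try ring1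
  · linear_combination hd
  · linear_combination a * b * i * h2 + d * scal k * hx
  · linear_combination hd
  · linear_combination a * e * f * h2
  · linear_combination hd

end SL34

/-! ### Structure constants of the class algebra, read off from digits in base 2048 -/

/-- A sum of powers of a large base determines how often each exponent occurs. -/
theorem sum_eq_sum_digits {ι K : Type*} [Fintype ι] [Field K] (l : ι → ℕ) (n : ℕ) {N : ℕ}
    (hN : ∑ i, 2 ^ (11 * l i) = N) (hlt : N < 2 ^ (11 * n)) (hι : Fintype.card ι < 2048) :
    (∀ i, l i < n) ∧ ∀ v : ℕ → K, ∑ i, v (l i) =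
      ∑ j ∈ Finset.range n, ((N / 2 ^ (11 * j) % 2048 : ℕ) : K) * v j := by
  -- A single summand with exponent at least n would already exceed N.
  have hl : ∀ i, l i < n := fun i => by
    have h1 : 2 ^ (11 * l i) ≤ N := hN ▸ Finset.single_le_sum (f := fun i => 2 ^ (11 * l i))
      (fun _ _ => Nat.zero_le _) (Finset.mem_univ i)
    have h2 := (Nat.pow_lt_pow_iff_right (by norm_num : 1 < 2)).1 (h1.trans_lt hlt)
    omega
  refine ⟨hl, fun v => ?_⟩
  classical
  set c : ℕ → ℕ := fun j => (Finset.univ.filter fun i => l i = j).card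
  have hc : ∀ j, c j < 2048 := fun j => (Finset.card_le_univ _).trans_lt hι
  have hmaps : ∀ i ∈ (Finset.univ : Finset ι), l i ∈ Finset.range n :=
    fun i _ => Finset.mem_range.2 (hl i)
  have hsum : ∑ j ∈ Finset.range n, c j * 2048 ^ j = N := by
    rw [← hN, ← Finset.sum_fiberwise_of_maps_to hmaps]
    refine Finset.sum_congr rfl fun j _ => ?_
    rw [Finset.sum_congr rfl (fun i hi => by rw [(Finset.mem_filter.1 hi).2]), Finset.sum_const,
      smul_eq_mul, pow_mul]
    rfl
  -- All coefficients are below the base, so they are the digits of the sum.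
  have digit : ∀ (n : ℕ) (c : ℕ → ℕ), (∀ j, c j < 2048) → ∀ j < n,
      (∑ j ∈ Finset.range n, c j * 2048 ^ j) / 2048 ^ j % 2048 = c j := by
    intro n
    induction n with
    | zero => intro c _ j hj; omega
    | succ n ih =>
      intro c hc j hj
      have h1 : ∑ j ∈ Finset.range (n + 1), c j * 2048 ^ j =
          c 0 + 2048 * ∑ j ∈ Finset.range n, c (j + 1) * 2048 ^ j := by
        rw [Finset.sum_range_succ', add_comm, Finset.mul_sum]
        congr 1
        · simp
        · exact Finset.sum_congr rfl fun j _ => by ring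
      rw [h1]
      cases j with
      | zero => rw [pow_zero, Nat.div_one, Nat.add_mul_mod_self_left, Nat.mod_eq_of_lt (hc 0)]
      | succ j =>
        rw [pow_succ', ← Nat.div_div_eq_div_mul, Nat.add_mul_div_left _ _ (by norm_num),
          Nat.div_eq_of_lt (hc 0), zero_add]
        exact ih (fun j => c (j + 1)) (fun j => hc _) j (by omega)
  rw [← Finset.sum_fiberwise_of_maps_to hmaps]
  refine Finset.sum_congr rfl fun j hj => ?_
  rw [Finset.sum_congr rfl (fun i hi => by rw [(Finset.mem_filter.1 hi).2]), Finset.sum_const,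
    nsmul_eq_mul, pow_mul, ← hsum]
  congr 2
  exact (digit n c hc j (Finset.mem_range.1 hj)).symm

namespace M3

theorem bind_eq (m : M3) (f : M3 → ℕ) : bind m f = f m := rfl

theorem sumFl_eq (f : M3 → ℕ) : sumFl f = ∑ i, f (SL34.flagRep i).raw := by
  have key : ∀ x : M3, Nat.add (sumAll fun c => bind (mul x (Y1 c)) f) (bind (mul x Y2) f) =
      ∑ j, f (mul x (SL34.lineMat j)) := fun x => by
    rw [Fintype.sum_sum_type, sumAll_eq]
    simp only [bind_eq, Finset.univ_unique, Finset.sum_singleton]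
    rfl
  have key2 : ∀ h : M3 → ℕ, sumPt h = ∑ p, h (SL34.ptMat p) := fun h => by
    rw [Fintype.sum_sum_type, Fintype.sum_sum_type, Fintype.sum_prod_type, sumPt]
    simp only [sumAll_eq, Finset.univ_unique, Finset.sum_singleton]
    rfl
  simp only [sumFl, key]
  rw [key2, Fintype.sum_prod_type]
  simp only [SL34.flagRep, SL34.raw_mul]
  rfl

theorem code_eq (m : M3) : code m = 2 ^ (11 * lab m) := rfl

theorem tallyT_eq (g : SL34) : tallyT g.raw = ∑ p : (SL34.Pt × (F4 ⊕ Unit)) × Fin 3,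
    2 ^ (11 * lab (g * (SL34.flagRep p.1 * SL34.transv p.2 * (SL34.flagRep p.1)⁻¹)).raw) := by
  refine (sumFl_eq _).trans ?_
  refine Eq.trans ?_ (Fintype.sum_prod_type _).symm
  refine Finset.sum_congr rfl fun i _ => ?_
  rw [Fin.sum_univ_three, add_assoc, SL34.raw_mul g, SL34.raw_mul g, SL34.raw_mul g, SL34.raw_conj,
    SL34.raw_conj, SL34.raw_conj]
  simp only [code_eq, Nat.add_eq]
  rfl

theorem tallyU_eq (d : F4) (g : SL34) : tallyU d g.raw =
    ∑ p : (SL34.Pt × (F4 ⊕ Unit)) × (F4 × Fin 3),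
    2 ^ (11 * lab (g * (SL34.flagRep p.1 * SL34.regUni d p.2 * (SL34.flagRep p.1)⁻¹)).raw) := by
  refine (sumFl_eq _).trans ?_
  refine Eq.trans ?_ (Fintype.sum_prod_type _).symm
  refine Finset.sum_congr rfl fun i _ => ?_
  rw [Fintype.sum_prod_type, sumAll_eq]
  refine Finset.sum_congr rfl fun b _ => ?_
  rw [Fin.sum_univ_three, add_assoc, SL34.raw_mul g, SL34.raw_mul g, SL34.raw_mul g, SL34.raw_conj,
    SL34.raw_conj, SL34.raw_conj]
  simp only [code_eq, Nat.add_eq]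
  rfl

end M3

namespace SL34

section

variable {K : Type*} [Field K] [CharZero K] {ψ : SL34 → K}

theorem omega_comm (x : SL34) : x * omega = omega * x := by
  apply raw_injective
  rw [omega_mul_raw, raw_mul, M3.mul_eq]
  simp [omega, raw_mk, dot_eq, q0_eq, mul_comm]

theorem map_ofLabel (hψ : IsCentralChar ψ) (j : ℕ) :
    ψ (ofLabel j) = ψ omega ^ (j % 3) * ψ (rep (j / 3)) := by
  rw [ofLabel]
  induction j % 3 with
  | zero => simp
  | succ n ih =>
    rw [pow_succ', mul_assoc, hψ.map_mul_of_commute omega_comm, ih, pow_succ', mul_assoc]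

theorem map_omega_pow_three (hψ : IsCentralChar ψ) : ψ omega ^ 3 = 1 := by
  have h : omega * (omega * omega) = 1 := by
    apply raw_injective
    rw [raw_one, raw_mul, raw_mul]
    rfl
  have := congrArg ψ h
  rw [hψ.map_mul_of_commute omega_comm, hψ.map_mul_of_commute omega_comm, hψ.one] at this
  rw [← this]; ring

theorem eq_of_map_rep {φ : SL34 → K} (hψ : IsCentralChar ψ) (hφ : IsCentralChar φ)
    (h0 : ψ omega = φ omega) (h : ∀ k < 10, ψ (rep k) = φ (rep k)) : ψ = φ := by
  funext s
  obtain ⟨j, hj, x, rfl⟩ := exists_label s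
  rw [hψ.conj, hφ.conj, map_ofLabel hψ, map_ofLabel hφ, h0, h _ (by omega)]

theorem map_eq_of_lab (hψ : IsCentralChar ψ) {s : SL34} {j : ℕ} (h : M3.lab s.raw = j)
    (hj : j < 28) : ψ s = ψ (ofLabel j) := by
  obtain ⟨x, hx⟩ := exists_conj_ofLabel (h ▸ hj)
  rw [hx, hψ.conj, h]

/-- The digits of N count how often gt lies in each class as t runs over the 315 = 105 · 3
transvections. The bound on N shows that the fallback label 28 never occurs. -/
theorem tallyT_rel (hψ : IsCentralChar ψ) {g : SL34} {N : ℕ} (hN : M3.tallyT g.raw = N)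
    (hlt : N < 2 ^ (11 * 28)) : ∑ j ∈ Finset.range 28,
      ((N / 2 ^ (11 * j) % 2048 : ℕ) : K) * (ψ omega ^ (j % 3) * ψ (rep (j / 3))) =
        315 * (ψ (rep 1) * ψ g) := by
  rw [M3.tallyT_eq] at hN
  obtain ⟨h1, h2⟩ := sum_eq_sum_digits (K := K) _ 28 hN hlt
    (by simp [show Fintype.card F4 = 4 from rfl])
  have h3 := h2 (fun j => ψ (ofLabel j))
  simp only [map_ofLabel hψ] at h3
  rw [← h3]
  have h4 := hψ.sum_conj flagRep_transversal transv_injective (fun k hk i => conj_transv hk i)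
    (c := ψ (rep 1)) (fun i => by
      fin_cases i <;>
        exact (map_eq_of_lab hψ (j := 3) rfl (by norm_num)).trans (by rw [map_ofLabel hψ]; simp)) g
  rw [← Fintype.sum_prod_type'] at h4
  rw [show (315 : K) = (Fintype.card (Pt × (F4 ⊕ Unit)) * Fintype.card (Fin 3) : K) by
    have : Fintype.card (Pt × (F4 ⊕ Unit)) = 105 := rfl
    rw [this, Fintype.card_fin]; norm_num, ← h4]
  refine Finset.sum_congr rfl fun i _ => ?_
  rw [← map_ofLabel hψ]
  exact (map_eq_of_lab hψ rfl (h1 i)).symm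

/-- The same count for a class of 1260 = 105 · 12 regular unipotents: `hd` says that the family
`regUni d` lies in the class of `rep k`, with no scalar factor. -/
theorem tallyU_rel (hψ : IsCentralChar ψ) {k : ℕ} (d : F4) {g : SL34} {N : ℕ}
    (hd : ∀ p, M3.lab (regUni d p).raw = 3 * k) (hk : k < 9)
    (hN : M3.tallyU d g.raw = N)
    (hlt : N < 2 ^ (11 * 28)) : ∑ j ∈ Finset.range 28,
      ((N / 2 ^ (11 * j) % 2048 : ℕ) : K) * (ψ omega ^ (j % 3) * ψ (rep (j / 3))) =
        1260 * (ψ (rep k) * ψ g) := by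
  rw [M3.tallyU_eq] at hN
  obtain ⟨h1, h2⟩ := sum_eq_sum_digits (K := K) _ 28 hN hlt
    (by simp [show Fintype.card F4 = 4 from rfl])
  have h3 := h2 (fun j => ψ (ofLabel j))
  simp only [map_ofLabel hψ] at h3
  rw [← h3]
  have h4 := hψ.sum_conj flagRep_transversal (regUni_injective d) (fun k hk i => conj_regUni d hk i)
    (c := ψ (rep k)) (fun i => by
      rw [map_eq_of_lab hψ (hd i) (by omega), map_ofLabel hψ]; simp) g
  rw [← Fintype.sum_prod_type'] at h4
  rw [show (1260 : K) = (Fintype.card (Pt × (F4 ⊕ Unit)) * Fintype.card (F4 × Fin 3) : K) by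
    have : Fintype.card (Pt × (F4 ⊕ Unit)) = 105 := rfl
    have h' : Fintype.card (F4 × Fin 3) = 12 := rfl
    rw [this, h']; norm_num, ← h4]
  refine Finset.sum_congr rfl fun i _ => ?_
  rw [← map_ofLabel hψ]
  exact (map_eq_of_lab hψ rfl (h1 i)).symm

/-- Multiplication by ω permutes the eigenvalues 1, ω, ω². Hence ψ vanishes on `rep 9` as soon as
ψ(ω) ≠ 1. -/
theorem map_rep_nine (hψ : IsCentralChar ψ) : ψ omega * ψ (rep 9) = ψ (rep 9) := by
  rw [← hψ.map_mul_of_commute omega_comm]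
  refine (map_eq_of_lab hψ (j := 27) rfl (by norm_num)).trans ?_
  rw [map_ofLabel hψ]; simp

/-- In these relations N encodes the products with the given class, and the powers of ζ record the
scalar factors ω and ω² of the classes reached. -/
theorem rel_transv_1 (hψ : IsCentralChar ψ) {ζ : K} (hζ : ψ omega = ζ) :
    315 * (ψ (rep 1) * ψ (rep 1)) =
      (1) + (26) * ψ (rep 1) + (32) * ψ (rep 2) + (32) * ψ (rep 3) + (32) * ψ (rep 4) +
      (64) * ψ (rep 5) + (64) * ψ (rep 6) + (64) * ψ (rep 9) := by
  have h := tallyT_rel hψ (g := rep 1)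
    (N := 16296287810675888690147565507300736297122884149089589312314947145915707854284144355416473601)
    (by decide +kernel) (by norm_num)
  rw [← h, hζ]
  simp only [Finset.sum_range_succ, Finset.sum_range_zero]
  norm_num [show rep 0 = 1 from rfl, hψ.one]

theorem rel_transv_2 (hψ : IsCentralChar ψ) {ζ : K} (hζ : ψ omega = ζ) :
    315 * (ψ (rep 1) * ψ (rep 2)) =
      (8) * ψ (rep 1) + (3 + 16 * ζ + 16 * ζ ^ 2) * ψ (rep 2) + (8) * ψ (rep 3) +
      (8) * ψ (rep 4) + (32 + 16 * ζ + 16 * ζ ^ 2) * ψ (rep 5) +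
      (32 + 16 * ζ + 16 * ζ ^ 2) * ψ (rep 6) + (16 + 16 * ζ + 16 * ζ ^ 2) * ψ (rep 7) +
      (16 + 16 * ζ + 16 * ζ ^ 2) * ψ (rep 8) + (32) * ψ (rep 9) := by
  have h := tallyT_rel hψ (g := rep 2)
    (N := 8150134170092545699334914600921331093170224599640172887034934720240584551191072589152780288)
    (by decide +kernel) (by norm_num)
  rw [← h, hζ]
  simp only [Finset.sum_range_succ, Finset.sum_range_zero]
  norm_num [show rep 0 = 1 from rfl, hψ.one]
  ring

theorem rel_transv_3 (hψ : IsCentralChar ψ) {ζ : K} (hζ : ψ omega = ζ) :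
    315 * (ψ (rep 1) * ψ (rep 3)) =
      (8) * ψ (rep 1) + (8) * ψ (rep 2) + (3 + 16 * ζ + 16 * ζ ^ 2) * ψ (rep 3) +
      (8) * ψ (rep 4) + (32 + 16 * ζ + 16 * ζ ^ 2) * ψ (rep 5) +
      (32 + 16 * ζ + 16 * ζ ^ 2) * ψ (rep 6) + (16 + 16 * ζ + 16 * ζ ^ 2) * ψ (rep 7) +
      (16 + 16 * ζ + 16 * ζ ^ 2) * ψ (rep 8) + (32) * ψ (rep 9) := by
  have h := tallyT_rel hψ (g := rep 3)
    (N := 8150134170092545699334914600921331093170224599640172929590996598711353584207647877927796736)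
    (by decide +kernel) (by norm_num)
  rw [← h, hζ]
  simp only [Finset.sum_range_succ, Finset.sum_range_zero]
  norm_num [show rep 0 = 1 from rfl, hψ.one]
  ring

theorem rel_transv_4 (hψ : IsCentralChar ψ) {ζ : K} (hζ : ψ omega = ζ) :
    315 * (ψ (rep 1) * ψ (rep 4)) =
      (8) * ψ (rep 1) + (8) * ψ (rep 2) + (8) * ψ (rep 3) +
      (3 + 16 * ζ + 16 * ζ ^ 2) * ψ (rep 4) + (32 + 16 * ζ + 16 * ζ ^ 2) * ψ (rep 5) +
      (32 + 16 * ζ + 16 * ζ ^ 2) * ψ (rep 6) + (16 + 16 * ζ + 16 * ζ ^ 2) * ψ (rep 7) +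
      (16 + 16 * ζ + 16 * ζ ^ 2) * ψ (rep 8) + (32) * ψ (rep 9) := by
  have h := tallyT_rel hψ (g := rep 4)
    (N := 8150134170092545699334914600921331093170224965193960958759555576262823766628550969971965952)
    (by decide +kernel) (by norm_num)
  rw [← h, hζ]
  simp only [Finset.sum_range_succ, Finset.sum_range_zero]
  norm_num [show rep 0 = 1 from rfl, hψ.one]
  ring

theorem rel_transv_5 (hψ : IsCentralChar ψ) {ζ : K} (hζ : ψ omega = ζ) :
    315 * (ψ (rep 1) * ψ (rep 5)) =
      (5) * ψ (rep 1) + (10 + 5 * ζ + 5 * ζ ^ 2) * ψ (rep 2) +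
      (10 + 5 * ζ + 5 * ζ ^ 2) * ψ (rep 3) + (10 + 5 * ζ + 5 * ζ ^ 2) * ψ (rep 4) +
      (30 + 15 * ζ + 15 * ζ ^ 2) * ψ (rep 5) + (35 + 15 * ζ + 15 * ζ ^ 2) * ψ (rep 6) +
      (15 + 15 * ζ + 15 * ζ ^ 2) * ψ (rep 7) + (15 + 15 * ζ + 15 * ζ ^ 2) * ψ (rep 8) +
      (35) * ψ (rep 9) := by
  have h := tallyT_rel hψ (g := rep 5)
    (N := 8913898269670815397044260993621617923059577160283880594924831324769661293177882287905177600)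
    (by decide +kernel) (by norm_num)
  rw [← h, hζ]
  simp only [Finset.sum_range_succ, Finset.sum_range_zero]
  norm_num [show rep 0 = 1 from rfl, hψ.one]
  ring

theorem rel_transv_6 (hψ : IsCentralChar ψ) {ζ : K} (hζ : ψ omega = ζ) :
    315 * (ψ (rep 1) * ψ (rep 6)) =
      (5) * ψ (rep 1) + (10 + 5 * ζ + 5 * ζ ^ 2) * ψ (rep 2) +
      (10 + 5 * ζ + 5 * ζ ^ 2) * ψ (rep 3) + (10 + 5 * ζ + 5 * ζ ^ 2) * ψ (rep 4) +
      (35 + 15 * ζ + 15 * ζ ^ 2) * ψ (rep 5) + (30 + 15 * ζ + 15 * ζ ^ 2) * ψ (rep 6) +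
      (15 + 15 * ζ + 15 * ζ ^ 2) * ψ (rep 7) + (15 + 15 * ζ + 15 * ζ ^ 2) * ψ (rep 8) +
      (35) * ψ (rep 9) := by
  have h := tallyT_rel hψ (g := rep 6)
    (N := 8913898269670815397044260993619609250504487262701426086776317461089743144718798746067927040)
    (by decide +kernel) (by norm_num)
  rw [← h, hζ]
  simp only [Finset.sum_range_succ, Finset.sum_range_zero]
  norm_num [show rep 0 = 1 from rfl, hψ.one]
  ring

theorem rel_transv_7 (hψ : IsCentralChar ψ) {ζ : K} (hζ : ψ omega = ζ) :
    315 * (ψ (rep 1) * ψ (rep 7)) =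
      (7 + 7 * ζ + 7 * ζ ^ 2) * ψ (rep 2) + (7 + 7 * ζ + 7 * ζ ^ 2) * ψ (rep 3) +
      (7 + 7 * ζ + 7 * ζ ^ 2) * ψ (rep 4) + (21 + 21 * ζ + 21 * ζ ^ 2) * ψ (rep 5) +
      (21 + 21 * ζ + 21 * ζ ^ 2) * ψ (rep 6) + (21 * ζ + 21 * ζ ^ 2) * ψ (rep 7) +
      (21 + 21 * ζ + 21 * ζ ^ 2) * ψ (rep 8) + (21) * ψ (rep 9) := by
  have h := tallyT_rel hψ (g := rep 7)
    (N := 5349831660368440253849937144984892042524408648983628975385015041419152226034690170061586432)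
    (by decide +kernel) (by norm_num)
  rw [← h, hζ]
  simp only [Finset.sum_range_succ, Finset.sum_range_zero]
  norm_num [show rep 0 = 1 from rfl, hψ.one]
  ring

theorem rel_transv_8 (hψ : IsCentralChar ψ) {ζ : K} (hζ : ψ omega = ζ) :
    315 * (ψ (rep 1) * ψ (rep 8)) =
      (7 + 7 * ζ + 7 * ζ ^ 2) * ψ (rep 2) + (7 + 7 * ζ + 7 * ζ ^ 2) * ψ (rep 3) +
      (7 + 7 * ζ + 7 * ζ ^ 2) * ψ (rep 4) + (21 + 21 * ζ + 21 * ζ ^ 2) * ψ (rep 5) +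
      (21 + 21 * ζ + 21 * ζ ^ 2) * ψ (rep 6) + (21 + 21 * ζ + 21 * ζ ^ 2) * ψ (rep 7) +
      (21 * ζ + 21 * ζ ^ 2) * ψ (rep 8) + (21) * ψ (rep 9) := by
  have h := tallyT_rel hψ (g := rep 8)
    (N := 5349831659745941982182593615029075346885767392918358305073268013350817313237355689467183104)
    (by decide +kernel) (by norm_num)
  rw [← h, hζ]
  simp only [Finset.sum_range_succ, Finset.sum_range_zero]
  norm_num [show rep 0 = 1 from rfl, hψ.one]
  ring

theorem rel_transv_9 (hψ : IsCentralChar ψ) {ζ : K} (hζ : ψ omega = ζ) :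
    315 * (ψ (rep 1) * ψ (rep 9)) =
      (3 + 3 * ζ + 3 * ζ ^ 2) * ψ (rep 1) + (6 + 6 * ζ + 6 * ζ ^ 2) * ψ (rep 2) +
      (6 + 6 * ζ + 6 * ζ ^ 2) * ψ (rep 3) + (6 + 6 * ζ + 6 * ζ ^ 2) * ψ (rep 4) +
      (21 + 21 * ζ + 21 * ζ ^ 2) * ψ (rep 5) + (21 + 21 * ζ + 21 * ζ ^ 2) * ψ (rep 6) +
      (9 + 9 * ζ + 9 * ζ ^ 2) * ψ (rep 7) + (9 + 9 * ζ + 9 * ζ ^ 2) * ψ (rep 8) +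
      (72) * ψ (rep 9) := by
  have h := tallyT_rel hψ (g := rep 9)
    (N := 18334443310934838038187918089615786592508602357335029539360476368024623196279583049926049792)
    (by decide +kernel) (by norm_num)
  rw [← h, hζ]
  simp only [Finset.sum_range_succ, Finset.sum_range_zero]
  norm_num [show rep 0 = 1 from rfl, hψ.one]
  ring

/-- Products with transvections alone do not separate the three regular unipotent classes when 315
ψ(`rep 1`) is -21 (ζ ≠ 1) or 27 (ζ = 1). The squares of these classes settle those cases. -/
theorem rel_regUni_2 (hψ : IsCentralChar ψ) {ζ : K} (hζ : ψ omega = ζ) :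
    1260 * (ψ (rep 2) * ψ (rep 2)) =
      (1) + (3 + 16 * ζ + 16 * ζ ^ 2) * ψ (rep 1) + (136) * ψ (rep 2) +
      (32 * ζ + 32 * ζ ^ 2) * ψ (rep 3) + (32 * ζ + 32 * ζ ^ 2) * ψ (rep 4) +
      (96 + 80 * ζ + 80 * ζ ^ 2) * ψ (rep 5) + (96 + 80 * ζ + 80 * ζ ^ 2) * ψ (rep 6) +
      (144 + 16 * ζ + 16 * ζ ^ 2) * ψ (rep 7) + (144 + 16 * ζ + 16 * ζ ^ 2) * ψ (rep 8) +
      (96) * ψ (rep 9) := by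
  have h := tallyU_rel hψ (k := 2) q1 (by decide) (by norm_num) (g := rep 2)
    (N := 24446421984562709570052676858499064506624844173403300604225832493406540716846831941957189633)
    (by decide +kernel) (by norm_num)
  rw [← h, hζ]
  simp only [Finset.sum_range_succ, Finset.sum_range_zero]
  norm_num [show rep 0 = 1 from rfl, hψ.one]
  ring

theorem rel_regUni_3 (hψ : IsCentralChar ψ) {ζ : K} (hζ : ψ omega = ζ) :
    1260 * (ψ (rep 3) * ψ (rep 3)) =
      (1) + (3 + 16 * ζ + 16 * ζ ^ 2) * ψ (rep 1) + (32 * ζ + 32 * ζ ^ 2) * ψ (rep 2) +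
      (136) * ψ (rep 3) + (32 * ζ + 32 * ζ ^ 2) * ψ (rep 4) +
      (96 + 80 * ζ + 80 * ζ ^ 2) * ψ (rep 5) + (96 + 80 * ζ + 80 * ζ ^ 2) * ψ (rep 6) +
      (144 + 16 * ζ + 16 * ζ ^ 2) * ψ (rep 7) + (144 + 16 * ζ + 16 * ζ ^ 2) * ψ (rep 8) +
      (96) * ψ (rep 9) := by
  have h := tallyU_rel hψ (k := 3) q2 (by decide) (by norm_num) (g := rep 3)
    (N := 24446421984562709570052676858499064506624844173403300519113788598452807732106962507095080961)
    (by decide +kernel) (by norm_num)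
  rw [← h, hζ]
  simp only [Finset.sum_range_succ, Finset.sum_range_zero]
  norm_num [show rep 0 = 1 from rfl, hψ.one]
  ring

theorem rel_regUni_4 (hψ : IsCentralChar ψ) {ζ : K} (hζ : ψ omega = ζ) :
    1260 * (ψ (rep 4) * ψ (rep 4)) =
      (1) + (3 + 16 * ζ + 16 * ζ ^ 2) * ψ (rep 1) + (32 * ζ + 32 * ζ ^ 2) * ψ (rep 2) +
      (32 * ζ + 32 * ζ ^ 2) * ψ (rep 3) + (136) * ψ (rep 4) +
      (96 + 80 * ζ + 80 * ζ ^ 2) * ψ (rep 5) + (96 + 80 * ζ + 80 * ζ ^ 2) * ψ (rep 6) +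
      (144 + 16 * ζ + 16 * ζ ^ 2) * ψ (rep 7) + (144 + 16 * ζ + 16 * ζ ^ 2) * ψ (rep 8) +
      (96) * ψ (rep 9) := by
  have h := tallyU_rel hψ (k := 4) q3 (by decide) (by norm_num) (g := rep 4)
    (N := 24446421984562709570052676858499064506624843442296410470028303393304395152021444475419099137)
    (by decide +kernel) (by norm_num)
  rw [← h, hζ]
  simp only [Finset.sum_range_succ, Finset.sum_range_zero]
  norm_num [show rep 0 = 1 from rfl, hψ.one]
  ring

end

end SL34

/-! ### Solving the equations for the central characters -/

/-- Integral values of a central character on sums over families of conjugates; `onFive` tells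
whether the remaining freedom is in the two classes of elements of order five or in those of order
seven. -/
structure CentralKey where
  (x a b c f s w : ℤ)
  onFive : Bool
  deriving DecidableEq

namespace CentralKey

/-- The keys of the nontrivial central characters with trivial central action. -/
def trivialList : List CentralKey :=
  -- The values match the characters of PSL₃(4) of degrees 20, 35, 35, 35, 45, 63, 64, where 45 and
  -- 63 stand for two characters each.
  [⟨63, 0, 0, 0, 0, -288, 224, true⟩, ⟨27, 108, -36, -36, 0, 0, -64, true⟩,
    ⟨27, -36, 108, -36, 0, 0, -64, true⟩, ⟨27, -36, -36, 108, 0, 0, -64, true⟩,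
    ⟨-21, 28, 28, 28, 0, -64, 0, false⟩, ⟨-5, -20, -20, -20, 64, 0, 0, true⟩,
    ⟨0, 0, 0, 0, -126, 90, 35, true⟩]

/-- The keys of the central characters with nontrivial central action. -/
def faithfulList : List CentralKey :=
  -- The values match the faithful characters of degrees 84, 21, 63, 45, 15, 15, 15, where 63 and 45
  -- stand for two characters each.
  [⟨15, 0, 0, 0, -96, 0, 0, true⟩, ⟨75, 60, 60, 60, 384, 0, 0, true⟩,
    ⟨-5, -20, -20, -20, 64, 0, 0, true⟩, ⟨-21, 28, 28, 28, 0, -64, 0, false⟩,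
    ⟨-21, -84, -84, 252, 0, 384, 0, false⟩, ⟨-21, -84, 252, -84, 0, 384, 0, false⟩,
    ⟨-21, 252, -84, -84, 0, 384, 0, false⟩]

end CentralKey

section

variable {K : Type*} [Field K] [CharZero K]

/-- The letters are the values multiplied by class sizes in PSL₃(4), with ζ² + ζ + 1 = 0 already
used. Unless X = -21, differences of the equations give S = S' = 0 and A = B = C = X - 15, and X is
a root of (X-15)(X-75)(X+5). For X = -21 the sum A + B + C is 84 and the squares determine the rest.
-/
theorem faithful_relations {X A B C F F' S S' : K}
    (h1 : X * X = 315 + 26 * X + 8 * (A + B + C) + 5 * (F + F'))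
    (hA : X * A = 32 * X - 13 * A + 8 * B + 8 * C + 5 * (F + F'))
    (hB : X * B = 32 * X - 13 * B + 8 * A + 8 * C + 5 * (F + F'))
    (hC : X * C = 32 * X - 13 * C + 8 * A + 8 * B + 5 * (F + F'))
    (hF : X * F = 64 * X + 16 * (A + B + C) + 15 * F + 20 * F')
    (hF' : X * F' = 64 * X + 16 * (A + B + C) + 20 * F + 15 * F')
    (hS : X * S = -21 * S) (hS' : X * S' = -21 * S')
    (hAA : A * A = 1260 - 52 * X + 136 * A - 32 * (B + C) + 5 * (F + F') + 56 * (S + S'))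
    (hBB : B * B = 1260 - 52 * X + 136 * B - 32 * (A + C) + 5 * (F + F') + 56 * (S + S'))
    (hCC : C * C = 1260 - 52 * X + 136 * C - 32 * (A + B) + 5 * (F + F') + 56 * (S + S')) :
    (X = 15 ∧ A = 0 ∧ B = 0 ∧ C = 0 ∧ F + F' = -96 ∧ F = F' ∧ S = 0 ∧ S' = 0) ∨
    (X = 75 ∧ A = 60 ∧ B = 60 ∧ C = 60 ∧ F + F' = 384 ∧ F = F' ∧ S = 0 ∧ S' = 0) ∨
    (X = -5 ∧ A = -20 ∧ B = -20 ∧ C = -20 ∧ F + F' = 64 ∧ S = 0 ∧ S' = 0) ∨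
    (X = -21 ∧ A = 28 ∧ B = 28 ∧ C = 28 ∧ F = 0 ∧ F' = 0 ∧ S + S' = -64) ∨
    (X = -21 ∧ A = -84 ∧ B = -84 ∧ C = 252 ∧ F = 0 ∧ F' = 0 ∧ S + S' = 384) ∨
    (X = -21 ∧ A = -84 ∧ B = 252 ∧ C = -84 ∧ F = 0 ∧ F' = 0 ∧ S + S' = 384) ∨
    (X = -21 ∧ A = 252 ∧ B = -84 ∧ C = -84 ∧ F = 0 ∧ F' = 0 ∧ S + S' = 384) := by
  by_cases hX : X = -21
  · subst hX
    have e1 : F = F' := by linear_combination (-1/16 : K) * (hF - hF')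
    subst e1
    have e2 : F = 0 := by linear_combination (-1/36 : K) * (hF - 2 * h1)
    subst e2
    have e3 : A + B + C = 84 := by linear_combination (-1/8 : K) * h1
    have hab : (A - B) * (A + B - 168) = 0 := by linear_combination hAA - hBB
    have hac : (A - C) * (A + C - 168) = 0 := by linear_combination hAA - hCC
    have hbc : (B - C) * (B + C - 168) = 0 := by linear_combination hBB - hCC
    by_cases h₁ : A = B
    · subst h₁
      by_cases h₂ : A = C
      · subst h₂
        obtain rfl : A = 28 := by linear_combination (1/3 : K) * e3
        exact Or.inr (Or.inr (Or.inr (Or.inl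
          ⟨rfl, rfl, rfl, rfl, rfl, rfl, by linear_combination (-1/56 : K) * hAA⟩)))
      · have h3 := (mul_eq_zero.1 hac).resolve_left (sub_ne_zero.2 h₂)
        obtain rfl : A = -84 := by linear_combination e3 - h3
        obtain rfl : C = 252 := by linear_combination e3
        exact Or.inr (Or.inr (Or.inr (Or.inr (Or.inl
          ⟨rfl, rfl, rfl, rfl, rfl, rfl, by linear_combination (-1/56 : K) * hAA⟩))))
    · have h3 := (mul_eq_zero.1 hab).resolve_left (sub_ne_zero.2 h₁)
      obtain rfl : C = -84 := by linear_combination e3 - h3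
      by_cases h₂ : A = -84
      · subst h₂
        obtain rfl : B = 252 := by linear_combination e3
        exact Or.inr (Or.inr (Or.inr (Or.inr (Or.inr (Or.inl
          ⟨rfl, rfl, rfl, rfl, rfl, rfl, by linear_combination (-1/56 : K) * hAA⟩)))))
      · have h4 := (mul_eq_zero.1 hac).resolve_left (sub_ne_zero.2 h₂)
        obtain rfl : A = 252 := by linear_combination h4
        obtain rfl : B = -84 := by linear_combination e3
        exact Or.inr (Or.inr (Or.inr (Or.inr (Or.inr (Or.inr
          ⟨rfl, rfl, rfl, rfl, rfl, rfl, by linear_combination (-1/56 : K) * hAA⟩)))))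
  · have hS0 : S = 0 := by
      have : (X + 21) * S = 0 := by linear_combination hS
      exact (mul_eq_zero.1 this).resolve_left fun h => hX (by linear_combination h)
    have hS0' : S' = 0 := by
      have : (X + 21) * S' = 0 := by linear_combination hS'
      exact (mul_eq_zero.1 this).resolve_left fun h => hX (by linear_combination h)
    have hAB : A = B := by
      have : (X + 21) * (A - B) = 0 := by linear_combination hA - hB
      exact sub_eq_zero.1 ((mul_eq_zero.1 this).resolve_left fun h => hX (by linear_combination h))
    have hAC : A = C := by
      have : (X + 21) * (A - C) = 0 := by linear_combination hA - hC
      exact sub_eq_zero.1 ((mul_eq_zero.1 this).resolve_left fun h => hX (by linear_combination h))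
    subst hAB hAC
    have hA' : A = X - 15 := by
      have : (X + 21) * (A - (X - 15)) = 0 := by linear_combination hA - h1
      exact sub_eq_zero.1 ((mul_eq_zero.1 this).resolve_left fun h => hX (by linear_combination h))
    subst hA'
    have hFX : F + F' = (X * X - 50 * X + 45) / 5 := by linear_combination (-1/5 : K) * h1
    have hcub : (X - 15) * ((X - 75) * (X + 5)) = 0 := by
      linear_combination 5 * (hF + hF') - 5 * (X - 35) * hFX
    have hFF : (X + 5) * (F - F') = 0 := by linear_combination hF - hF'
    rcases mul_eq_zero.1 hcub with h | h
    · obtain rfl : X = 15 := by linear_combination h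
      have : F = F' := by linear_combination (1/20 : K) * hFF
      refine Or.inl ⟨rfl, by ring, by ring, by ring, by linear_combination hFX, this, hS0, hS0'⟩
    rcases mul_eq_zero.1 h with h | h
    · obtain rfl : X = 75 := by linear_combination h
      have : F = F' := by linear_combination (1/80 : K) * hFF
      refine Or.inr (Or.inl ⟨rfl, by ring, by ring, by ring, by linear_combination hFX, this, hS0, hS0'⟩)
    · obtain rfl : X = -5 := by linear_combination h
      exact Or.inr (Or.inr (Or.inl ⟨rfl, by ring, by ring, by ring, by linear_combination hFX, hS0, hS0'⟩))

/-- Orthogonality in disguise: `e0` to `e5` have the form (X - λ)L = 0, where L pairs the unknown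
central character with the characters χ of PSL₃(4) whose transvection class sum acts by λ. At most
one L can survive, and the vanishing of the others determines the values. -/
theorem trivial_relations {X A B C F F' S S' W : K}
    (h1 : X * X = 315 + 26 * X + 8 * (A + B + C) + 5 * (F + F') + 9 * W)
    (hA : X * A = 32 * X + 35 * A + 8 * B + 8 * C + 20 * (F + F') + 21 * (S + S') + 18 * W)
    (hB : X * B = 32 * X + 35 * B + 8 * A + 8 * C + 20 * (F + F') + 21 * (S + S') + 18 * W)
    (hC : X * C = 32 * X + 35 * C + 8 * A + 8 * B + 20 * (F + F') + 21 * (S + S') + 18 * W)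
    (hF : X * F = 64 * X + 64 * (A + B + C) + 60 * F + 65 * F' + 63 * (S + S') + 63 * W)
    (hF' : X * F' = 64 * X + 64 * (A + B + C) + 65 * F + 60 * F' + 63 * (S + S') + 63 * W)
    (hS : X * S = 48 * (A + B + C) + 45 * (F + F') + 42 * S + 63 * S' + 27 * W)
    (hS' : X * S' = 48 * (A + B + C) + 45 * (F + F') + 63 * S + 42 * S' + 27 * W)
    (hW : X * W = 64 * X + 32 * (A + B + C) + 35 * (F + F') + 21 * (S + S') + 72 * W)
    (hAA : A * A = 1260 + 140 * X + 136 * A + 64 * (B + C) + 80 * (F + F') + 77 * (S + S') + 54 * W)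
    (hBB : B * B = 1260 + 140 * X + 136 * B + 64 * (A + C) + 80 * (F + F') + 77 * (S + S') + 54 * W)
    (hCC : C * C =
      1260 + 140 * X + 136 * C + 64 * (A + B) + 80 * (F + F') + 77 * (S + S') + 54 * W) :
    (X = 315 ∧ A = 1260 ∧ B = 1260 ∧ C = 1260 ∧ F = 4032 ∧ F' = 4032 ∧ S = 2880 ∧ S' = 2880 ∧
      W = 2240) ∨
    (X = 63 ∧ A = 0 ∧ B = 0 ∧ C = 0 ∧ F + F' = 0 ∧ F = F' ∧ S + S' = -288 ∧ S = S' ∧ W = 224) ∨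
    (X = 27 ∧ ((A = 108 ∧ B = -36 ∧ C = -36) ∨ (A = -36 ∧ B = 108 ∧ C = -36) ∨
      (A = -36 ∧ B = -36 ∧ C = 108)) ∧
      F + F' = 0 ∧ F = F' ∧ S + S' = 0 ∧ S = S' ∧ W = -64) ∨
    (X = -21 ∧ A = 28 ∧ B = 28 ∧ C = 28 ∧ F + F' = 0 ∧ F = F' ∧ S + S' = -64 ∧ W = 0) ∨
    (X = -5 ∧ A = -20 ∧ B = -20 ∧ C = -20 ∧ F + F' = 64 ∧ S + S' = 0 ∧ S = S' ∧ W = 0) ∨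
    (X = 0 ∧ A = 0 ∧ B = 0 ∧ C = 0 ∧ F + F' = -126 ∧ F = F' ∧ S + S' = 90 ∧ S = S' ∧ W = 35) := by
  -- The forms belong to the trivial character, the degree 20, the sum of the three of degree 35,
  -- the sum of the two of degree 45, the sum of the two of degree 63, and the degree 64.
  have e0 : (X - (315)) * (1 + (1) * X + (1) * (A + B + C) + (1) * (F + F') + (1) * (S + S') + (1) * W) = 0 := by
    linear_combination (1) * h1 + (1) * (hA + hB + hC) + (1) * (hF + hF') + (1) * (hS + hS') + (1) * hW
  have e1 : (X - (63)) * (20 + (4) * X + (-1) * (S + S') + (2) * W) = 0 := by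
    linear_combination (4) * h1 + (-1) * (hS + hS') + (2) * hW
  have e2 : (X - (27)) * (105 + (9) * X + (1) * (A + B + C) + (-3) * W) = 0 := by
    linear_combination (9) * h1 + (1) * (hA + hB + hC) + (-3) * hW
  have e3 : (X - (-21)) * (90 + (-6) * X + (2) * (A + B + C) + (-1) * (S + S')) = 0 := by
    linear_combination (-6) * h1 + (2) * (hA + hB + hC) + (-1) * (hS + hS')
  have e4 : (X - (-5)) * (126 + (-2) * X + (-2) * (A + B + C) + (1) * (F + F')) = 0 := by
    linear_combination (-2) * h1 + (-2) * (hA + hB + hC) + (1) * (hF + hF')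
  have e5 : (X - (0)) * (64 + (-1) * (F + F') + (1) * (S + S') + (1) * W) = 0 := by
    linear_combination (-1) * (hF + hF') + (1) * (hS + hS') + (1) * hW
  have hAB : (X - 27) * (A - B) = 0 := by linear_combination hA - hB
  have hAC : (X - 27) * (A - C) = 0 := by linear_combination hA - hC
  have hFF : (X + 5) * (F - F') = 0 := by linear_combination hF - hF'
  have hSS : (X + 21) * (S - S') = 0 := by linear_combination hS - hS'
  by_cases hx0 : X = 315
  · subst hx0
    have g1 : 20 + (4) * (315) + (-1) * (S + S') + (2) * W = 0 := by
      linear_combination (1/252 : K) * e1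
    have g2 : 105 + (9) * (315) + (1) * (A + B + C) + (-3) * W = 0 := by
      linear_combination (1/288 : K) * e2
    have g3 : 90 + (-6) * (315) + (2) * (A + B + C) + (-1) * (S + S') = 0 := by
      linear_combination (1/336 : K) * e3
    have g4 : 126 + (-2) * (315) + (-2) * (A + B + C) + (1) * (F + F') = 0 := by
      linear_combination (1/320 : K) * e4
    have g5 : 64 + (-1) * (F + F') + (1) * (S + S') + (1) * W = 0 := by
      linear_combination (1/315 : K) * e5
    have v2 : (A + B + C) = 3780 := by linear_combination (-3/4) * g1 + (-1/2) * g2 + (3/4) * g3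
    have v3 : (F + F') = 8064 := by linear_combination (-3/2) * g1 + (-1) * g2 + (3/2) * g3 + (1) * g4
    have v4 : (S + S') = 5760 := by linear_combination (-3/2) * g1 + (-1) * g2 + (1/2) * g3
    have v5 : W = 2240 := by linear_combination (-1/4) * g1 + (-1/2) * g2 + (1/4) * g3
    have hab : A = B := by linear_combination (1/288 : K) * hAB
    have hac : A = C := by linear_combination (1/288 : K) * hAC
    subst hab hac
    obtain rfl : A = 1260 := by linear_combination (1/3 : K) * v2
    have hff : F = F' := by linear_combination (1/320 : K) * hFF
    have hss : S = S' := by linear_combination (1/336 : K) * hSS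
    exact Or.inl ⟨rfl, rfl, rfl, rfl, by linear_combination (1/2 : K) * (v3 + hff), by linear_combination (1/2 : K) * (v3 - hff), by linear_combination (1/2 : K) * (v4 + hss),
      by linear_combination (1/2 : K) * (v4 - hss), v5⟩
  by_cases hx1 : X = 63
  · subst hx1
    have g0 : 1 + (1) * (63) + (1) * (A + B + C) + (1) * (F + F') + (1) * (S + S') + (1) * W = 0 := by
      linear_combination (-1/252 : K) * e0
    have g2 : 105 + (9) * (63) + (1) * (A + B + C) + (-3) * W = 0 := by
      linear_combination (1/36 : K) * e2
    have g3 : 90 + (-6) * (63) + (2) * (A + B + C) + (-1) * (S + S') = 0 := by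
      linear_combination (1/84 : K) * e3
    have g4 : 126 + (-2) * (63) + (-2) * (A + B + C) + (1) * (F + F') = 0 := by
      linear_combination (1/68 : K) * e4
    have g5 : 64 + (-1) * (F + F') + (1) * (S + S') + (1) * W = 0 := by
      linear_combination (1/63 : K) * e5
    have v2 : (A + B + C) = 0 := by linear_combination (3/16) * g0 + (1/16) * g2 + (3/16) * g3 + (-3/16) * g4
    have v3 : (F + F') = 0 := by linear_combination (3/8) * g0 + (1/8) * g2 + (3/8) * g3 + (5/8) * g4
    have v4 : (S + S') = -288 := by linear_combination (3/8) * g0 + (1/8) * g2 + (-5/8) * g3 + (-3/8) * g4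
    have v5 : W = 224 := by linear_combination (1/16) * g0 + (-5/16) * g2 + (1/16) * g3 + (-1/16) * g4
    have hab : A = B := by linear_combination (1/36 : K) * hAB
    have hac : A = C := by linear_combination (1/36 : K) * hAC
    subst hab hac
    obtain rfl : A = 0 := by linear_combination (1/3 : K) * v2
    have hff : F = F' := by linear_combination (1/68 : K) * hFF
    have hss : S = S' := by linear_combination (1/84 : K) * hSS
    exact Or.inr (Or.inl ⟨rfl, rfl, rfl, rfl, v3, hff, v4, hss, v5⟩)
  by_cases hx2 : X = 27
  · subst hx2
    have g0 : 1 + (1) * (27) + (1) * (A + B + C) + (1) * (F + F') + (1) * (S + S') + (1) * W = 0 := by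
      linear_combination (-1/288 : K) * e0
    have g1 : 20 + (4) * (27) + (-1) * (S + S') + (2) * W = 0 := by
      linear_combination (-1/36 : K) * e1
    have g3 : 90 + (-6) * (27) + (2) * (A + B + C) + (-1) * (S + S') = 0 := by
      linear_combination (1/48 : K) * e3
    have g4 : 126 + (-2) * (27) + (-2) * (A + B + C) + (1) * (F + F') = 0 := by
      linear_combination (1/32 : K) * e4
    have g5 : 64 + (-1) * (F + F') + (1) * (S + S') + (1) * W = 0 := by
      linear_combination (1/27 : K) * e5
    have v2 : (A + B + C) = 36 := by linear_combination (1/6) * g0 + (-1/12) * g1 + (1/4) * g3 + (-1/6) * g4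
    have v3 : (F + F') = 0 := by linear_combination (1/3) * g0 + (-1/6) * g1 + (1/2) * g3 + (2/3) * g4
    have v4 : (S + S') = 0 := by linear_combination (1/3) * g0 + (-1/6) * g1 + (-1/2) * g3 + (-1/3) * g4
    have v5 : W = -64 := by linear_combination (1/6) * g0 + (5/12) * g1 + (-1/4) * g3 + (-1/6) * g4
    have hff : F = F' := by linear_combination (1/32 : K) * hFF
    have hss : S = S' := by linear_combination (1/48 : K) * hSS
    -- For X = 27 the linear equations fix only A + B + C = 36; the squares leave the two values 108
    -- and -36 for each letter.
    have rt : ∀ A B C : K, A + B + C = 36 → A * A = 1260 + 140 * 27 + 136 * A + 64 * (B + C) +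
        80 * (F + F') + 77 * (S + S') + 54 * W → A = 108 ∨ A = -36 := fun A B C h hA => by
      have : (A - 108) * (A + 36) = 0 := by
        linear_combination hA + 64 * h + 80 * v3 + 77 * v4 + 54 * v5
      rcases mul_eq_zero.1 this with h | h
      · exact Or.inl (by linear_combination h)
      · exact Or.inr (by linear_combination h)
    have h : (A = 108 ∧ B = -36 ∧ C = -36) ∨ (A = -36 ∧ B = 108 ∧ C = -36) ∨
        (A = -36 ∧ B = -36 ∧ C = 108) := by
      rcases rt A B C v2 hAA with rfl | rfl <;>
        rcases rt B _ C (by linear_combination v2) hBB with rfl | rfl <;>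
          rcases rt C _ _ (by linear_combination v2) hCC with rfl | rfl <;>
            norm_num at v2 <;> norm_num
    exact Or.inr (Or.inr (Or.inl ⟨rfl, h, v3, hff, v4, hss, v5⟩))
  by_cases hx3 : X = -21
  · subst hx3
    have g0 : 1 + (1) * (-21) + (1) * (A + B + C) + (1) * (F + F') + (1) * (S + S') + (1) * W = 0 := by
      linear_combination (-1/336 : K) * e0
    have g1 : 20 + (4) * (-21) + (-1) * (S + S') + (2) * W = 0 := by
      linear_combination (-1/84 : K) * e1
    have g2 : 105 + (9) * (-21) + (1) * (A + B + C) + (-3) * W = 0 := by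
      linear_combination (-1/48 : K) * e2
    have g4 : 126 + (-2) * (-21) + (-2) * (A + B + C) + (1) * (F + F') = 0 := by
      linear_combination (-1/16 : K) * e4
    have g5 : 64 + (-1) * (F + F') + (1) * (S + S') + (1) * W = 0 := by
      linear_combination (-1/21 : K) * e5
    have v2 : (A + B + C) = 84 := by linear_combination (1/4) * g0 + (1/4) * g1 + (1/4) * g2 + (-1/4) * g4
    have v3 : (F + F') = 0 := by linear_combination (1/2) * g0 + (1/2) * g1 + (1/2) * g2 + (1/2) * g4
    have v4 : (S + S') = -64 := by linear_combination (1/6) * g0 + (-5/6) * g1 + (-1/2) * g2 + (-1/6) * g4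
    have v5 : W = 0 := by linear_combination (1/12) * g0 + (1/12) * g1 + (-1/4) * g2 + (-1/12) * g4
    have hab : A = B := by linear_combination (-1/48 : K) * hAB
    have hac : A = C := by linear_combination (-1/48 : K) * hAC
    subst hab hac
    obtain rfl : A = 28 := by linear_combination (1/3 : K) * v2
    have hff : F = F' := by linear_combination (-1/16 : K) * hFF
    exact Or.inr (Or.inr (Or.inr (Or.inl ⟨rfl, rfl, rfl, rfl, v3, hff, v4, v5⟩)))
  by_cases hx4 : X = -5
  · subst hx4
    have g0 : 1 + (1) * (-5) + (1) * (A + B + C) + (1) * (F + F') + (1) * (S + S') + (1) * W = 0 := by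
      linear_combination (-1/320 : K) * e0
    have g1 : 20 + (4) * (-5) + (-1) * (S + S') + (2) * W = 0 := by
      linear_combination (-1/68 : K) * e1
    have g2 : 105 + (9) * (-5) + (1) * (A + B + C) + (-3) * W = 0 := by
      linear_combination (-1/32 : K) * e2
    have g3 : 90 + (-6) * (-5) + (2) * (A + B + C) + (-1) * (S + S') = 0 := by
      linear_combination (1/16 : K) * e3
    have g5 : 64 + (-1) * (F + F') + (1) * (S + S') + (1) * W = 0 := by
      linear_combination (-1/5 : K) * e5
    have v2 : (A + B + C) = -60 := by linear_combination (-3/4) * g1 + (-1/2) * g2 + (3/4) * g3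
    have v3 : (F + F') = 64 := by linear_combination (1) * g0 + (5/2) * g1 + (2) * g2 + (-3/2) * g3
    have v4 : (S + S') = 0 := by linear_combination (-3/2) * g1 + (-1) * g2 + (1/2) * g3
    have v5 : W = 0 := by linear_combination (-1/4) * g1 + (-1/2) * g2 + (1/4) * g3
    have hab : A = B := by linear_combination (-1/32 : K) * hAB
    have hac : A = C := by linear_combination (-1/32 : K) * hAC
    subst hab hac
    obtain rfl : A = -20 := by linear_combination (1/3 : K) * v2
    have hss : S = S' := by linear_combination (1/16 : K) * hSS
    exact Or.inr (Or.inr (Or.inr (Or.inr (Or.inl ⟨rfl, rfl, rfl, rfl, v3, v4, hss, v5⟩))))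
  by_cases hx5 : X = 0
  · subst hx5
    have g0 : 1 + (1) * (0) + (1) * (A + B + C) + (1) * (F + F') + (1) * (S + S') + (1) * W = 0 := by
      linear_combination (-1/315 : K) * e0
    have g1 : 20 + (4) * (0) + (-1) * (S + S') + (2) * W = 0 := by
      linear_combination (-1/63 : K) * e1
    have g2 : 105 + (9) * (0) + (1) * (A + B + C) + (-3) * W = 0 := by
      linear_combination (-1/27 : K) * e2
    have g3 : 90 + (-6) * (0) + (2) * (A + B + C) + (-1) * (S + S') = 0 := by
      linear_combination (1/21 : K) * e3
    have g4 : 126 + (-2) * (0) + (-2) * (A + B + C) + (1) * (F + F') = 0 := by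
      linear_combination (1/5 : K) * e4
    have v2 : (A + B + C) = 0 := by linear_combination (-3/4) * g1 + (-1/2) * g2 + (3/4) * g3
    have v3 : (F + F') = -126 := by linear_combination (1) * g0 + (5/2) * g1 + (2) * g2 + (-3/2) * g3
    have v4 : (S + S') = 90 := by linear_combination (-3/2) * g1 + (-1) * g2 + (1/2) * g3
    have v5 : W = 35 := by linear_combination (-1/4) * g1 + (-1/2) * g2 + (1/4) * g3
    have hab : A = B := by linear_combination (-1/27 : K) * hAB
    have hac : A = C := by linear_combination (-1/27 : K) * hAC
    subst hab hac
    obtain rfl : A = 0 := by linear_combination (1/3 : K) * v2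
    have hff : F = F' := by linear_combination (1/5 : K) * hFF
    have hss : S = S' := by linear_combination (1/21 : K) * hSS
    exact Or.inr (Or.inr (Or.inr (Or.inr (Or.inr (⟨rfl, rfl, rfl, rfl, v3, hff, v4, hss, v5⟩)))))
  exfalso
  replace e0 := (mul_eq_zero.1 e0).resolve_left fun h => hx0 (by linear_combination h)
  replace e1 := (mul_eq_zero.1 e1).resolve_left fun h => hx1 (by linear_combination h)
  replace e2 := (mul_eq_zero.1 e2).resolve_left fun h => hx2 (by linear_combination h)
  replace e3 := (mul_eq_zero.1 e3).resolve_left fun h => hx3 (by linear_combination h)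
  replace e4 := (mul_eq_zero.1 e4).resolve_left fun h => hx4 (by linear_combination h)
  replace e5 := (mul_eq_zero.1 e5).resolve_left fun h => hx5 (by linear_combination h)
  -- The coefficients are the degrees: the forms add up to the regular character, whose pairing is
  -- |PSL₃(4)| = 20160 because it is supported at the identity.
  have : (20160 : K) = 0 := by
    linear_combination e0 + 20 * e1 + 35 * e2 + 45 * e3 + 63 * e4 + 64 * e5
  norm_num at this

/-- The values of a central character are encoded in the key. -/
def HasKey (ψ : SL34 → K) (k : CentralKey) : Prop :=
  315 * ψ (SL34.rep 1) = k.x ∧ 1260 * ψ (SL34.rep 2) = k.a ∧ 1260 * ψ (SL34.rep 3) = k.b ∧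
  1260 * ψ (SL34.rep 4) = k.c ∧ 4032 * ψ (SL34.rep 5) + 4032 * ψ (SL34.rep 6) = k.f ∧
  2880 * ψ (SL34.rep 7) + 2880 * ψ (SL34.rep 8) = k.s ∧ 2240 * ψ (SL34.rep 9) = k.w ∧
  (k.onFive = true → 2880 * ψ (SL34.rep 7) = 2880 * ψ (SL34.rep 8)) ∧
  (k.onFive = false → 4032 * ψ (SL34.rep 5) = 4032 * ψ (SL34.rep 6))

namespace SL34

theorem exists_key_of_omega_ne_one {ψ : SL34 → K} (hψ : IsCentralChar ψ) (h : ψ omega ≠ 1) :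
    ∃ k ∈ CentralKey.faithfulList, HasKey ψ k := by
  obtain ⟨ζ, hζ⟩ : ∃ ζ, ψ omega = ζ := ⟨_, rfl⟩
  have h3 := map_omega_pow_three hψ
  have h9 := map_rep_nine hψ
  rw [hζ] at h h3 h9
  have hw : ψ (rep 9) = 0 := by
    have : (ζ - 1) * ψ (rep 9) = 0 := by linear_combination h9
    exact (mul_eq_zero.1 this).resolve_left (sub_ne_zero.2 h)
  have hz : ζ ^ 2 + ζ + 1 = 0 := by
    have : (ζ - 1) * (ζ ^ 2 + ζ + 1) = 0 := by linear_combination h3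
    exact (mul_eq_zero.1 this).resolve_left (sub_ne_zero.2 h)
  have key := faithful_relations (X := 315 * ψ (rep 1)) (A := 1260 * ψ (rep 2))
    (B := 1260 * ψ (rep 3)) (C := 1260 * ψ (rep 4)) (F := 4032 * ψ (rep 5))
    (F' := 4032 * ψ (rep 6)) (S := 2880 * ψ (rep 7)) (S' := 2880 * ψ (rep 8))
    -- Each relation is scaled by a class size; the multiples of `hz` reduce the powers of ζ, and
    -- those of `hw` remove ψ(`rep 9`).
    (by linear_combination 315 * rel_transv_1 hψ hζ + 315 * (0) * hz + 20160 * hw)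
    (by linear_combination 1260 * rel_transv_2 hψ hζ + 1260 * (16 * ψ (rep 2) + 16 * ψ (rep 5) + 16 * ψ (rep 6) + 16 * ψ (rep 7) + 16 * ψ (rep 8)) * hz + 40320 * hw)
    (by linear_combination 1260 * rel_transv_3 hψ hζ + 1260 * (16 * ψ (rep 3) + 16 * ψ (rep 5) + 16 * ψ (rep 6) + 16 * ψ (rep 7) + 16 * ψ (rep 8)) * hz + 40320 * hw)
    (by linear_combination 1260 * rel_transv_4 hψ hζ + 1260 * (16 * ψ (rep 4) + 16 * ψ (rep 5) + 16 * ψ (rep 6) + 16 * ψ (rep 7) + 16 * ψ (rep 8)) * hz + 40320 * hw)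
    (by linear_combination 4032 * rel_transv_5 hψ hζ + 4032 * (5 * ψ (rep 2) + 5 * ψ (rep 3) + 5 * ψ (rep 4) + 15 * ψ (rep 5) + 15 * ψ (rep 6) + 15 * ψ (rep 7) + 15 * ψ (rep 8)) * hz + 141120 * hw)
    (by linear_combination 4032 * rel_transv_6 hψ hζ + 4032 * (5 * ψ (rep 2) + 5 * ψ (rep 3) + 5 * ψ (rep 4) + 15 * ψ (rep 5) + 15 * ψ (rep 6) + 15 * ψ (rep 7) + 15 * ψ (rep 8)) * hz + 141120 * hw)
    (by linear_combination 2880 * rel_transv_7 hψ hζ + 2880 * (7 * ψ (rep 2) + 7 * ψ (rep 3) + 7 * ψ (rep 4) + 21 * ψ (rep 5) + 21 * ψ (rep 6) + 21 * ψ (rep 7) + 21 * ψ (rep 8)) * hz + 60480 * hw)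
    (by linear_combination 2880 * rel_transv_8 hψ hζ + 2880 * (7 * ψ (rep 2) + 7 * ψ (rep 3) + 7 * ψ (rep 4) + 21 * ψ (rep 5) + 21 * ψ (rep 6) + 21 * ψ (rep 7) + 21 * ψ (rep 8)) * hz + 60480 * hw)
    (by linear_combination 1260 * rel_regUni_2 hψ hζ + 1260 * (16 * ψ (rep 1) + 32 * ψ (rep 3) + 32 * ψ (rep 4) + 80 * ψ (rep 5) + 80 * ψ (rep 6) + 16 * ψ (rep 7) + 16 * ψ (rep 8)) * hz + 120960 * hw)
    (by linear_combination 1260 * rel_regUni_3 hψ hζ + 1260 * (16 * ψ (rep 1) + 32 * ψ (rep 2) + 32 * ψ (rep 4) + 80 * ψ (rep 5) + 80 * ψ (rep 6) + 16 * ψ (rep 7) + 16 * ψ (rep 8)) * hz + 120960 * hw)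
    (by linear_combination 1260 * rel_regUni_4 hψ hζ + 1260 * (16 * ψ (rep 1) + 32 * ψ (rep 2) + 32 * ψ (rep 3) + 80 * ψ (rep 5) + 80 * ψ (rep 6) + 16 * ψ (rep 7) + 16 * ψ (rep 8)) * hz + 120960 * hw)
  rcases key with ⟨e1, e2, e3, e4, e5, -, e6, e7⟩ | ⟨e1, e2, e3, e4, e5, -, e6, e7⟩ |
    ⟨e1, e2, e3, e4, e5, e6, e7⟩ | ⟨e1, e2, e3, e4, e5, e6, e7⟩ |
    ⟨e1, e2, e3, e4, e5, e6, e7⟩ | ⟨e1, e2, e3, e4, e5, e6, e7⟩ | ⟨e1, e2, e3, e4, e5, e6, e7⟩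
  · exact ⟨⟨15, 0, 0, 0, -96, 0, 0, true⟩, by decide, by push_cast; exact e1, by push_cast; exact e2, by push_cast; exact e3,
      by push_cast; exact e4, by push_cast; exact e5, by push_cast; rw [e6, e7]; norm_num, by push_cast; rw [hw]; norm_num, fun _ => e6.trans e7.symm, nofun⟩
  · exact ⟨⟨75, 60, 60, 60, 384, 0, 0, true⟩, by decide, by push_cast; exact e1, by push_cast; exact e2, by push_cast; exact e3,
      by push_cast; exact e4, by push_cast; exact e5, by push_cast; rw [e6, e7]; norm_num, by push_cast; rw [hw]; norm_num, fun _ => e6.trans e7.symm, nofun⟩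
  · exact ⟨⟨-5, -20, -20, -20, 64, 0, 0, true⟩, by decide, by push_cast; exact e1, by push_cast; exact e2, by push_cast; exact e3,
      by push_cast; exact e4, by push_cast; exact e5, by push_cast; rw [e6, e7]; norm_num, by push_cast; rw [hw]; norm_num, fun _ => e6.trans e7.symm, nofun⟩
  · exact ⟨⟨-21, 28, 28, 28, 0, -64, 0, false⟩, by decide, by push_cast; exact e1, by push_cast; exact e2, by push_cast; exact e3,
      by push_cast; exact e4, by push_cast; rw [e5, e6]; norm_num, by push_cast; exact e7, by push_cast; rw [hw]; norm_num, nofun, fun _ => e5.trans e6.symm⟩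
  · exact ⟨⟨-21, -84, -84, 252, 0, 384, 0, false⟩, by decide, by push_cast; exact e1, by push_cast; exact e2, by push_cast; exact e3,
      by push_cast; exact e4, by push_cast; rw [e5, e6]; norm_num, by push_cast; exact e7, by push_cast; rw [hw]; norm_num, nofun, fun _ => e5.trans e6.symm⟩
  · exact ⟨⟨-21, -84, 252, -84, 0, 384, 0, false⟩, by decide, by push_cast; exact e1, by push_cast; exact e2, by push_cast; exact e3,
      by push_cast; exact e4, by push_cast; rw [e5, e6]; norm_num, by push_cast; exact e7, by push_cast; rw [hw]; norm_num, nofun, fun _ => e5.trans e6.symm⟩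
  · exact ⟨⟨-21, 252, -84, -84, 0, 384, 0, false⟩, by decide, by push_cast; exact e1, by push_cast; exact e2, by push_cast; exact e3,
      by push_cast; exact e4, by push_cast; rw [e5, e6]; norm_num, by push_cast; exact e7, by push_cast; rw [hw]; norm_num, nofun, fun _ => e5.trans e6.symm⟩

theorem exists_key_of_omega_eq_one {ψ : SL34 → K} (hψ : IsCentralChar ψ) (h : ψ omega = 1)
    (h1 : ∃ g, ψ g ≠ 1) : ∃ k ∈ CentralKey.trivialList, HasKey ψ k := by
  have key := trivial_relations (X := 315 * ψ (rep 1)) (A := 1260 * ψ (rep 2))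
    (B := 1260 * ψ (rep 3)) (C := 1260 * ψ (rep 4)) (F := 4032 * ψ (rep 5))
    (F' := 4032 * ψ (rep 6)) (S := 2880 * ψ (rep 7)) (S' := 2880 * ψ (rep 8))
    (W := 2240 * ψ (rep 9))
    (by linear_combination 315 * rel_transv_1 hψ h)
    (by linear_combination 1260 * rel_transv_2 hψ h)
    (by linear_combination 1260 * rel_transv_3 hψ h)
    (by linear_combination 1260 * rel_transv_4 hψ h)
    (by linear_combination 4032 * rel_transv_5 hψ h)
    (by linear_combination 4032 * rel_transv_6 hψ h)
    (by linear_combination 2880 * rel_transv_7 hψ h)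
    (by linear_combination 2880 * rel_transv_8 hψ h)
    (by linear_combination 2240 * rel_transv_9 hψ h)
    (by linear_combination 1260 * rel_regUni_2 hψ h)
    (by linear_combination 1260 * rel_regUni_3 hψ h)
    (by linear_combination 1260 * rel_regUni_4 hψ h)
  rcases key with ⟨e1, e2, e3, e4, e5, e6, e7, e8, e9⟩ | key
  -- The solution X = 315 is the trivial character.
  · exfalso
    obtain ⟨g, hg⟩ := h1
    apply hg
    obtain ⟨j, hj, x, rfl⟩ := exists_label g
    rw [hψ.conj, map_ofLabel hψ, h, one_pow, one_mul]
    have hj' : j / 3 < 10 := by omega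
    interval_cases j / 3
    · exact hψ.one
    · linear_combination (1/315 : K) * e1
    · linear_combination (1/1260 : K) * e2
    · linear_combination (1/1260 : K) * e3
    · linear_combination (1/1260 : K) * e4
    · linear_combination (1/4032 : K) * e5
    · linear_combination (1/4032 : K) * e6
    · linear_combination (1/2880 : K) * e7
    · linear_combination (1/2880 : K) * e8
    · linear_combination (1/2240 : K) * e9
  rcases key with ⟨e1, e2, e3, e4, e5, -, e6, e7, e8⟩ |
    ⟨e1, ⟨e2, e3, e4⟩ | ⟨e2, e3, e4⟩ | ⟨e2, e3, e4⟩, e5, -, e6, e7, e8⟩ |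
    ⟨e1, e2, e3, e4, e5, e7, e6, e8⟩ | ⟨e1, e2, e3, e4, e5, e6, e7, e8⟩ |
    ⟨e1, e2, e3, e4, e5, -, e6, e7, e8⟩
  · exact ⟨⟨63, 0, 0, 0, 0, -288, 224, true⟩, by decide, by push_cast; exact e1, by push_cast; exact e2, by push_cast; exact e3,
      by push_cast; exact e4, by push_cast; exact e5, by push_cast; exact e6, by push_cast; exact e8, fun _ => e7, nofun⟩
  · exact ⟨⟨27, 108, -36, -36, 0, 0, -64, true⟩, by decide, by push_cast; exact e1, by push_cast; exact e2, by push_cast; exact e3,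
      by push_cast; exact e4, by push_cast; exact e5, by push_cast; exact e6, by push_cast; exact e8, fun _ => e7, nofun⟩
  · exact ⟨⟨27, -36, 108, -36, 0, 0, -64, true⟩, by decide, by push_cast; exact e1, by push_cast; exact e2, by push_cast; exact e3,
      by push_cast; exact e4, by push_cast; exact e5, by push_cast; exact e6, by push_cast; exact e8, fun _ => e7, nofun⟩
  · exact ⟨⟨27, -36, -36, 108, 0, 0, -64, true⟩, by decide, by push_cast; exact e1, by push_cast; exact e2, by push_cast; exact e3,
      by push_cast; exact e4, by push_cast; exact e5, by push_cast; exact e6, by push_cast; exact e8, fun _ => e7, nofun⟩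
  · exact ⟨⟨-21, 28, 28, 28, 0, -64, 0, false⟩, by decide, by push_cast; exact e1, by push_cast; exact e2, by push_cast; exact e3,
      by push_cast; exact e4, by push_cast; exact e5, by push_cast; exact e6, by push_cast; exact e8, nofun, fun _ => e7⟩
  · exact ⟨⟨-5, -20, -20, -20, 64, 0, 0, true⟩, by decide, by push_cast; exact e1, by push_cast; exact e2, by push_cast; exact e3,
      by push_cast; exact e4, by push_cast; exact e5, by push_cast; exact e6, by push_cast; exact e8, fun _ => e7, nofun⟩
  · exact ⟨⟨0, 0, 0, 0, -126, 90, 35, true⟩, by decide, by push_cast; exact e1, by push_cast; exact e2, by push_cast; exact e3,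
      by push_cast; exact e4, by push_cast; exact e5, by push_cast; exact e6, by push_cast; exact e8, fun _ => e7, nofun⟩

end SL34

end

/-! ### Three congruent non-trivial central characters cannot exist -/

namespace IsTransversal

variable {G ι κ : Type*} [Group G] [Fintype G] [DecidableEq G] [Fintype ι] [Fintype κ]
  {H : Subgroup G} {x : ι → G}

/-- How often an element is hit by a family of conjugates. -/
def hits (x : ι → G) (f : κ → G) (g : G) : ℕ :=
  ∑ i, ∑ j, if x i * f j * (x i)⁻¹ = g then 1 else 0

/-- Summing over the whole group instead of the transversal multiplies `hits` by |H| and makes the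
invariance visible. This makes `hits` an admissible test function for congruences of central
characters. -/
theorem hits_conj (hx : IsTransversal H x) {f : κ → G} (hf : Function.Injective f)
    (hH : ∀ k ∈ H, ∀ i, ∃ j, k * f i * k⁻¹ = f j) (y g : G) :
    hits x f (y * g * y⁻¹) = hits x f g := by
  have key : ∀ g, ∑ z, ∑ j, (if z * f j * z⁻¹ = g then 1 else 0) = Nat.card H * hits x f g := by
    intro g
    have h := hx.sum_eq (fun z => ∑ j, if z * f j * z⁻¹ = g then 1 else 0) (fun z k hk => by
      choose σ hσ using hH k hk
      have hinj : Function.Injective σ := fun i j hij => by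
        apply hf
        have := hσ i
        rw [hij, ← hσ j] at this
        exact mul_left_cancel (mul_right_cancel this)
      rw [← (Equiv.ofBijective σ (Finite.injective_iff_bijective.1 hinj)).sum_comp
        (fun j => if z * f j * z⁻¹ = g then 1 else 0)]
      refine Finset.sum_congr rfl fun j _ => ?_
      rw [Equiv.ofBijective_apply, ← hσ]
      congr 2
      group)
    rw [h, smul_eq_mul]
    rfl
  have h0 : 0 < Nat.card H := Nat.card_pos
  apply Nat.eq_of_mul_eq_mul_left h0
  rw [← key, ← key, ← Equiv.sum_comp (Equiv.mulLeft y)]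
  refine Finset.sum_congr rfl fun z _ => Finset.sum_congr rfl fun j _ => ?_
  congr 1
  rw [Equiv.coe_mulLeft, mul_inv_rev, eq_iff_iff]
  constructor
  · intro h
    apply mul_left_cancel (a := y)
    apply mul_right_cancel (b := y⁻¹)
    rw [← h]; group
  · rintro rfl; group

theorem sum_hits_mul {R : Type*} [CommSemiring R] (x : ι → G) (f : κ → G) (φ : G → R) :
    ∑ g, (hits x f g : R) * φ g = ∑ i, ∑ j, φ (x i * f j * (x i)⁻¹) := by
  simp only [hits, Nat.cast_sum, Finset.sum_mul, Nat.cast_ite, Nat.cast_one, Nat.cast_zero,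
    ite_mul, one_mul, zero_mul]
  rw [Finset.sum_comm]
  refine Finset.sum_congr rfl fun i _ => ?_
  rw [Finset.sum_comm]
  simp

end IsTransversal

namespace SL34

open IsTransversal

variable {K : Type*} [Field K] [CharZero K]

theorem sum_hits_transv {ψ : SL34 → K} (hψ : IsCentralChar ψ) :
    ∑ g, (hits flagRep transv g : K) * ψ g = 315 * ψ (rep 1) := by
  rw [sum_hits_mul]
  have h : ∀ i j, ψ (flagRep i * transv j * (flagRep i)⁻¹) = ψ (rep 1) := fun i j => by
    rw [hψ.conj]
    fin_cases j <;>
      exact (map_eq_of_lab hψ (j := 3) rfl (by norm_num)).trans (by rw [map_ofLabel hψ]; simp)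
  simp only [h, Finset.sum_const, Finset.card_univ]
  rw [show Fintype.card (Pt × (F4 ⊕ Unit)) = 105 from rfl, Fintype.card_fin, smul_smul, nsmul_eq_mul]
  norm_num

theorem sum_hits_regUni {ψ : SL34 → K} (hψ : IsCentralChar ψ) (d : F4) {k : ℕ}
    (hd : ∀ p, M3.lab (regUni d p).raw = 3 * k) (hk : k < 9) :
    ∑ g, (hits flagRep (regUni d) g : K) * ψ g = 1260 * ψ (rep k) := by
  rw [sum_hits_mul]
  have h : ∀ i j, ψ (flagRep i * regUni d j * (flagRep i)⁻¹) = ψ (rep k) := fun i j => by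
    rw [hψ.conj, map_eq_of_lab hψ (hd j) (by omega), map_ofLabel hψ]; simp
  simp only [h, Finset.sum_const, Finset.card_univ]
  rw [show Fintype.card (Pt × (F4 ⊕ Unit)) = 105 from rfl,
    show Fintype.card (F4 × Fin 3) = 12 from rfl, smul_smul, nsmul_eq_mul]
  norm_num

/-- The first four entries of a key determine it, even modulo 64. -/
theorem key_eq_of_dvd {l : List CentralKey}
    (hl : l = CentralKey.trivialList ∨ l = CentralKey.faithfulList) :
    ∀ k ∈ l, ∀ k' ∈ l, 64 ∣ k.x - k'.x → 64 ∣ k.a - k'.a → 64 ∣ k.b - k'.b → 64 ∣ k.c - k'.c →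
      k = k' := by
  rcases hl with rfl | rfl <;> decide

/-- Three nontrivial central characters with the same key and the same central action are not
pairwise distinct. -/
theorem eq_or_eq_of_hasKey {ψ₁ ψ₂ ψ₃ : SL34 → K} (h₁ : IsCentralChar ψ₁) (h₂ : IsCentralChar ψ₂)
    (h₃ : IsCentralChar ψ₃) (hz₂ : ψ₁ omega = ψ₂ omega) (hz₃ : ψ₁ omega = ψ₃ omega)
    {k : CentralKey} (hk₁ : HasKey ψ₁ k) (hk₂ : HasKey ψ₂ k) (hk₃ : HasKey ψ₃ k) :
    ψ₁ = ψ₂ ∨ ψ₃ = ψ₁ ∨ ψ₃ = ψ₂ := by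
  obtain ⟨a1, a2, a3, a4, a5, a6, a7, a8, a9⟩ := hk₁
  obtain ⟨b1, b2, b3, b4, b5, b6, b7, b8, b9⟩ := hk₂
  obtain ⟨c1, c2, c3, c4, c5, c6, c7, c8, c9⟩ := hk₃
  -- All three functions agree outside one pair of classes, and on that pair their two values have
  -- the same sum. So they lie on a line, where collinearity forces two to coincide.
  have affine : ∀ α : K, (∀ n < 10, ψ₃ (rep n) = α * ψ₁ (rep n) + (1 - α) * ψ₂ (rep n)) →
      ψ₁ = ψ₂ ∨ ψ₃ = ψ₁ ∨ ψ₃ = ψ₂ := fun α h => by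
    refine h₁.eq_or_eq_of_affine h₂ h₃ α fun g => ?_
    obtain ⟨j, hj, x, rfl⟩ := exists_label g
    rw [h₁.conj, h₂.conj, h₃.conj, map_ofLabel h₁, map_ofLabel h₂, map_ofLabel h₃, ← hz₂, ← hz₃,
      h _ (by omega)]
    ring
  have common : ∀ α : K, (∀ n < 10, 4 < n → n < 9 →
      ψ₃ (rep n) = α * ψ₁ (rep n) + (1 - α) * ψ₂ (rep n)) →
      ψ₁ = ψ₂ ∨ ψ₃ = ψ₁ ∨ ψ₃ = ψ₂ := fun α h => affine α fun n hn => by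
    by_cases h' : 4 < n ∧ n < 9
    · exact h n hn h'.1 h'.2
    have : n = 0 ∨ n = 1 ∨ n = 2 ∨ n = 3 ∨ n = 4 ∨ n = 9 := by omega
    rcases this with rfl | rfl | rfl | rfl | rfl | rfl
    · rw [show rep 0 = 1 from rfl, h₁.one, h₂.one, h₃.one]; ring
    · linear_combination (1/315 : K) * (c1 - α * a1 - (1 - α) * b1)
    · linear_combination (1/1260 : K) * (c2 - α * a2 - (1 - α) * b2)
    · linear_combination (1/1260 : K) * (c3 - α * a3 - (1 - α) * b3)
    · linear_combination (1/1260 : K) * (c4 - α * a4 - (1 - α) * b4)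
    · linear_combination (1/2240 : K) * (c7 - α * a7 - (1 - α) * b7)
  -- The parameter α is determined by the class k, and the common sum carries it over to m. If ψ₁
  -- and ψ₂ agree on k, they agree on both.
  have twin : ∀ k m : ℕ, ψ₁ (rep k) + ψ₁ (rep m) = ψ₃ (rep k) + ψ₃ (rep m) →
      ψ₂ (rep k) + ψ₂ (rep m) = ψ₃ (rep k) + ψ₃ (rep m) →
      ∃ α : K, ψ₃ (rep k) = α * ψ₁ (rep k) + (1 - α) * ψ₂ (rep k) ∧
        ψ₃ (rep m) = α * ψ₁ (rep m) + (1 - α) * ψ₂ (rep m) ∨ ψ₁ (rep k) = ψ₂ (rep k) ∧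
          ψ₁ (rep m) = ψ₂ (rep m) := fun k m e1 e2 => by
    by_cases h : ψ₁ (rep k) - ψ₂ (rep k) = 0
    · exact ⟨0, Or.inr ⟨by linear_combination h, by linear_combination e1 - e2 - h⟩⟩
    · refine ⟨(ψ₃ (rep k) - ψ₂ (rep k)) / (ψ₁ (rep k) - ψ₂ (rep k)), Or.inl ?_⟩
      have e3 : ψ₃ (rep k) = (ψ₃ (rep k) - ψ₂ (rep k)) / (ψ₁ (rep k) - ψ₂ (rep k)) * ψ₁ (rep k) +
        (1 - (ψ₃ (rep k) - ψ₂ (rep k)) / (ψ₁ (rep k) - ψ₂ (rep k))) * ψ₂ (rep k) := by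
        field_simp
        ring
      refine ⟨e3, ?_⟩
      linear_combination (ψ₃ (rep k) - ψ₂ (rep k)) / (ψ₁ (rep k) - ψ₂ (rep k)) * (e2 - e1) - e2 - e3
  have h12 : (∀ n < 10, ψ₁ (rep n) = ψ₂ (rep n)) → ψ₁ = ψ₂ := eq_of_map_rep h₁ h₂ hz₂
  have split : ∀ P : ℕ → Prop, P 5 → P 6 → P 7 → P 8 → ∀ n < 10, 4 < n → n < 9 → P n := by
    intro P p5 p6 p7 p8 n _ hn hn'
    interval_cases n <;> assumption
  cases hk : k.onFive
  · have d1 := a9 hk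
    have d2 := b9 hk
    have d3 := c9 hk
    obtain ⟨α, ⟨e1, e2⟩ | ⟨e1, e2⟩⟩ := twin 7 8 (by linear_combination (1/2880 : K) * (a6 - c6))
      (by linear_combination (1/2880 : K) * (b6 - c6))
    · exact common α (split _
        (by linear_combination (1/8064 : K) * (c5 + d3 - α * (a5 + d1) - (1 - α) * (b5 + d2)))
        (by linear_combination (1/8064 : K) * (c5 - d3 - α * (a5 - d1) - (1 - α) * (b5 - d2))) e1 e2)
    · left
      apply h12
      intro n hn
      interval_cases n
      · rw [show rep 0 = 1 from rfl, h₁.one, h₂.one]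
      · linear_combination (1/315 : K) * (a1 - b1)
      · linear_combination (1/1260 : K) * (a2 - b2)
      · linear_combination (1/1260 : K) * (a3 - b3)
      · linear_combination (1/1260 : K) * (a4 - b4)
      · linear_combination (1/8064 : K) * (a5 + d1 - b5 - d2)
      · linear_combination (1/8064 : K) * (a5 - d1 - b5 + d2)
      · exact e1
      · exact e2
      · linear_combination (1/2240 : K) * (a7 - b7)
  · have d1 := a8 hk
    have d2 := b8 hk
    have d3 := c8 hk
    obtain ⟨α, ⟨e1, e2⟩ | ⟨e1, e2⟩⟩ := twin 5 6 (by linear_combination (1/4032 : K) * (a5 - c5))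
      (by linear_combination (1/4032 : K) * (b5 - c5))
    · exact common α (split _ e1 e2
        (by linear_combination (1/5760 : K) * (c6 + d3 - α * (a6 + d1) - (1 - α) * (b6 + d2)))
        (by linear_combination (1/5760 : K) * (c6 - d3 - α * (a6 - d1) - (1 - α) * (b6 - d2))))
    · left
      apply h12
      intro n hn
      interval_cases n
      · rw [show rep 0 = 1 from rfl, h₁.one, h₂.one]
      · linear_combination (1/315 : K) * (a1 - b1)
      · linear_combination (1/1260 : K) * (a2 - b2)
      · linear_combination (1/1260 : K) * (a3 - b3)
      · linear_combination (1/1260 : K) * (a4 - b4)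
      · exact e1
      · exact e2
      · linear_combination (1/5760 : K) * (a6 + d1 - b6 - d2)
      · linear_combination (1/5760 : K) * (a6 - d1 - b6 + d2)
      · linear_combination (1/2240 : K) * (a7 - b7)

/-- There are no three distinct nontrivial central characters of `SL₃(4)` that are congruent
modulo 64 on all integral class functions. -/
theorem eq_of_congruent (S : Subring K)
    (hS : ∀ n : ℤ, ∀ t ∈ S, (n : K) = 64 * t → 64 ∣ n) (ψ : Fin 3 → SL34 → K)
    (hψ : ∀ i, IsCentralChar (ψ i)) (h1 : ∀ i, ∃ g, ψ i g ≠ 1)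
    (hint : ∀ i, ∀ c : SL34 → ℕ, (∀ x g, c (x * g * x⁻¹) = c g) → ∑ g, (c g : K) * ψ i g ∈ S)
    (hcong : ∀ i j, ∀ c : SL34 → ℕ, (∀ x g, c (x * g * x⁻¹) = c g) →
      ∃ t ∈ S, ∑ g, (c g : K) * ψ i g - ∑ g, (c g : K) * ψ j g = 64 * t) :
    ψ 0 = ψ 1 ∨ ψ 2 = ψ 0 ∨ ψ 2 = ψ 1 := by
  have homega : ∀ x : SL34, ∀ g, (if x * g * x⁻¹ = omega then 1 else 0) =
      if g = omega then 1 else 0 := fun x g => by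
    congr 1
    rw [eq_iff_iff, mul_inv_eq_iff_eq_mul, ← omega_comm, mul_right_inj]
  -- Distinct cube roots of unity satisfy (z - z')² = -3zz'. A congruence modulo 64 would therefore
  -- make 64 divide 3.
  have hz : ∀ i j, ψ i omega = ψ j omega := fun i j => by
    by_contra hne
    obtain ⟨t, ht, e⟩ := hcong i j (fun g => if g = omega then 1 else 0) homega
    have hi := hint i (fun g => if g = omega then 1 else 0) homega
    have hj := hint j (fun g => if g = omega then 1 else 0) homega
    simp only [Nat.cast_ite, Nat.cast_one, Nat.cast_zero, ite_mul, one_mul, zero_mul,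
      Finset.sum_ite_eq', Finset.mem_univ, if_true] at e hi hj
    have hi3 := map_omega_pow_three (hψ i)
    have hj3 := map_omega_pow_three (hψ j)
    generalize ψ i omega = z at *
    generalize ψ j omega = z' at *
    have e2 : z ^ 2 + z * z' + z' ^ 2 = 0 := by
      have : (z - z') * (z ^ 2 + z * z' + z' ^ 2) = 0 := by linear_combination hi3 - hj3
      exact (mul_eq_zero.1 this).resolve_left (sub_ne_zero.2 hne)
    have := hS 3 (-64 * (t * t * (z ^ 2 * z' ^ 2))) (S.mul_mem (S.neg_mem (by exact_mod_cast natCast_mem S 64))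
      (S.mul_mem (S.mul_mem ht ht) (S.mul_mem (S.pow_mem hi 2) (S.pow_mem hj 2)))) (by
        push_cast
        linear_combination z ^ 2 * z' ^ 2 * e2 -
          (z - z' + 64 * t) * z ^ 2 * z' ^ 2 * e - 3 * z' ^ 3 * hi3 - 3 * hj3)
    omega
  have hlist : ∃ l : List CentralKey, (l = CentralKey.trivialList ∨ l = CentralKey.faithfulList) ∧
      ∀ i, ∃ k ∈ l, HasKey (ψ i) k := by
    by_cases h : ψ 0 omega = 1
    · exact ⟨_, Or.inl rfl, fun i => exists_key_of_omega_eq_one (hψ i) ((hz i 0).trans h) (h1 i)⟩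
    · exact ⟨_, Or.inr rfl, fun i => exists_key_of_omega_ne_one (hψ i) fun h' => h ((hz 0 i).trans h')⟩
  obtain ⟨l, hl, hlk⟩ := hlist
  choose k hkl hk using hlk
  -- The first four entries of a key are values on sums over unipotent classes. They are congruent
  -- modulo 64, and this already identifies the keys.
  have hkk : ∀ i j, k i = k j := fun i j => by
    refine key_eq_of_dvd hl _ (hkl i) _ (hkl j) ?_ ?_ ?_ ?_
    · obtain ⟨t, ht, e⟩ := hcong i j _ (hits_conj flagRep_transversal transv_injective
        fun k hk i => conj_transv hk i)
      refine hS _ t ht ?_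
      rw [← e, sum_hits_transv (hψ i), sum_hits_transv (hψ j), (hk i).1, (hk j).1]
      push_cast; rfl
    · obtain ⟨t, ht, e⟩ := hcong i j _ (hits_conj flagRep_transversal (regUni_injective q1)
        fun k hk i => conj_regUni q1 hk i)
      refine hS _ t ht ?_
      rw [← e, sum_hits_regUni (hψ i) q1 (k := 2) (by decide) (by norm_num),
        sum_hits_regUni (hψ j) q1 (k := 2) (by decide) (by norm_num), (hk i).2.1, (hk j).2.1]
      push_cast; rfl
    · obtain ⟨t, ht, e⟩ := hcong i j _ (hits_conj flagRep_transversal (regUni_injective q2)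
        fun k hk i => conj_regUni q2 hk i)
      refine hS _ t ht ?_
      rw [← e, sum_hits_regUni (hψ i) q2 (k := 3) (by decide) (by norm_num),
        sum_hits_regUni (hψ j) q2 (k := 3) (by decide) (by norm_num), (hk i).2.2.1, (hk j).2.2.1]
      push_cast; rfl
    · obtain ⟨t, ht, e⟩ := hcong i j _ (hits_conj flagRep_transversal (regUni_injective q3)
        fun k hk i => conj_regUni q3 hk i)
      refine hS _ t ht ?_
      rw [← e, sum_hits_regUni (hψ i) q3 (k := 4) (by decide) (by norm_num),
        sum_hits_regUni (hψ j) q3 (k := 4) (by decide) (by norm_num), (hk i).2.2.2.1,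
        (hk j).2.2.2.1]
      push_cast; rfl
  exact eq_or_eq_of_hasKey (hψ 0) (hψ 1) (hψ 2) (hz 0 1) (hz 0 2) (hk 0) (hkk 0 1 ▸ hk 1)
    (hkk 0 2 ▸ hk 2)

end SL34

/-! ### Derived equivalences and centres -/

namespace CategoryTheory

open Limits Pretriangulated Triangulated

theorem comp_pow_of_natural {C : Type*} [Category* C] {ν : ∀ X : C, End X}
    (hν : ∀ {X Y : C} (f : X ⟶ Y), f ≫ ν Y = ν X ≫ f) {X Y : C} (f : X ⟶ Y) (n : ℕ) :
    f ≫ (ν Y ^ n : End Y) = (ν X ^ n : End X) ≫ f := by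
  induction n with
  | zero =>
    rw [pow_zero, pow_zero]
    exact (Category.comp_id f).trans (Category.id_comp f).symm
  | succ n ih =>
    rw [pow_succ, pow_succ]
    change f ≫ ν Y ≫ (ν Y ^ n : End Y) = (ν X ≫ (ν X ^ n : End X)) ≫ f
    rw [← Category.assoc, hν, Category.assoc, ih, Category.assoc]

variable {C : Type*} [Category* C] [Preadditive C] [HasZeroObject C] [HasShift C ℤ]
  [∀ n : ℤ, (shiftFunctor C n).Additive] [Pretriangulated C]

/-- If ν^k = 0 on the first object and ν^l = 0 on the third, then ν^l on the middle one factors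
through the first, where ν^k kills it. -/
theorem isNilpotent_of_triangle {ν : ∀ X : C, End X}
    (hν : ∀ {X Y : C} (f : X ⟶ Y), f ≫ ν Y = ν X ≫ f) {T : Triangle C} (hT : T ∈ distTriang C)
    (h₁ : IsNilpotent (ν T.obj₁)) (h₃ : IsNilpotent (ν T.obj₃)) : IsNilpotent (ν T.obj₂) := by
  obtain ⟨k, hk⟩ := h₁
  obtain ⟨l, hl⟩ := h₃
  refine ⟨l + k, ?_⟩
  have e1 : (ν T.obj₂ ^ l : End T.obj₂) ≫ T.mor₂ = 0 := by
    rw [← comp_pow_of_natural hν]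
    exact (congrArg _ hl).trans comp_zero
  obtain ⟨g, hg⟩ := Triangle.coyoneda_exact₂ _ hT _ e1
  rw [add_comm, pow_add]
  change (ν T.obj₂ ^ l : End T.obj₂) ≫ (ν T.obj₂ ^ k : End T.obj₂) = 0
  rw [hg, Category.assoc, comp_pow_of_natural hν]
  exact (congrArg (fun e => g ≫ e ≫ _) hk).trans (by simp)

/-- A natural family of endomorphisms that vanishes on the shifted heart is nilpotent on every
bounded object. -/
theorem Triangulated.TStructure.isNilpotent_of_natural [IsTriangulated C] (t : TStructure C)
    {ν : ∀ X : C, End X} (hν : ∀ {X Y : C} (f : X ⟶ Y), f ≫ ν Y = ν X ≫ f)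
    (h0 : ∀ (X : C) (n : ℤ), t.IsGE X n → t.IsLE X n → ν X = 0) :
    ∀ (m : ℕ) (X : C) (a b : ℤ), b < a + m → t.IsGE X a → t.IsLE X b →
      IsNilpotent (ν X) := by
  intro m
  induction m with
  | zero =>
    intro X a b hab ha hb
    have hX := t.isZero X b a (by omega)
    exact ⟨1, hX.eq_of_src _ _⟩
  | succ m ih =>
    intro X a b hab ha hb
    -- Truncation splits off one object of a shifted heart and leaves an object of smaller
    -- amplitude.
    refine isNilpotent_of_triangle hν (t.triangleLEGE_distinguished a (a + 1) rfl X)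
      ⟨1, by rw [pow_one]; exact h0 ((t.truncLE a).obj X) a inferInstance inferInstance⟩
      (ih ((t.truncGE (a + 1)).obj X) (a + 1) b (by push_cast at hab; omega)
      inferInstance inferInstance)

section SmulEnd

variable {R D : Type*} [CommRing R] [Category* D] [Preadditive D] [Linear R D]

/-- Scalars as endomorphisms of an object of a linear category. -/
def smulEnd (R : Type*) {D : Type*} [CommRing R] [Category* D] [Preadditive D] [Linear R D]
    (X : D) : R →+* End X where
  toFun r := r • 𝟙 X
  map_one' := one_smul R _
  map_mul' r s := by
    change (r * s) • 𝟙 X = (s • 𝟙 X) ≫ (r • 𝟙 X)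
    rw [Linear.comp_smul, Category.comp_id, smul_smul]
  map_zero' := zero_smul R _
  map_add' r s := add_smul r s _

theorem smulEnd_apply (r : R) (X : D) : smulEnd R X r = r • 𝟙 X := rfl

theorem comp_smulEnd (r : R) {X Y : D} (f : X ⟶ Y) : f ≫ smulEnd R Y r = smulEnd R X r ≫ f := by
  rw [smulEnd_apply, smulEnd_apply, Linear.comp_smul, Linear.smul_comp, Category.comp_id,
    Category.id_comp]

end SmulEnd

section Linear

variable {A R : Type u} [CommRing R] [Ring A] [Algebra R A]

/-- A ring is an algebra over the centre. -/
noncomputable instance centerAlgebra (R A : Type*) [CommRing R] [Ring A] [Algebra R A] :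
    Algebra (Subalgebra.center R A) A :=
  Algebra.ofModule (fun r x y => smul_mul_assoc (r : A) x y) (fun r x y => by
    change x * ((r : A) * y) = (r : A) * (x * y)
    rw [← mul_assoc, ← mul_assoc, Subalgebra.mem_center_iff.1 r.2 x])

theorem centerAlgebra_algebraMap (R : Type*) {A : Type*} [CommRing R] [Ring A] [Algebra R A]
    (c : Subalgebra.center R A) : algebraMap (Subalgebra.center R A) A c = c :=
  (Algebra.algebraMap_eq_smul_one c).trans (mul_one (c : A))

attribute [local instance] moduleCatLinear

theorem FGModuleCat_smul_hom_apply (r : R) {M N : FGModuleCat.{u} A} (f : M ⟶ N) (m : M) :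
    (r • f).hom.hom m = algebraMap R A r • f.hom.hom m := rfl

theorem exists_eq_smul_id (f : FGModuleCat.of A A ⟶ FGModuleCat.of A A)
    (hc : ∀ a : A, f.hom.hom (1 : A) * a = a * f.hom.hom (1 : A)) :
    ∃ c : Subalgebra.center R A, f = c • 𝟙 (FGModuleCat.of A A) := by
  have hmem : f.hom.hom (1 : A) ∈ Subalgebra.center R A :=
    Subalgebra.mem_center_iff.2 fun a => (hc a).symm
  refine ⟨⟨_, hmem⟩, ?_⟩
  ext
  rw [FGModuleCat_smul_hom_apply, centerAlgebra_algebraMap]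
  exact (mul_one _).symm

end Linear

section Derived

variable {A R : Type u} [CommRing R] [Ring A] [Algebra R A] [IsNoetherianRing A]
  [HasDerivedCategory.{u + 1} (FGModuleCat.{u} A)]

/-- The regular module, as an object of the derived category. -/
noncomputable def regularObj (A : Type u) [Ring A] [IsNoetherianRing A]
    [HasDerivedCategory.{u + 1} (FGModuleCat.{u} A)] (n : ℤ) : BoundedDerived A :=
  ⟨(DerivedCategory.singleFunctor (FGModuleCat.{u} A) n).obj (FGModuleCat.of A A),
    ⟨n, inferInstance⟩, ⟨n, inferInstance⟩⟩

/-- Such an X is a module M placed in degree n, and every m ∈ M is the image of 1 under a morphism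
from the regular module. By naturality the endomorphism kills every m. -/
theorem natural_eq_zero_of_regularObj {ν : ∀ X : BoundedDerived A, End X}
    (hν : ∀ {X Y : BoundedDerived A} (f : X ⟶ Y), f ≫ ν Y = ν X ≫ f)
    (h0 : ∀ n, ν (regularObj A n) = 0) (X : BoundedDerived A) (n : ℤ)
    (h1 : DerivedCategory.IsGE X.obj n) (h2 : DerivedCategory.IsLE X.obj n) : ν X = 0 := by
  obtain ⟨M, ⟨e⟩⟩ := DerivedCategory.exists_iso_singleFunctor_obj_of_isGE_of_isLE X.obj n
  set S := DerivedCategory.singleFunctor (FGModuleCat.{u} A) n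
  obtain ⟨f, hf⟩ := S.map_surjective (e.inv ≫ (ν X).hom ≫ e.hom)
  have hf0 : f = 0 := by
    ext m
    let g : FGModuleCat.of A A ⟶ M := ObjectProperty.homMk (ModuleCat.ofHom (LinearMap.toSpanSingleton A M m))
    let g' : regularObj A n ⟶ X := ObjectProperty.homMk (S.map g ≫ e.inv)
    have h3 := hν g'
    rw [h0] at h3
    have h4 : g ≫ f = 0 := by
      apply S.map_injective
      rw [S.map_comp, hf, S.map_zero]
      have h5 : S.map g ≫ e.inv ≫ (ν X).hom = 0 := by
        have h6 := congrArg (fun k => k.hom) h3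
        have h7 : (0 : End (regularObj A n)) ≫ g' = 0 := zero_comp
        rw [h7] at h6
        exact (Category.assoc _ _ _).symm.trans h6
      rw [← Category.assoc, ← Category.assoc, Category.assoc (S.map g), h5, zero_comp]
    have h5 : (g ≫ f).hom.hom (1 : A) = 0 := by rw [h4]; rfl
    have h6 : (g ≫ f).hom.hom (1 : A) = f.hom.hom ((1 : A) • m) := rfl
    rw [h6, one_smul] at h5
    exact h5
  have h8 : (ν X).hom = 0 := by
    have h9 : e.inv ≫ (ν X).hom ≫ e.hom = 0 := by rw [← hf, hf0, S.map_zero]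
    calc (ν X).hom = e.hom ≫ (e.inv ≫ (ν X).hom ≫ e.hom) ≫ e.inv := by simp
      _ = 0 := by rw [h9]; simp
  exact ObjectProperty.hom_ext _ h8

theorem isNilpotent_of_regularObj {ν : ∀ X : BoundedDerived A, End X}
    (hν : ∀ {X Y : BoundedDerived A} (f : X ⟶ Y), f ≫ ν Y = ν X ≫ f)
    (h0 : ∀ n, ν (regularObj A n) = 0) (X : BoundedDerived A) : IsNilpotent (ν X) := by
  obtain ⟨⟨a, ha⟩, ⟨b, hb⟩⟩ := X.property
  let t := (DerivedCategory.TStructure.t (C := FGModuleCat.{u} A)).onBounded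
  refine t.isNilpotent_of_natural hν (fun Y n h1 h2 => ?_) (b - a + 1).toNat X a b
    (by have := Int.self_le_toNat (b - a + 1); omega) ⟨ha.ge⟩ ⟨hb.le⟩
  exact natural_eq_zero_of_regularObj hν h0 Y n ⟨h1.ge⟩ ⟨h2.le⟩

attribute [local instance] moduleCatLinear

theorem smul_id_regularObj (r : R) (n : ℤ) : r • 𝟙 (regularObj A n) =
    ObjectProperty.homMk ((DerivedCategory.singleFunctor (FGModuleCat.{u} A) n).map
      (r • 𝟙 (FGModuleCat.of A A))) := by
  apply ObjectProperty.hom_ext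
  rw [Functor.map_smul, Functor.map_id]
  rfl

theorem smul_id_regularObj_injective {c c' : Subalgebra.center R A} {n : ℤ}
    (h : c • 𝟙 (regularObj A n) = c' • 𝟙 (regularObj A n)) : c = c' := by
  have h0 := (smul_id_regularObj c n).symm.trans (h.trans (smul_id_regularObj c' n))
  have h1 := (DerivedCategory.singleFunctor (FGModuleCat.{u} A) n).map_injective
    (congrArg (fun k => k.hom) h0)
  have h2 := congrArg (fun k : FGModuleCat.of A A ⟶ FGModuleCat.of A A => k.hom.hom (1 : A)) h1
  rw [FGModuleCat_smul_hom_apply, FGModuleCat_smul_hom_apply, centerAlgebra_algebraMap,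
    centerAlgebra_algebraMap] at h2
  have h3 : (c : A) * 1 = (c' : A) * 1 := h2
  exact Subtype.ext (by simpa using h3)

/-- Endomorphisms of the regular left module are right multiplications. One that commutes with all
the others is multiplication by a central element. -/
theorem exists_smul_id_regularObj {n : ℤ} (φ : regularObj A n ⟶ regularObj A n)
    (hφ : ∀ ψ : regularObj A n ⟶ regularObj A n, ψ ≫ φ = φ ≫ ψ) :
    ∃ c : Subalgebra.center R A, φ = c • 𝟙 (regularObj A n) := by
  obtain ⟨f, hf⟩ := (DerivedCategory.singleFunctor (FGModuleCat.{u} A) n).map_surjective φ.hom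
  have hc : ∀ a : A, f.hom.hom (1 : A) * a = a * f.hom.hom (1 : A) := fun a => by
    let g : FGModuleCat.of A A ⟶ FGModuleCat.of A A :=
      ObjectProperty.homMk (ModuleCat.ofHom (LinearMap.toSpanSingleton A A a))
    have h1 := congrArg (fun k => k.hom) (hφ (ObjectProperty.homMk ((DerivedCategory.singleFunctor (FGModuleCat.{u} A) n).map g)))
    have h2 : g ≫ f = f ≫ g := (DerivedCategory.singleFunctor (FGModuleCat.{u} A) n).map_injective (by
      rw [Functor.map_comp, Functor.map_comp, hf]; exact h1)
    have h3 := congrArg (fun k : FGModuleCat.of A A ⟶ FGModuleCat.of A A => k.hom.hom (1 : A)) h2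
    have h4 : f.hom.hom ((1 : A) • a) = f.hom.hom (1 : A) • a := h3
    rw [← smul_eq_mul, ← h4, one_smul, ← smul_eq_mul, ← map_smul, smul_eq_mul, mul_one]
  obtain ⟨c, hfc⟩ := exists_eq_smul_id (R := R) f hc
  refine ⟨c, ObjectProperty.hom_ext _ ?_⟩
  have h5 := congrArg (fun k => k.hom) (smul_id_regularObj (A := A) c n)
  exact hf.symm.trans ((congrArg _ hfc).trans h5.symm)

/-- The derived category is linear both over R and over the centre. The two actions agree on
complexes, hence after localisation. -/
theorem algebraMap_center_smul_id (r : R) (X : BoundedDerived A) :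
    algebraMap R (Subalgebra.center R A) r • 𝟙 X = r • 𝟙 X := by
  apply ObjectProperty.hom_ext
  change algebraMap R (Subalgebra.center R A) r • 𝟙 X.obj = r • 𝟙 X.obj
  have e := DerivedCategory.Q.objObjPreimageIso X.obj
  set K := DerivedCategory.Q.objPreimage X.obj
  have h1 : algebraMap R (Subalgebra.center R A) r • 𝟙 K = r • 𝟙 K := by
    ext i : 1
    rw [HomologicalComplex.smul_f_apply, HomologicalComplex.smul_f_apply]
    ext m
    rw [FGModuleCat_smul_hom_apply, FGModuleCat_smul_hom_apply, centerAlgebra_algebraMap]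
    rfl
  have h2 := congrArg DerivedCategory.Q.map h1
  rw [Functor.map_smul, Functor.map_smul, Functor.map_id] at h2
  have h3 := congrArg (fun k => e.inv ≫ k ≫ e.hom) h2
  simpa using h3

theorem smul_id_shift (c : R) (X : BoundedDerived A) (n : ℤ) :
    (c • 𝟙 X)⟦n⟧' = c • 𝟙 (X⟦n⟧) := by
  have h : (shiftFunctor (DerivedCategory (FGModuleCat.{u} A)) n).map (c • 𝟙 X.obj) =
    c • 𝟙 ((shiftFunctor (DerivedCategory (FGModuleCat.{u} A)) n).obj X.obj) := by
    rw [Functor.map_smul, Functor.map_id]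
  have hnat := ((DerivedCategory.Bounded.ι (C := FGModuleCat.{u} A)).commShiftIso n).hom.naturality
    (c • 𝟙 X)
  apply (DerivedCategory.Bounded.ι (C := FGModuleCat.{u} A)).map_injective
  rw [← cancel_mono (((DerivedCategory.Bounded.ι (C := FGModuleCat.{u} A)).commShiftIso n).hom.app X)]
  refine hnat.trans ?_
  refine (congrArg (fun k => _ ≫ k) h).trans ?_
  have h2 : (DerivedCategory.Bounded.ι (C := FGModuleCat.{u} A)).map (c • 𝟙 (X⟦n⟧)) = c • 𝟙 _ := rfl
  rw [h2, Linear.smul_comp, Linear.comp_smul]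
  exact congrArg (fun k => c • k) ((Category.comp_id _).trans (Category.id_comp _).symm)

theorem regularObj_iso_shift (n : ℤ) : Nonempty (regularObj A n ≅ (regularObj A 0)⟦-n⟧) := by
  have e := ((DerivedCategory.singleFunctors (FGModuleCat.{u} A)).shiftIso (-n) n 0 (by omega)).app
    (FGModuleCat.of A A)
  exact ⟨(ObjectProperty.fullyFaithfulι _).preimageIso (e.symm ≪≫
    ((DerivedCategory.Bounded.ι (C := FGModuleCat.{u} A)).commShiftIso (-n)).symm.app (regularObj A 0))⟩

/-- The action of the centre on an object of the bounded derived category. -/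
noncomputable def centerEnd (R : Type u) {A : Type u} [CommRing R] [Ring A] [Algebra R A]
    [IsNoetherianRing A] [HasDerivedCategory.{u + 1} (FGModuleCat.{u} A)] (X : BoundedDerived A) :
    Subalgebra.center R A →+* End X := smulEnd (Subalgebra.center R A) X

theorem comp_centerEnd (c : Subalgebra.center R A) {X Y : BoundedDerived A} (f : X ⟶ Y) :
    f ≫ centerEnd R Y c = centerEnd R X c ≫ f := comp_smulEnd c f

theorem centerEnd_algebraMap (r : R) (X : BoundedDerived A) :
    centerEnd R X (algebraMap R _ r) = r • 𝟙 X := algebraMap_center_smul_id r X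

theorem centerEnd_injective (n : ℤ) : Function.Injective (centerEnd R (regularObj A n)) :=
  fun _ _ h => smul_id_regularObj_injective h

theorem exists_centerEnd_eq {n : ℤ} (φ : End (regularObj A n))
    (hφ : ∀ ψ : End (regularObj A n), ψ ≫ φ = φ ≫ ψ) :
    ∃ c : Subalgebra.center R A, centerEnd R (regularObj A n) c = φ :=
  (exists_smul_id_regularObj φ hφ).imp fun _ h => h.symm

theorem centerEnd_shift (c : Subalgebra.center R A) (X : BoundedDerived A) (n : ℤ) :
    (shiftFunctor _ n).map (centerEnd R X c) = centerEnd R (X⟦n⟧) c := smul_id_shift c X n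

section Equivalence

variable {A A' R : Type u} [CommRing R] [Ring A] [Ring A'] [Algebra R A] [Algebra R A']
  [IsNoetherianRing A] [IsNoetherianRing A'] [HasDerivedCategory.{u + 1} (FGModuleCat.{u} A)]
  [HasDerivedCategory.{u + 1} (FGModuleCat.{u} A')]

/-- The algebra homomorphism between the centres induced by a fully faithful functor. -/
theorem exists_center_hom (F : BoundedDerived A ⥤ BoundedDerived A') [F.Full] [F.Faithful]
    [F.Additive] [F.Linear R] : ∃ β : Subalgebra.center R A' →ₐ[R] Subalgebra.center R A,
      ∀ z, F.map (centerEnd R (regularObj A 0) (β z)) =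
        centerEnd R (F.obj (regularObj A 0)) z := by
  obtain ⟨P, hP⟩ : ∃ P, P = regularObj A 0 := ⟨_, rfl⟩
  have hinj : ∀ {c c' : Subalgebra.center R A}, F.map (centerEnd R P c) =
      F.map (centerEnd R P c') → c = c' := fun h => by
    subst hP
    exact centerEnd_injective 0 (F.map_injective h)
  -- The action of z on F(A) commutes with all endomorphisms of F(A), so its preimage under F is
  -- central in End(A).
  have hex : ∀ z : Subalgebra.center R A', ∃ c : Subalgebra.center R A,
      F.map (centerEnd R P c) = centerEnd R (F.obj P) z := fun z => by
    obtain ⟨φ, hφ⟩ := F.map_surjective (centerEnd R (F.obj P) z)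
    subst hP
    obtain ⟨c, rfl⟩ := exists_centerEnd_eq (R := R) φ fun ψ => F.map_injective (by
      rw [F.map_comp, F.map_comp, hφ, comp_centerEnd])
    exact ⟨c, hφ⟩
  choose β hβ using hex
  have hone : β 1 = 1 := hinj (by
    rw [hβ, map_one, map_one]
    exact (F.map_id P).symm)
  have hmul : ∀ x y, β (x * y) = β x * β y := fun x y => hinj (by
    rw [hβ, map_mul, map_mul]
    refine Eq.trans ?_ (F.map_comp (centerEnd R P (β y)) (centerEnd R P (β x))).symm
    rw [hβ, hβ]
    rfl)
  have hadd : ∀ x y, β (x + y) = β x + β y := fun x y => hinj (by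
    rw [hβ, map_add, map_add]
    refine Eq.trans ?_ (F.map_add (f := centerEnd R P (β x)) (g := centerEnd R P (β y))).symm
    rw [hβ, hβ])
  have halg : ∀ r, β (algebraMap R _ r) = algebraMap R _ r := fun r => hinj (by
    rw [hβ, centerEnd_algebraMap, centerEnd_algebraMap, Functor.map_smul, F.map_id])
  have hzero : β 0 = 0 := by rw [← map_zero (algebraMap R _), halg, map_zero]
  exact ⟨⟨⟨⟨⟨β, hone⟩, hmul⟩, hzero, hadd⟩, halg⟩, hP ▸ hβ⟩

/-- An equivalence of triangulated categories induces a surjection between the centres if the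
target is reduced. -/
theorem exists_surjective_center_hom [IsReduced (Subalgebra.center R A)]
    (E : BoundedDerived A ≌ BoundedDerived A') [E.functor.CommShift ℤ] [E.functor.Additive]
    [E.functor.Linear R] : ∃ β : Subalgebra.center R A' →ₐ[R] Subalgebra.center R A,
      Function.Surjective β := by
  obtain ⟨β, hβ⟩ := exists_center_hom (R := R) E.functor
  refine ⟨β, fun c => ?_⟩
  -- The action of c transported to the other category, where it is a natural endomorphism of the
  -- identity functor.
  let ν₀ : ∀ Y : BoundedDerived A', End Y := fun Y => E.counitInv.app Y ≫
    E.functor.map (centerEnd R (E.inverse.obj Y) c) ≫ E.counit.app Y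
  have key : ∀ {X : BoundedDerived A} {Y : BoundedDerived A'} (e : E.functor.obj X ⟶ Y),
      e ≫ ν₀ Y = E.functor.map (centerEnd R X c) ≫ e := by
    intro X Y e
    obtain ⟨g, hg⟩ := E.functor.map_surjective (e ≫ E.counitInv.app Y)
    have h1 : e = E.functor.map g ≫ E.counit.app Y := by rw [hg]; simp
    change e ≫ E.counitInv.app Y ≫ _ = _
    rw [← Category.assoc, ← hg, ← Category.assoc, ← E.functor.map_comp, comp_centerEnd,
      E.functor.map_comp, Category.assoc, ← h1]
  obtain ⟨cu⟩ : Nonempty (∀ Y : BoundedDerived A', E.functor.obj (E.inverse.obj Y) ≅ Y) :=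
    ⟨fun Y => E.counitIso.app Y⟩
  have hν₀ : ∀ {X Y : BoundedDerived A'} (f : X ⟶ Y), f ≫ ν₀ Y = ν₀ X ≫ f := by
    intro X Y f
    rw [← cancel_epi (cu X).hom, ← Category.assoc, key, ← Category.assoc (cu X).hom, key,
      Category.assoc]
  -- On the regular module the transported action is that of a central element, and this z is the
  -- preimage of c.
  obtain ⟨z, hz⟩ := exists_centerEnd_eq (R := R) (ν₀ (regularObj A' 0)) fun ψ => hν₀ ψ
  refine ⟨z, ?_⟩
  let ν : ∀ Y : BoundedDerived A', End Y := fun Y => ν₀ Y - centerEnd R Y z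
  have hν : ∀ {X Y : BoundedDerived A'} (f : X ⟶ Y), f ≫ ν Y = ν X ≫ f := by
    intro X Y f
    exact (Preadditive.comp_sub _ _ _).trans
      ((congrArg₂ _ (hν₀ f) (comp_centerEnd z f)).trans (Preadditive.sub_comp _ _ _).symm)
  -- The equivalence commutes with shifts, so the transported action agrees with z on every shift of
  -- the regular module.
  have h0 : ∀ n, ν (regularObj A' n) = 0 := by
    intro n
    obtain ⟨i⟩ := regularObj_iso_shift (A := A') n
    have h1 : ν₀ ((regularObj A' 0)⟦-n⟧) = centerEnd R _ z := by
      let e : E.functor.obj ((E.inverse.obj (regularObj A' 0))⟦-n⟧) ≅ (regularObj A' 0)⟦-n⟧ :=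
        (E.functor.commShiftIso (-n)).app _ ≪≫
          (shiftFunctor _ (-n)).mapIso (cu (regularObj A' 0))
      have h3 : (shiftFunctor _ (-n)).map (E.functor.map (centerEnd R (E.inverse.obj
          (regularObj A' 0)) c)) ≫ (shiftFunctor _ (-n)).map (cu (regularObj A' 0)).hom =
          (shiftFunctor _ (-n)).map (cu (regularObj A' 0)).hom ≫ centerEnd R _ z := by
        rw [← centerEnd_shift, hz, ← Functor.map_comp, ← Functor.map_comp, ← key]
      have h4 := (E.functor.commShiftIso (-n)).hom.naturality
        (centerEnd R (E.inverse.obj (regularObj A' 0)) c)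
      rw [← cancel_epi e.hom, key, ← centerEnd_shift]
      refine (Category.assoc _ _ _).symm.trans ((congrArg (fun k => k ≫ _) h4).trans ?_)
      exact (Category.assoc _ _ _).trans ((congrArg (fun k => _ ≫ k) h3).trans
        (Category.assoc _ _ _).symm)
    have h2 : ν ((regularObj A' 0)⟦-n⟧) = 0 := sub_eq_zero.2 h1
    rw [← cancel_mono i.hom, ← hν, h2]
    simp
  -- On E(A) the difference ν is the image of c - β(z). This element is nilpotent, hence zero in a
  -- reduced centre.
  obtain ⟨k, hk⟩ := isNilpotent_of_regularObj hν h0 (E.functor.obj (regularObj A 0))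
  have h1 : ν (E.functor.obj (regularObj A 0)) =
      E.functor.map (centerEnd R (regularObj A 0) (c - β z)) := by
    rw [map_sub]
    refine Eq.trans ?_ (E.functor.map_sub).symm
    rw [hβ]
    refine congrArg (fun k => k - _) ?_
    have := key (𝟙 (E.functor.obj (regularObj A 0)))
    rwa [Category.id_comp, Category.comp_id] at this
  have h2 : IsNilpotent (c - β z) := by
    refine ⟨k, ?_⟩
    have h3 : ∀ m : ℕ, (ν (E.functor.obj (regularObj A 0)) ^ m : End _) =
        E.functor.map (centerEnd R (regularObj A 0) ((c - β z) ^ m)) := by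
      intro m
      induction m with
      | zero => rw [pow_zero, pow_zero, map_one]; exact (E.functor.map_id _).symm
      | succ m ih =>
        rw [pow_succ, ih, pow_succ, map_mul, h1]
        exact (E.functor.map_comp _ _).symm
    apply centerEnd_injective 0
    apply E.functor.map_injective
    rw [← h3, hk, map_zero]
    exact (E.functor.map_zero _ _).symm
  exact (sub_eq_zero.1 h2.eq_zero).symm

end Equivalence

end Derived

end CategoryTheory

open CategoryTheory in
theorem DerivedEquivalentOver.exists_surjective_center_hom {R A A' : Type u} [CommRing R] [Ring A]
    [Ring A'] [Algebra R A] [Algebra R A'] [IsNoetherianRing A] [IsNoetherianRing A']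
    [IsReduced (Subalgebra.center R A)] (h : DerivedEquivalentOver R A A') :
    ∃ β : Subalgebra.center R A' →ₐ[R] Subalgebra.center R A, Function.Surjective β := by
  letI := moduleCatLinear R A
  letI := moduleCatLinear R A'
  letI := HasDerivedCategory.standard (FGModuleCat.{u} A)
  letI := HasDerivedCategory.standard (FGModuleCat.{u} A')
  obtain ⟨E, hE, hT, hL⟩ := h
  exact CategoryTheory.exists_surjective_center_hom E

/-! ### The icosahedral representation of SL₂(4) -/

/-- The ring generated by the golden ratio. -/
abbrev GoldenInt : Type := QuadraticAlgebra ℤ 1 1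

namespace Ico

/-- The discrete logarithm on the units of `F4`. -/
def lg : F4 → Fin 3
  | q2 => 1
  | q3 => 2
  | _ => 0

/-- The characters of `F4` through which it acts diagonally. -/
def sgn : F4 → Fin 3 → ℤ
  | q0, _ => 1
  | q1, 0 => 1
  | q2, 1 => 1
  | q3, 2 => 1
  | _, _ => -1

/-- With τ = ⟨0, 1⟩ and τ² = τ + 1 these are -1, -τ, τ - 1; the Weyl element acts by half of `val (r
+ s)`. -/
def val : Fin 3 → GoldenInt
  | 0 => ⟨-1, 0⟩
  | 1 => ⟨0, -1⟩
  | 2 => ⟨-1, 1⟩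

/-- Twice the matrix coefficients of the icosahedral representation of `SL₂(4)`. -/
def coeff (e f h i : F4) (r s : Fin 3) : GoldenInt :=
  match h with
  -- Upper triangular matrices act monomially: the unipotent ones by the three non-trivial
  -- characters of `F4`, the torus by cyclic shifts.
  | q0 => if s = r + lg e then ⟨2 * sgn (mul f e) r, 0⟩ else ⟨0, 0⟩
  | h => match val (r + s - lg h), sgn (mul e (mul h h)) r * sgn (mul i (mul h h)) s with
    -- For h ≠ 0 this is the Bruhat decomposition u(e/h) · w · diag(h, h⁻¹) · u(i/h), with h⁻¹ = h².
    | ⟨x, y⟩, z => ⟨z * x, z * y⟩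

def mulSum (e f h i e' f' h' i' : F4) (r s : Fin 3) : GoldenInt :=
  match coeff e f h i r 0, coeff e f h i r 1, coeff e f h i r 2,
    coeff e' f' h' i' 0 s, coeff e' f' h' i' 1 s, coeff e' f' h' i' 2 s with
  | ⟨x, y⟩, ⟨z, w⟩, ⟨u, v⟩, ⟨x', y'⟩, ⟨z', w'⟩, ⟨u', v'⟩ =>
    ⟨x * x' + y * y' + (z * z' + w * w') + (u * u' + v * v'),
     x * y' + y * x' + y * y' + (z * w' + w * z' + w * w') + (u * v' + v * u' + v * v')⟩

theorem two_mul_eq (x : GoldenInt) : 2 * x = ⟨2 * x.re, 2 * x.im⟩ := by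
  rw [two_mul]; ext <;> simp [two_mul]

theorem mulSum_eq (e f h i e' f' h' i' : F4) (r s : Fin 3) :
    mulSum e f h i e' f' h' i' r s = ∑ k, coeff e f h i r k * coeff e' f' h' i' k s := by
  rw [Fin.sum_univ_three]
  ext <;> simp [mulSum] 

/-- Multiplication of a matrix in `SL₂(4)` by a given matrix on the right is compatible with the
icosahedral representation. -/
def Compatible (e' f' h' i' : F4) : Prop :=
  ∀ e f h i, minor e f h i = q1 → ∀ r s, mulSum e f h i e' f' h' i' r s =
    match coeff (add (mul e e') (mul f h')) (add (mul e f') (mul f i'))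
      (add (mul h e') (mul i h')) (add (mul h f') (mul i i')) r s with
    | ⟨x, y⟩ => ⟨2 * x, 2 * y⟩

instance (e' f' h' i' : F4) : Decidable (Compatible e' f' h' i') := by
  unfold Compatible; infer_instance

theorem compatible_unipotent : ∀ t, Compatible q1 t q0 q1 := by decide +kernel
theorem compatible_diagonal : ∀ e, e ≠ 0 → Compatible e q0 q0 (mul e e) := by decide +kernel
theorem compatible_antidiagonal : Compatible q0 q1 q1 q0 := by decide +kernel

theorem Compatible.sum_eq {e' f' h' i' : F4} (H : Compatible e' f' h' i') {e f h i : F4}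
    (hx : e * i + f * h = 1) (r s : Fin 3) :
    ∑ k, coeff e f h i r k * coeff e' f' h' i' k s =
      2 * coeff (e * e' + f * h') (e * f' + f * i') (h * e' + i * h') (h * f' + i * i') r s := by
  have := H e f h i hx r s
  rw [mulSum_eq] at this
  rw [this, two_mul_eq]
  rfl

theorem compatible_of_sum_eq {e' f' h' i' : F4} (H : ∀ e f h i, e * i + f * h = 1 → ∀ r s,
    ∑ k, coeff e f h i r k * coeff e' f' h' i' k s =
      2 * coeff (e * e' + f * h') (e * f' + f * i') (h * e' + i * h') (h * f' + i * i') r s) :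
    Compatible e' f' h' i' := by
  intro e f h i hx r s
  rw [mulSum_eq, H e f h i hx, two_mul_eq]
  rfl

/-- Associativity of the matrix product, after cancelling the factor 2 in the golden integers. It
reduces multiplicativity to generators. -/
theorem Compatible.mul {e f h i e' f' h' i' : F4} (H : Compatible e f h i)
    (H' : Compatible e' f' h' i') (hd : e * i + f * h = 1) :
    Compatible (e * e' + f * h') (e * f' + f * i') (h * e' + i * h') (h * f' + i * i') := by
  refine compatible_of_sum_eq fun a b c d hx r s => ?_
  have h1 := fun k => H'.sum_eq hd k s
  have h2 := fun k => H.sum_eq hx r k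
  have h3 := H'.sum_eq (e := a * e + b * h) (f := a * f + b * i) (h := c * e + d * h)
    (i := c * f + d * i) (by
      have : (a * e + b * h) * (c * f + d * i) + (a * f + b * i) * (c * e + d * h) =
        (a * d + b * c) * (e * i + f * h) + 2 * (a * e * c * f + b * h * d * i) := by ring
      rw [this, hd, hx, F4.two_eq_zero]; ring) r s
  have h0 : (2 : GoldenInt) ≠ 0 := by decide
  have h4 : (2 : GoldenInt) * ∑ k, coeff a b c d r k *
      coeff (e * e' + f * h') (e * f' + f * i') (h * e' + i * h') (h * f' + i * i') k s =
      2 * (2 * coeff ((a * e + b * h) * e' + (a * f + b * i) * h')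
        ((a * e + b * h) * f' + (a * f + b * i) * i') ((c * e + d * h) * e' + (c * f + d * i) * h')
        ((c * e + d * h) * f' + (c * f + d * i) * i') r s) := by
    rw [← h3, Finset.mul_sum, Finset.mul_sum]
    simp only [← mul_assoc, ← h2]
    simp only [mul_comm (2 : GoldenInt), mul_assoc]
    simp only [mul_comm _ (2 : GoldenInt), ← h1, Finset.mul_sum, Finset.sum_mul]
    rw [Finset.sum_comm]
    simp only [mul_assoc]
  have h5 : ∀ x y : GoldenInt, 2 * x = 2 * y → x = y := fun x y h => by
    rw [two_mul_eq, two_mul_eq, QuadraticAlgebra.mk.injEq] at h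
    ext
    · exact mul_left_cancel₀ two_ne_zero h.1
    · exact mul_left_cancel₀ two_ne_zero h.2
  rw [h5 _ _ h4]
  congr 2 <;> ring

/-- Bruhat decomposition into unipotent, diagonal and antidiagonal factors, each checked separately.
-/
theorem compatible : ∀ e f h i : F4, e * i + f * h = 1 → Compatible e f h i := by
  intro e f h i hd
  by_cases hh : h = 0
  · have he : e ≠ 0 := by rintro rfl; simp [hh] at hd
    have := (compatible_unipotent (f * e)).mul (compatible_diagonal e he) (by simp [q1_eq, q0_eq])
    convert this using 1 <;> clear this <;> revert e f h i <;> decide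
  · have h1 := (compatible_unipotent (e * (h * h))).mul compatible_antidiagonal
      (by simp [q1_eq, q0_eq])
    have h2 := h1.mul (compatible_diagonal h hh) (by simp [q1_eq, q0_eq])
    have h3 := h2.mul (compatible_unipotent (i * (h * h))) (by
      clear h1 h2; revert e f h i; decide)
    clear h1 h2
    convert h3 using 1 <;> clear h3 <;> revert e f h i <;> decide

end Ico

/-! ### Inflation to the stabiliser of a point -/

namespace Ico

/-- Twice the matrix coefficients of the inflation of the icosahedral representation to the
stabiliser of a point, extended by zero. -/
def stabCoeff (m : M3) (r s : Fin 3) : GoldenInt :=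
  match m with
  | ⟨_, _, _, q0, e, f, q0, h, i⟩ => match minor e f h i with
    -- A ↦ det(A)·A is a retraction of GL₂(4) onto SL₂(4), because det(A)³ = 1.
    | d => coeff (mul d e) (mul d f) (mul d h) (mul d i) r s
  | _ => ⟨0, 0⟩

theorem stabCoeff_of_eq_zero (a b c e f h i : F4) (r s : Fin 3) :
    stabCoeff ⟨a, b, c, 0, e, f, 0, h, i⟩ r s = coeff ((e * i + f * h) * e) ((e * i + f * h) * f)
      ((e * i + f * h) * h) ((e * i + f * h) * i) r s := rfl

theorem stabCoeff_of_ne_zero {m : M3} (hm : ¬ (m.d = 0 ∧ m.g = 0)) (r s : Fin 3) :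
    stabCoeff m r s = 0 := by
  rcases m with ⟨a, b, c, d, e, f, g, h, i⟩
  cases d <;> cases g <;> first | rfl | exact absurd ⟨rfl, rfl⟩ hm

theorem sum_stabCoeff (s t : SL34) (ht : t ∈ SL34.parabolic) (r c : Fin 3) :
    ∑ k, stabCoeff s.raw r k * stabCoeff t.raw k c = 2 * stabCoeff (s * t).raw r c := by
  by_cases hs : s ∈ SL34.parabolic
  · have hst := mul_mem hs ht
    rw [SL34.mem_parabolic] at hs ht hst
    have ds := s.raw_det
    have dt := t.raw_det
    have e1 := s.raw_mul t
    generalize (s * t).raw = x at *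
    generalize s.raw = y at *
    generalize t.raw = z at *
    rcases y with ⟨a, b, c, d, e, f, g, h, i⟩
    rcases z with ⟨a', b', c', d', e', f', g', h', i'⟩
    obtain ⟨h1, h2⟩ := hs
    obtain ⟨h3, h4⟩ := ht
    dsimp only at h1 h2 h3 h4
    subst h1 h2 h3 h4
    rw [M3.mul_eq] at e1
    simp only [M3.det, det_eq, dot_eq, mul_zero, zero_mul, add_zero, zero_add] at ds dt e1
    subst e1
    simp only [stabCoeff_of_eq_zero]
    have hs3 : (e * i + f * h) * (e * i + f * h) * (e * i + f * h) = 1 :=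
      pow_three (right_ne_zero_of_mul_eq_one ds)
    have ht3 : (e' * i' + f' * h') * (e' * i' + f' * h') * (e' * i' + f' * h') = 1 :=
      pow_three (right_ne_zero_of_mul_eq_one dt)
    have hd : (e * e' + f * h') * (h * f' + i * i') + (e * f' + f * i') * (h * e' + i * h') =
        (e * i + f * h) * (e' * i' + f' * h') := by
      have : (e * e' + f * h') * (h * f' + i * i') + (e * f' + f * i') * (h * e' + i * h') =
        (e * i + f * h) * (e' * i' + f' * h') + 2 * (e * e' * h * f' + f * h' * i * i') := by ring
      rw [this, F4.two_eq_zero]; ring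
    rw [hd]
    generalize hD : e * i + f * h = D at *
    generalize hD' : e' * i' + f' * h' = D' at *
    rw [(compatible (D' * e') (D' * f') (D' * h') (D' * i')
      (by rw [← ht3]; nth_rw 5 [← hD']; ring)).sum_eq (by rw [← hs3]; nth_rw 5 [← hD]; ring)]
    congr 2 <;> ring
  · have hst : s * t ∉ SL34.parabolic := fun h => hs ((SL34.parabolic.mul_mem_cancel_right ht).1 h)
    rw [stabCoeff_of_ne_zero hst, mul_zero]
    exact Finset.sum_eq_zero fun k _ => by rw [stabCoeff_of_ne_zero hs, zero_mul]

def fixMat (b c : F4) : M3 := ⟨q1, b, c, q0, q1, q0, q0, q0, q1⟩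

/-- The sum of the matrix coefficients over the elements acting trivially on the quotient. -/
def fixSum (p j : SL34.Pt) (r s : Fin 3) : GoldenInt :=
  ∑ x : F4 × F4, stabCoeff (M3.mul (M3.mul (M3.adj (SL34.ptMat p)) (fixMat x.1 x.2)) (SL34.ptMat j)) r s

/-- Summing over the 16 elements of the unipotent radical gives 16 times the projection onto the
block of the base point; 32 because `stabCoeff` is doubled. The other blocks vanish since the
four-group has no invariants in the icosahedral representation. -/
theorem fixSum_eq : ∀ p j r s, fixSum p j r s =
    if p = .inl (q0, q0) ∧ j = .inl (q0, q0) ∧ r = s then ⟨32, 0⟩ else ⟨0, 0⟩ := by decide +kernel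

/-- Twice the character of the induced representation. -/
def charSum (m : M3) : GoldenInt :=
  ∑ p : SL34.Pt, ∑ r, stabCoeff (M3.mul (M3.mul (M3.adj (SL34.ptMat p)) m) (SL34.ptMat p)) r r

theorem charSum_one : charSum (SL34.rep 0).raw = ⟨126, 0⟩ := by decide +kernel
theorem charSum_omega : charSum (SL34.omega).raw = ⟨126, 0⟩ := by decide +kernel
theorem charSum_rep : ∀ k : Fin 4, charSum (SL34.rep (k + 1)).raw = ⟨-2, 0⟩ := by decide +kernel
theorem charSum_rep_five : charSum (SL34.rep 5).raw = ⟨0, 2⟩ := by decide +kernel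
theorem charSum_rep_six : charSum (SL34.rep 6).raw = ⟨2, -2⟩ := by decide +kernel
theorem charSum_rep_seven : charSum (SL34.rep 7).raw = ⟨0, 0⟩ := by decide +kernel
theorem charSum_rep_eight : charSum (SL34.rep 8).raw = ⟨0, 0⟩ := by decide +kernel
theorem charSum_rep_nine : charSum (SL34.rep 9).raw = ⟨0, 0⟩ := by decide +kernel

end Ico

/-! ### Induced representations and the irreducibility of degree 63 -/

/-- A function behaving like a matrix representation of a subgroup extended by zero. -/
structure IsBlockRep {G n K : Type*} [Group G] [Fintype n] [DecidableEq n] [Field K]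
    (H : Subgroup G) (B : G → Matrix n n K) : Prop where
  one : B 1 = 1
  mul : ∀ s, ∀ t ∈ H, B (s * t) = B s * B t
  zero : ∀ s ∉ H, B s = 0

namespace IsBlockRep

variable {G ι n K : Type*} [Group G] [Fintype ι] [DecidableEq ι] [Fintype n] [DecidableEq n]
  [Field K] {H : Subgroup G} {x : ι → G} {B : G → Matrix n n K}

/-- Only the representative of the coset of b contributes. -/
theorem sum_mul (hB : IsBlockRep H B) (hx : IsTransversal H x) (a b : G) :
    ∑ k, B (a * x k) * B ((x k)⁻¹ * b) = B (a * b) := by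
  obtain ⟨k, hk, hu⟩ := hx b
  rw [Finset.sum_eq_single k (fun l _ hl => by
    rw [hB.zero _ fun h => hl (hu l h), mul_zero]) (by simp), ← hB.mul _ _ hk]
  congr 1; group

theorem apply_transversal (hB : IsBlockRep H B) (hx : IsTransversal H x) (i j : ι) :
    B ((x i)⁻¹ * x j) = if i = j then 1 else 0 := by
  split_ifs with h
  · rw [h, inv_mul_cancel, hB.one]
  · refine hB.zero _ fun hm => h ((hx (x j)).unique hm ?_)
    rw [inv_mul_cancel]; exact one_mem H

/-- The induced matrix representation. -/
def induced (hB : IsBlockRep H B) (hx : IsTransversal H x) : G →* Matrix ι ι (Matrix n n K) where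
  toFun g := Matrix.of fun i j => B ((x i)⁻¹ * g * x j)
  map_one' := by
    refine Matrix.ext fun i j => ?_
    rw [Matrix.of_apply, mul_one, hB.apply_transversal hx, Matrix.one_apply]
  map_mul' g h := by
    refine Matrix.ext fun i j => ?_
    rw [Matrix.mul_apply, Matrix.of_apply]
    simp only [Matrix.of_apply]
    have := hB.sum_mul hx ((x i)⁻¹ * g) (h * x j)
    simp only [mul_assoc] at this ⊢
    exact this.symm

theorem induced_apply (hB : IsBlockRep H B) (hx : IsTransversal H x) (g : G) (i j : ι) :
    hB.induced hx g i j = B ((x i)⁻¹ * g * x j) := rfl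

/-- A matrix commuting with an induced representation is scalar, if the projection onto one of the
blocks lies in the group algebra and the block is absolutely irreducible. -/
theorem eq_scalar_of_commute (hB : IsBlockRep H B) (hx : IsTransversal H x) {κ : Type*} [Fintype κ]
    (q : κ → G) (i₀ : ι) (h₀ : x i₀ = 1) {m : K} (hm : m ≠ 0)
    (hq : ∀ i j, ∑ k, B ((x i)⁻¹ * q k * x j) = if i = i₀ ∧ j = i₀ then Matrix.scalar n m else 0)
    (hirr : ∀ A : Matrix n n K, (∀ t ∈ H, Commute A (B t)) → ∃ c, A = Matrix.scalar n c)
    (φ : Matrix ι ι (Matrix n n K)) (hφ : ∀ g, Commute φ (hB.induced hx g)) :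
    ∃ c, φ = Matrix.scalar ι (Matrix.scalar n c) := by
  -- Commuting with the projection onto the block i₀ kills the rest of the column i₀ of φ.
  have h1 : ∀ i, i ≠ i₀ → φ i i₀ = 0 := by
    intro i hi
    have h2 : φ * ∑ k, hB.induced hx (q k) = (∑ k, hB.induced hx (q k)) * φ := by
      rw [Finset.mul_sum, Finset.sum_mul]
      exact Finset.sum_congr rfl fun k _ => hφ (q k)
    have h3 := congrFun (congrFun h2 i) i₀
    simp only [Matrix.mul_apply, Matrix.sum_apply, induced_apply, hq] at h3
    simp only [hi, false_and, if_false, zero_mul, Finset.sum_const_zero, and_true] at h3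
    rw [Finset.sum_eq_single i₀ (fun b _ hb => by rw [if_neg hb, mul_zero]) (by simp),
      if_pos rfl] at h3
    have h4 : φ i i₀ * Matrix.scalar n m = m • φ i i₀ := by
      rw [Matrix.scalar_apply, ← Matrix.smul_one_eq_diagonal, mul_smul_comm, mul_one]
    rw [h4] at h3
    exact (smul_eq_zero_iff_right hm).1 h3
  -- The remaining block of that column commutes with H and is scalar by hypothesis; translation by
  -- x j carries this to the other columns.
  have h5 : ∀ t ∈ H, Commute (φ i₀ i₀) (B t) := by
    intro t ht
    have h3 := congrFun (congrFun (hφ t) i₀) i₀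
    simp only [Matrix.mul_apply, induced_apply] at h3
    rw [Finset.sum_eq_single i₀ (fun b _ hb => by
        rw [h₀, mul_one, hB.zero _ fun h => hb ((hx t).unique h (by simpa [h₀] using ht)), mul_zero])
        (by simp),
      Finset.sum_eq_single i₀ (fun b _ hb => by rw [h1 b hb, mul_zero]) (by simp)] at h3
    simpa [h₀, Commute, SemiconjBy] using h3
  obtain ⟨c, hc⟩ := hirr _ h5
  refine ⟨c, ?_⟩
  refine Matrix.ext fun i j => ?_
  have h3 := congrFun (congrFun (hφ (x j)) i) i₀
  simp only [Matrix.mul_apply, induced_apply] at h3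
  have h6 : ∑ k, φ i k * B ((x k)⁻¹ * x j * x i₀) = φ i j := by
    simp only [h₀, mul_one, hB.apply_transversal hx, mul_ite, mul_zero, Finset.sum_ite_eq',
      Finset.mem_univ, if_true]
  have h7 : ∑ k, B ((x i)⁻¹ * x j * x k) * φ k i₀ = (if i = j then 1 else 0) * φ i₀ i₀ := by
    rw [Finset.sum_eq_single i₀ (fun b _ hb => by rw [h1 b hb, mul_zero]) (by simp), h₀, mul_one,
      hB.apply_transversal hx]
  rw [← h6, h3, h7, hc, Matrix.scalar_apply (n := ι)]
  split_ifs with h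
  · rw [h, one_mul]; exact (Matrix.diagonal_apply_eq (fun _ => Matrix.diagonal fun _ => c) j).symm
  · rw [zero_mul]; exact (Matrix.diagonal_apply_ne (fun _ => Matrix.diagonal fun _ => c) h).symm

end IsBlockRep

namespace Ico

variable {K : Type*} [Field K] [CharZero K] (f : GoldenInt →+* K)

/-- The inflation of the icosahedral representation to the stabiliser of a point, extended by
zero. -/
def block (s : SL34) : Matrix (Fin 3) (Fin 3) K := Matrix.of fun r c => f (stabCoeff s.raw r c) / 2

theorem isBlockRep : IsBlockRep SL34.parabolic (block f) where
  one := by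
    have h : ∀ r c, stabCoeff (1 : SL34).raw r c = if r = c then ⟨2, 0⟩ else ⟨0, 0⟩ := by
      rw [SL34.raw_one]; decide
    have h2 : (⟨2, 0⟩ : GoldenInt) = 2 := rfl
    have h3 : (⟨0, 0⟩ : GoldenInt) = 0 := rfl
    ext r c
    rw [block, Matrix.of_apply, h, Matrix.one_apply, h2, h3]
    split_ifs
    · rw [map_ofNat, div_self two_ne_zero]
    · rw [map_zero, zero_div]
  mul s t ht := by
    ext r c
    have h := congrArg f (sum_stabCoeff s t ht r c)
    rw [map_sum, map_mul, map_ofNat] at h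
    simp only [map_mul] at h
    simp only [block, Matrix.mul_apply, Matrix.of_apply, div_mul_div_comm, ← Finset.sum_div, h]
    field_simp
  zero s hs := by
    ext r c
    rw [block, Matrix.of_apply, stabCoeff_of_ne_zero (by rwa [SL34.mem_parabolic] at hs), map_zero,
      zero_div, Matrix.zero_apply]

/-- The elements fixing the first basis vector and acting trivially modulo it. -/
def fixElt (x : F4 × F4) : SL34 := SL34.mk (fixMat x.1 x.2) (by
  rcases x with ⟨x, y⟩; cases x <;> cases y <;> rfl)

theorem sum_fixElt (i j : SL34.Pt) : ∑ k, block f ((SL34.ptRep i)⁻¹ * fixElt k * SL34.ptRep j) =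
    if i = .inl (q0, q0) ∧ j = .inl (q0, q0) then Matrix.scalar (Fin 3) 16 else 0 := by
  ext r c
  have h := congrArg f (fixSum_eq i j r c)
  rw [fixSum, map_sum] at h
  rw [Matrix.sum_apply]
  simp only [block, Matrix.of_apply, SL34.raw_mul, SL34.raw_inv, SL34.ptRep, fixElt, SL34.raw_mk,
    ← Finset.sum_div, h]
  have h2 : (⟨32, 0⟩ : GoldenInt) = 32 := rfl
  have h3 : (⟨0, 0⟩ : GoldenInt) = 0 := rfl
  rw [h2, h3]
  by_cases h4 : i = .inl (q0, q0) ∧ j = .inl (q0, q0)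
  · by_cases h5 : r = c
    · rw [if_pos h4, if_pos ⟨h4.1, h4.2, h5⟩, map_ofNat, Matrix.scalar_apply, h5,
        Matrix.diagonal_apply_eq]
      norm_num
    · rw [if_pos h4, if_neg fun h => h5 h.2.2, map_zero, Matrix.scalar_apply,
        Matrix.diagonal_apply_ne _ h5, zero_div]
  · rw [if_neg h4, if_neg fun h => h4 ⟨h.1, h.2.1⟩, map_zero, zero_div, Matrix.zero_apply]

/-- Two unipotents act by diagonal signs that separate the three coordinates, so A is diagonal. A
torus element permutes the coordinates cyclically, so its entries are equal. -/
theorem eq_scalar_of_commute_block (A : Matrix (Fin 3) (Fin 3) K)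
    (hA : ∀ t ∈ SL34.parabolic, Commute A (block f t)) : ∃ c, A = Matrix.scalar (Fin 3) c := by
  have key : ∀ (m : M3) (hm : m.det = 1), m.d = 0 ∧ m.g = 0 → ∀ r c,
      ∑ k, A r k * f (stabCoeff m k c) = ∑ k, f (stabCoeff m r k) * A k c := by
    intro m hm h0 r c
    have := congrFun (congrFun (hA (SL34.mk m hm) h0) r) c
    simp only [Matrix.mul_apply, block, Matrix.of_apply, SL34.raw_mk, mul_div_assoc',
      div_mul_eq_mul_div, ← Finset.sum_div] at this
    exact (div_left_inj' two_ne_zero).1 this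
  have k1 := key ⟨q1, q0, q0, q0, q1, q1, q0, q0, q1⟩ rfl ⟨rfl, rfl⟩
  have k2 := key ⟨q1, q0, q0, q0, q1, q2, q0, q0, q1⟩ rfl ⟨rfl, rfl⟩
  have k3 := key ⟨q1, q0, q0, q0, q2, q0, q0, q0, q3⟩ rfl ⟨rfl, rfl⟩
  have h1 : ∀ r c, stabCoeff ⟨q1, q0, q0, q0, q1, q1, q0, q0, q1⟩ r c =
    if r = c then (if r = 0 then 2 else -2) else 0 := by decide
  have h2 : ∀ r c, stabCoeff ⟨q1, q0, q0, q0, q1, q2, q0, q0, q1⟩ r c =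
    if r = c then (if r = 1 then 2 else -2) else 0 := by decide
  have h3 : ∀ r c, stabCoeff ⟨q1, q0, q0, q0, q2, q0, q0, q0, q3⟩ r c =
    if c = r + 1 then 2 else 0 := by decide
  simp only [h1] at k1
  simp only [h2] at k2
  simp only [h3] at k3
  have e01 := k1 0 1
  have e02 := k1 0 2
  have e10 := k1 1 0
  have e20 := k1 2 0
  have e12 := k2 1 2
  have e21 := k2 2 1
  have f01 := k3 0 1
  have f12 := k3 1 2
  simp [Fin.sum_univ_three] at e01 e02 e10 e20 e12 e21 f01 f12
  have h4 : f 2 = 2 := map_ofNat f 2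
  rw [h4] at e01 e02 e10 e20 e12 e21 f01 f12
  have z1 : ∀ a : K, -(a * 2) = 2 * a → a = 0 := fun a h => by
    have : (4 : K) * a = 0 := by linear_combination -h
    simpa using this
  have z2 : ∀ a : K, a * 2 = -(2 * a) → a = 0 := fun a h => by
    have : (4 : K) * a = 0 := by linear_combination h
    simpa using this
  have z3 : ∀ a b : K, a * 2 = 2 * b → b = a := fun a b h => by
    have : (2 : K) * b = 2 * a := by linear_combination -h
    exact mul_left_cancel₀ two_ne_zero this
  have g1 := z3 _ _ f01
  have g2 := z3 _ _ f12
  refine ⟨A 0 0, ?_⟩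
  ext r c
  rw [Matrix.scalar_apply, Matrix.diagonal_apply]
  fin_cases r <;> fin_cases c <;> simp [z1 _ e01, z1 _ e02, z2 _ e10, z2 _ e20, z1 _ e12, z2 _ e21, g1, g2]

/-- The representations of degree 63 as block matrices. -/
def blockMat : SL34 →* Matrix SL34.Pt SL34.Pt (Matrix (Fin 3) (Fin 3) K) :=
  (isBlockRep f).induced SL34.ptRep_transversal

theorem eq_scalar_of_commute_blockMat (φ : Matrix SL34.Pt SL34.Pt (Matrix (Fin 3) (Fin 3) K))
    (hφ : ∀ g, Commute φ (blockMat f g)) : ∃ c, φ = Matrix.scalar _ (Matrix.scalar (Fin 3) c) :=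
  (isBlockRep f).eq_scalar_of_commute SL34.ptRep_transversal fixElt (.inl (q0, q0))
    (SL34.raw_injective rfl) (m := 16) (by norm_num) (sum_fixElt f) (eq_scalar_of_commute_block f) φ
    hφ

/-- The representations of degree 63 as matrices. -/
def mat : SL34 →* Matrix (SL34.Pt × Fin 3) (SL34.Pt × Fin 3) K :=
  (Matrix.compRingEquiv SL34.Pt (Fin 3) K : _ →* _).comp (blockMat f)

theorem eq_scalar_of_commute_mat (φ : Matrix (SL34.Pt × Fin 3) (SL34.Pt × Fin 3) K)
    (hφ : ∀ g, Commute φ (mat f g)) : ∃ c, φ = Matrix.scalar _ c := by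
  obtain ⟨ψ, rfl⟩ := (Matrix.compRingEquiv SL34.Pt (Fin 3) K).surjective φ
  obtain ⟨c, hc⟩ := eq_scalar_of_commute_blockMat f ψ fun g => by
    have h : _ = _ := hφ g
    refine (Matrix.compRingEquiv SL34.Pt (Fin 3) K).injective ?_
    rw [map_mul, map_mul]
    exact h
  refine ⟨c, ?_⟩
  rw [hc]
  ext ⟨i, r⟩ ⟨j, s⟩
  change Matrix.scalar SL34.Pt (Matrix.scalar (Fin 3) c) i j r s = _
  rw [Matrix.scalar_apply, Matrix.scalar_apply, Matrix.scalar_apply, Matrix.diagonal_apply,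
    Matrix.diagonal_apply]
  by_cases h : i = j
  · subst h
    simp [Matrix.diagonal_apply]
  · simp [h]

theorem trace_mat (g : SL34) : (mat f g).trace = f (charSum g.raw) / 2 := by
  rw [Matrix.trace, Fintype.sum_prod_type, charSum, map_sum, Finset.sum_div]
  refine Finset.sum_congr rfl fun p _ => ?_
  rw [map_sum, Finset.sum_div]
  refine Finset.sum_congr rfl fun r _ => ?_
  rw [Matrix.diag_apply]
  change block f ((SL34.ptRep p)⁻¹ * g * SL34.ptRep p) r r = _
  rw [block, Matrix.of_apply, SL34.raw_mul, SL34.raw_mul, SL34.raw_inv, SL34.ptRep, SL34.raw_mk]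

end Ico

/-! ### The congruence modulo 64 for the characters of degree 63 -/

namespace SL34

/-- The upper unitriangular matrices. -/
def unitriangular : Subgroup SL34 where
  carrier := {s | ∃ a b c, s.raw = M3.uu a b c}
  one_mem' := ⟨0, 0, 0, raw_one⟩
  mul_mem' {s t} := by
    rintro ⟨a, b, c, h⟩ ⟨a', b', c', h'⟩
    refine ⟨a + a', b + b' + a * c', c + c', ?_⟩
    rw [raw_mul, h, h', M3.mul_eq]
    simp only [M3.uu, dot_eq, q0_eq, q1_eq, M3.mk.injEq]
    refine ⟨?_, ?_, ?_, ?_, ?_, ?_, ?_, ?_, ?_⟩ <;> ring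
  inv_mem' {s} := by
    rintro ⟨a, b, c, h⟩
    refine ⟨a, b + a * c, c, ?_⟩
    rw [raw_inv, h, M3.uu, M3.adj, M3.mk'_eq]
    simp only [minor_eq, M3.uu, q0_eq, q1_eq, M3.mk.injEq]
    refine ⟨?_, ?_, ?_, ?_, ?_, ?_, ?_, ?_, ?_⟩ <;> ring

theorem card_unitriangular : Nat.card unitriangular = 64 := by
  have e : unitriangular ≃ F4 × F4 × F4 :=
    { toFun s := (s.1.raw.b, s.1.raw.c, s.1.raw.f)
      invFun x := ⟨mk (M3.uu x.1 x.2.1 x.2.2) (by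
        simp [M3.det, det_eq, M3.uu, q0_eq, q1_eq]), _, _, _, rfl⟩
      left_inv := by
        rintro ⟨s, a, b, c, h⟩
        apply Subtype.ext
        apply raw_injective
        simp only [raw_mk, h]
        rfl
      right_inv x := rfl }
  rw [Nat.card_congr e, Nat.card_eq_fintype_card]
  rfl

/-- Scalar multiples of unipotent elements, in terms of characteristic polynomials. -/
def ScalarUni (s : SL34) : Prop := M3.tr s.raw ≠ 0 ∧ M3.e2 s.raw = M3.tr s.raw * M3.tr s.raw

theorem scalarUni_conj (x s : SL34) : ScalarUni (x * s * x⁻¹) ↔ ScalarUni s := by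
  rw [ScalarUni, ScalarUni, tr_conj, e2_conj]

/-- An element commuting with a regular unipotent is a polynomial in it and has a single eigenvalue.
One commuting with a transvection has eigenvalues p, t, p, and p²t = 1 = p³ gives t = p. -/
theorem scalarUni_of_commute {u s : SL34} (hu : u ∈ unitriangular) (h1 : u ≠ 1)
    (h : u * s = s * u) : ScalarUni s := by
  obtain ⟨a, b, c, hu⟩ := hu
  have h2 := congrArg raw h
  have hd := s.raw_det
  rw [raw_mul, raw_mul, hu] at h2
  have h3 : ¬ (a = 0 ∧ b = 0 ∧ c = 0) := fun h => h1 (raw_injective (by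
    rw [hu, h.1, h.2.1, h.2.2, raw_one]; rfl))
  clear hu h h1
  unfold ScalarUni
  generalize s.raw = m at *
  obtain ⟨p, q, r, s, t, v, w, x, y⟩ := m
  rw [M3.mul_eq, M3.mul_eq] at h2
  simp only [M3.uu, dot_eq, M3.mk.injEq, q0_eq, q1_eq, M3.det, det_eq, zero_mul, one_mul, mul_zero,
    mul_one, zero_add, add_zero] at h2 hd
  simp only [M3.tr, M3.e2, add_def, minor_eq]
  obtain ⟨e1, e2, e3, e4, e5, e6, e7, e8, e9⟩ := h2
  rw [add_eq_left] at e1 e4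
  by_cases ha : a = 0
  · subst ha
    by_cases hc0 : c = 0
    · subst hc0
      have hb : b ≠ 0 := fun h => h3 ⟨rfl, h, rfl⟩
      have hw : w = 0 := by simpa [hb] using e1
      have hx : x = 0 := by simpa [hb] using e2
      have hs : s = 0 := by simpa [hb] using e6
      subst hw hx hs
      have hy : y = p := by
        apply mul_left_cancel₀ hb
        linear_combination e3
      subst hy
      simp only [mul_zero, zero_mul, add_zero] at hd ⊢
      clear * - hd
      revert t y; decide
    · have hw : w = 0 := by simpa [hc0] using e4
      have hx : x = 0 := by simpa [hc0] using e5
      subst hw hx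
      simp only [mul_zero, zero_mul, add_zero, zero_add] at hd e3 e6 ⊢
      have e3 : b * y = p * b + q * c := by linear_combination e3
      have e6 : c * y = s * b + t * c := by linear_combination e6
      clear * - hd e3 e6 hc0
      revert b c p q s t y; decide +kernel
  · have hw : w = 0 := by simpa [ha] using e8
    subst hw
    have hs : s = 0 := by simpa [ha] using e1
    subst hs
    simp only [mul_zero, zero_mul, add_zero, zero_add] at hd e2 e3 e6 e5 e9 ⊢
    by_cases hc0 : c = 0
    · subst hc0
      have e2 : a * t + b * x = p * a := by linear_combination e2
      have e3 : a * v + b * y = p * b := by linear_combination e3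
      clear * - hd e3 e2 ha
      revert a b p t v x y; decide +kernel
    · have hx : x = 0 := by simpa [hc0] using e5
      subst hx
      have hy : y = t := by
        apply mul_left_cancel₀ hc0
        linear_combination e6
      have ht : p = t := by
        apply mul_left_cancel₀ ha
        linear_combination -e2
      subst hy ht
      clear * - hd
      simp only [mul_zero, add_zero] at hd ⊢
      revert p; decide

open Classical in
/-- Sums of class functions over the elements which are not scalar multiples of unipotents. -/
theorem sum_not_scalarUni {K : Type*} [CommRing K] (F : SL34 → K)
    (hF : ∀ x g, F (x * g * x⁻¹) = F g) (R : Subring K) (hR : ∀ g, F g ∈ R) :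
    ∃ t ∈ R, ∑ g : {g : SL34 // ¬ ScalarUni g}, F g = 64 * t := by
  let act : MulAction unitriangular {g : SL34 // ¬ ScalarUni g} :=
    { smul u g := ⟨u * g * (u : SL34)⁻¹, fun h => g.2 ((scalarUni_conj _ _).1 h)⟩
      one_smul g := Subtype.ext (by change (1 : SL34) * g * (1 : SL34)⁻¹ = g; simp)
      mul_smul u v g := Subtype.ext (by
        change (u * v : SL34) * g * (u * v : SL34)⁻¹ = u * (v * g * (v : SL34)⁻¹) * (u : SL34)⁻¹
        group) }
  -- A point stabiliser consists of unipotents commuting with g, so it is trivial. All orbits then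
  -- have 64 elements, and F is constant on each.
  have hfree : ∀ g : {g : SL34 // ¬ ScalarUni g}, MulAction.stabilizer unitriangular g = ⊥ := by
    intro g
    rw [Subgroup.eq_bot_iff_forall]
    intro u hu
    by_contra h1
    have h2 : (u * g * (u : SL34)⁻¹ : SL34) = g := congrArg Subtype.val hu
    exact g.2 (scalarUni_of_commute u.2 (fun h => h1 (Subtype.ext h)) (mul_inv_eq_iff_eq_mul.1 h2))
  let e := MulAction.selfEquivOrbitsQuotientProd hfree
  have := Fintype.ofFinite unitriangular
  have := Fintype.ofFinite (Quotient (MulAction.orbitRel unitriangular {g : SL34 // ¬ ScalarUni g}))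
  refine ⟨∑ q : Quotient (MulAction.orbitRel unitriangular {g : SL34 // ¬ ScalarUni g}), F q.out,
    sum_mem fun q _ => hR _, ?_⟩
  rw [← e.symm.sum_comp, Fintype.sum_prod_type, Finset.mul_sum]
  refine Finset.sum_congr rfl fun q _ => ?_
  have h : ∀ u, F (e.symm (q, u)) = F q.out := by
    intro u
    have h3 : e.symm (q, u) = u • q.out := rfl
    rw [h3]
    exact hF _ _
  simp only [h, Finset.sum_const, Finset.card_univ, nsmul_eq_mul, ← Nat.card_eq_fintype_card,
    card_unitriangular]
  norm_num

end SL34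

namespace Ico

variable {K : Type*} [Field K] [CharZero K] (f : GoldenInt →+* K)

theorem trace_mat_conj (x g : SL34) : (mat f (x * g * x⁻¹)).trace = (mat f g).trace := by
  rw [map_mul, Matrix.trace_mul_comm, ← map_mul, inv_mul_cancel_left]

theorem map_mk (x y : ℤ) : f ⟨x, y⟩ = x + y * f ⟨0, 1⟩ := by
  have h : (⟨x, y⟩ : GoldenInt) = (x : GoldenInt) + (y : GoldenInt) * ⟨0, 1⟩ := by
    ext <;> simp
  rw [h, map_add, map_mul, map_intCast, map_intCast]

theorem mat_omega : mat f SL34.omega = 1 := by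
  obtain ⟨c, hc⟩ := eq_scalar_of_commute_mat f (mat f SL34.omega) fun g => by
    rw [Commute, SemiconjBy, ← map_mul, ← map_mul, SL34.omega_comm]
  have h := trace_mat f SL34.omega
  rw [charSum_omega, map_mk, hc, Matrix.scalar_apply, Matrix.trace_diagonal, Finset.sum_const,
    Finset.card_univ, nsmul_eq_mul] at h
  have h1 : (Fintype.card (SL34.Pt × Fin 3) : K) = 63 := by
    have : Fintype.card (SL34.Pt × Fin 3) = 63 := by decide
    rw [this]; norm_num
  rw [h1] at h
  push_cast at h
  have h2 : c = 1 := by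
    have h3 : (63 : K) * c = 63 * 1 := by linear_combination h
    exact mul_left_cancel₀ (by norm_num) h3
  rw [hc, h2, map_one]

theorem trace_mat_ofLabel (j : ℕ) :
    (mat f (SL34.ofLabel j)).trace = f (charSum (SL34.rep (j / 3)).raw) / 2 := by
  rw [SL34.ofLabel, map_mul, map_pow, mat_omega, one_pow, one_mul, trace_mat]

theorem trace_mat_rep_five : (mat f (SL34.rep 5)).trace = f ⟨0, 1⟩ := by
  rw [trace_mat, charSum_rep_five, map_mk]
  push_cast
  ring

theorem not_scalarUni_ofLabel : ∀ j : Fin 28, 15 ≤ j.1 → ¬ SL34.ScalarUni (SL34.ofLabel j) := by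
  unfold SL34.ScalarUni
  simp only [SL34.raw_ofLabel]
  decide +kernel

theorem exists_trace_mat_eq (g : SL34) : ∃ v : GoldenInt, (mat f g).trace = f v ∧
    (SL34.ScalarUni g → v = 63 ∨ v = -1) := by
  obtain ⟨j, hj, x, rfl⟩ := SL34.exists_label g
  rw [trace_mat_conj, trace_mat_ofLabel, SL34.scalarUni_conj]
  have half : ∀ v : GoldenInt, f (2 * v) / 2 = f v := fun v => by
    rw [map_mul, map_ofNat, mul_div_cancel_left₀ _ two_ne_zero]
  have key : ∀ k : Fin 10, ∃ v : GoldenInt, charSum (SL34.rep k).raw = 2 * v ∧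
      (k.1 < 5 → v = 63 ∨ v = -1) := by
    intro k
    fin_cases k
    · exact ⟨63, charSum_one, fun _ => Or.inl rfl⟩
    · exact ⟨-1, (charSum_rep 0).trans (by decide), fun _ => Or.inr rfl⟩
    · exact ⟨-1, (charSum_rep 1).trans (by decide), fun _ => Or.inr rfl⟩
    · exact ⟨-1, (charSum_rep 2).trans (by decide), fun _ => Or.inr rfl⟩
    · exact ⟨-1, (charSum_rep 3).trans (by decide), fun _ => Or.inr rfl⟩
    · exact ⟨⟨0, 1⟩, charSum_rep_five, fun h => absurd h (by decide)⟩
    · exact ⟨⟨1, -1⟩, charSum_rep_six.trans (by decide), fun h => absurd h (by decide)⟩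
    · exact ⟨0, charSum_rep_seven, fun h => absurd h (by decide)⟩
    · exact ⟨0, charSum_rep_eight, fun h => absurd h (by decide)⟩
    · exact ⟨0, charSum_rep_nine, fun h => absurd h (by decide)⟩
  obtain ⟨v, hv, hv'⟩ := key ⟨j / 3, by omega⟩
  refine ⟨v, by rw [hv, half], fun hs => hv' ?_⟩
  by_contra h
  exact not_scalarUni_ofLabel ⟨j, hj⟩ (by dsimp only at h ⊢; omega) hs

/-- The central characters of the representations of degree 63 are congruent to that of the trivial
representation modulo 64. -/
theorem sum_trace_mat_sub (z : SL34 → K) (hz : ∀ x g, z (x * g * x⁻¹) = z g) (R : Subring K)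
    (hR : ∀ g, z g ∈ R) (hf : ∀ v, f v ∈ R) :
    ∃ t ∈ R, ∑ g, z g * ((mat f g).trace - 63) = 64 * t := by
  classical
  obtain ⟨t, ht, h⟩ := SL34.sum_not_scalarUni (fun g => z g * ((mat f g).trace - 63))
    (fun x g => by rw [hz, trace_mat_conj]) R fun g => by
      obtain ⟨v, hv, -⟩ := exists_trace_mat_eq f g
      rw [hv]
      exact mul_mem (hR g) (sub_mem (hf v) (ofNat_mem R 63))
  -- On scalar multiples of unipotents the character is 63 or -1, so each summand is already a
  -- multiple of 64.
  have h2 : ∃ t ∈ R, ∑ g : {g : SL34 // SL34.ScalarUni g}, z g * ((mat f g).trace - 63) = 64 * t := by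
    have h3 : ∀ g : {g : SL34 // SL34.ScalarUni g}, ∃ t ∈ R,
        z g * ((mat f g).trace - 63) = 64 * t := by
      intro g
      obtain ⟨v, hv, hv'⟩ := exists_trace_mat_eq f g
      rcases hv' g.2 with h | h
      · exact ⟨0, zero_mem R, by rw [hv, h, map_ofNat]; ring⟩
      · exact ⟨- z g, neg_mem (hR g), by rw [hv, h, map_neg, map_one]; ring⟩
    choose s hs hs' using h3
    exact ⟨∑ g, s g, sum_mem fun g _ => hs g, by
      rw [Finset.mul_sum]; exact Finset.sum_congr rfl fun g _ => hs' g⟩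
  obtain ⟨t', ht', h'⟩ := h2
  refine ⟨t' + t, add_mem ht' ht, ?_⟩
  rw [mul_add, ← h, ← h', ← Fintype.sum_subtype_add_sum_subtype SL34.ScalarUni]

end Ico

/-! ### Representations with scalar endomorphisms and their integral central characters -/

namespace Representation

variable {K G V : Type*} [Field K] [Group G] [AddCommGroup V] [Module K V]

/-- The only endomorphisms of the representation are the scalars. -/
def HasScalarEnd (ρ : Representation K G V) : Prop :=
  ∀ T : Module.End K V, (∀ g, Commute T (ρ g)) → ∃ c : K, T = algebraMap K (Module.End K V) c

/-- Maschke gives an equivariant projection onto any subrepresentation. It is a scalar, and equals 1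
if it fixes a non-zero vector. -/
theorem HasScalarEnd.isIrreducible [Finite G] [CharZero K] [Nontrivial V]
    {ρ : Representation K G V} (h : ρ.HasScalarEnd) : ρ.IsIrreducible := by
  have : NeZero (Nat.card G : K) := ⟨Nat.cast_ne_zero.2 Nat.card_pos.ne'⟩
  rw [irreducible_iff_isSimpleModule_asModule]
  have : Nontrivial ρ.asModule := inferInstanceAs (Nontrivial V)
  refine { exists_pair_ne := exists_pair_ne _, eq_bot_or_eq_top := fun S => ?_ }
  obtain ⟨S', hS⟩ := MonoidAlgebra.Submodule.exists_isCompl S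
  let P : IntertwiningMap ρ ρ := (IntertwiningMap.equivAlgEnd (ρ := ρ)).symm (S.projection S' hS)
  obtain ⟨c, hc⟩ := h P.toLinearMap P.isIntertwining'
  have hP : ∀ x : ρ.asModule, S.projection S' hS x = (c • x : V) :=
    fun x => by
      rw [← (IntertwiningMap.equivAlgEnd (ρ := ρ)).apply_symm_apply (S.projection S' hS)]
      exact LinearMap.congr_fun hc x
  by_cases hS0 : S = ⊥
  · exact Or.inl hS0
  obtain ⟨s, hs, hs0⟩ := Submodule.exists_mem_ne_zero_of_ne_bot hS0
  have h1 : (c • s : V) = (1 : K) • (s : V) := by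
    rw [← hP s, one_smul, Submodule.projection_apply_of_mem_left hS hs]
  have h2 : c = 1 := smul_left_injective K (M := V) hs0 h1
  refine Or.inr (eq_top_iff.2 fun x _ => ?_)
  have h3 : S.projection S' hS x = x := (hP x).trans (by rw [h2]; exact one_smul K (x : V))
  rw [← h3]
  exact Submodule.projection_apply_mem hS x

/-- The action of a central element of the group ring is by an integral scalar. -/
theorem HasScalarEnd.exists_centralHom {O : Type*} [CommRing O] [Algebra O K]
    [IsIntegrallyClosedIn O K] [Finite G] [Nontrivial V]
    {ρ : Representation K G V} (h : ρ.HasScalarEnd) :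
    ∃ Φ : Subalgebra.center O (MonoidAlgebra O G) →ₐ[O] O, ∀ z,
      ρ.asAlgebraHom (MonoidAlgebra.mapRingHom G (algebraMap O K) z.1) =
        algebraMap K (Module.End K V) (algebraMap O K (Φ z)) := by
  have hinj : Function.Injective (algebraMap K (Module.End K V)) := RingHom.injective _
  have hinj' : Function.Injective (algebraMap O K) :=
    IsIntegralClosure.algebraMap_injective O O K
  let act : MonoidAlgebra O G →+* Module.End K V :=
    (ρ.asAlgebraHom : MonoidAlgebra K G →+* Module.End K V).comp
      (MonoidAlgebra.mapRingHom G (algebraMap O K))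
  have hact : act.comp (algebraMap O (MonoidAlgebra O G)) =
      (algebraMap K (Module.End K V)).comp (algebraMap O K) := by
    ext r : 1
    simp [act, Representation.asAlgebraHom_def, Algebra.algebraMap_eq_smul_one]
  have key : ∀ z : Subalgebra.center O (MonoidAlgebra O G), ∃ o : O,
      act z.1 = algebraMap K (Module.End K V) (algebraMap O K o) := by
    intro z
    obtain ⟨c, hc⟩ := h (act z.1) fun g => by
      have h1 : ρ g = act (MonoidAlgebra.single g 1) := by simp [act]
      rw [h1, Commute, SemiconjBy, ← map_mul, ← map_mul]
      congr 1
      exact ((Subalgebra.mem_center_iff.1 z.2) _).symm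
    -- The scalar is a root of the monic equation of z over O, so it lies in O, which is integrally
    -- closed in K.
    have hz : IsIntegral O z.1 := Algebra.IsIntegral.isIntegral _
    obtain ⟨p, hp, hp'⟩ := hz
    have h2 := congrArg act hp'
    rw [Polynomial.hom_eval₂, hact, hc, map_zero, ← Polynomial.hom_eval₂] at h2
    have h3 : IsIntegral O c := ⟨p, hp, hinj (by rw [h2, map_zero])⟩
    obtain ⟨o, ho⟩ := IsIntegrallyClosedIn.isIntegral_iff.1 h3
    exact ⟨o, by rw [hc, ho]⟩
  choose Φ hΦ using key
  have hcomp : Function.Injective fun o => algebraMap K (Module.End K V) (algebraMap O K o) :=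
    hinj.comp hinj'
  refine ⟨{ toFun := Φ, map_one' := hcomp ?_, map_mul' := fun x y => hcomp ?_,
            map_zero' := hcomp ?_, map_add' := fun x y => hcomp ?_,
            commutes' := fun r => hcomp ?_ }, hΦ⟩ <;> dsimp only
  · rw [← hΦ]; simp
  · rw [map_mul, map_mul, ← hΦ, ← hΦ, ← hΦ]; exact map_mul act _ _
  · rw [← hΦ]; simp
  · rw [map_add, map_add, ← hΦ, ← hΦ, ← hΦ]; exact map_add act _ _
  · rw [← hΦ]; exact RingHom.congr_fun hact r

theorem trace_asAlgebraHom [Fintype G] [FiniteDimensional K V] (ρ : Representation K G V)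
    (x : MonoidAlgebra K G) :
    LinearMap.trace K V (ρ.asAlgebraHom x) = ∑ g, x.coeff g * ρ.character g := by
  rw [asAlgebraHom_def, MonoidAlgebra.lift_apply, Finsupp.sum_fintype, map_sum]
  · exact Finset.sum_congr rfl fun g _ => by rw [map_smul, smul_eq_mul]; rfl
  · simp

end Representation

theorem Representation.IsIrreducible.nontrivial {K G V : Type*} [Field K] [Group G]
    [AddCommGroup V] [Module K V] {ρ : Representation K G V} (h : ρ.IsIrreducible) :
    Nontrivial V := by
  by_contra hV
  rw [not_nontrivial_iff_subsingleton] at hV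
  have : Subsingleton (Subrepresentation ρ) :=
    ⟨fun a b => Subrepresentation.toSubmodule_injective (Subsingleton.elim _ _)⟩
  exact not_subsingleton (Subrepresentation ρ) this

/-! ### Scalar products and the character lattice -/

namespace GroupBlock

section ScalarProduct

variable {G K : Type*} [Group G] [Fintype G] [Field K]

theorem scalarProduct_eq_sum (φ ψ : G → K) :
    scalarProduct φ ψ = (Nat.card G : K)⁻¹ * ∑ g, φ g * ψ g⁻¹ := by
  rw [scalarProduct, finsum_eq_sum_of_fintype]

variable (G K) in
/-- The scalar product as a bilinear form. -/
noncomputable def scalarForm : (G → K) →ₗ[K] (G → K) →ₗ[K] K :=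
  LinearMap.mk₂ K scalarProduct
    (fun φ φ' ψ => by
      simp only [scalarProduct_eq_sum, Pi.add_apply, add_mul, Finset.sum_add_distrib, mul_add])
    (fun c φ ψ => by
      simp only [scalarProduct_eq_sum, Pi.smul_apply, smul_eq_mul, mul_assoc, ← Finset.mul_sum]
      ring)
    (fun φ ψ ψ' => by
      simp only [scalarProduct_eq_sum, Pi.add_apply, mul_add, Finset.sum_add_distrib])
    (fun c φ ψ => by
      simp only [scalarProduct_eq_sum, Pi.smul_apply, smul_eq_mul, mul_left_comm _ c,
        ← Finset.mul_sum])

theorem scalarForm_apply (φ ψ : G → K) : scalarForm G K φ ψ = scalarProduct φ ψ := rfl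

theorem scalarProduct_character [CharZero K] {V W : Type*} [AddCommGroup V] [Module K V]
    [FiniteDimensional K V] [AddCommGroup W] [Module K W] [FiniteDimensional K W]
    (ρ : Representation K G V) (σ : Representation K G W) :
    scalarProduct σ.character ρ.character =
      Module.finrank K (Representation.IntertwiningMap ρ σ) := by
  have : Invertible (Nat.card G : K) := invertibleOfNonzero (Nat.cast_ne_zero.2 Nat.card_pos.ne')
  rw [scalarProduct_eq_sum, Representation.card_inv_mul_sum_char_mul_char_eq_finrank]

theorem one_ne_zero_intertwiningMap {V : Type*} [AddCommGroup V] [Module K V] [Nontrivial V]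
    (ρ : Representation K G V) : (1 : Representation.IntertwiningMap ρ ρ) ≠ 0 := by
  intro h
  obtain ⟨v, hv⟩ := exists_ne (0 : V)
  exact hv (congrArg (fun T : Representation.IntertwiningMap ρ ρ => T.toLinearMap v) h)

theorem scalarProduct_self_of_hasScalarEnd [CharZero K] {V : Type*} [AddCommGroup V] [Module K V]
    [FiniteDimensional K V] [Nontrivial V] {ρ : Representation K G V} (h : ρ.HasScalarEnd) :
    scalarProduct ρ.character ρ.character = 1 := by
  rw [scalarProduct_character, ← Nat.cast_one, Nat.cast_inj]
  have h0 := one_ne_zero_intertwiningMap ρ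
  refine (finrank_eq_one_iff_of_nonzero' _ h0).2 fun T => ?_
  obtain ⟨c, hc⟩ := h T.toLinearMap T.isIntertwining'
  exact ⟨c, by ext v; exact (LinearMap.congr_fun hc v).symm⟩

/-- Norm one means a one-dimensional endomorphism algebra. This condition replaces absolute
irreducibility, so K need not be known to be a splitting field. -/
theorem hasScalarEnd_of_scalarProduct_self [CharZero K] {V : Type*} [AddCommGroup V] [Module K V]
    [FiniteDimensional K V] [Nontrivial V] {ρ : Representation K G V}
    (h : scalarProduct ρ.character ρ.character = 1) : ρ.HasScalarEnd := by
  rw [scalarProduct_character, ← Nat.cast_one, Nat.cast_inj] at h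
  have h0 := one_ne_zero_intertwiningMap ρ
  intro T hT
  obtain ⟨c, hc⟩ := (finrank_eq_one_iff_of_nonzero' _ h0).1 h ⟨T, hT⟩
  refine ⟨c, ?_⟩
  ext v
  exact (congrArg (fun T : Representation.IntertwiningMap ρ ρ => T.toLinearMap v) hc).symm

end ScalarProduct

section Irr

variable {O G K : Type*} [CommRing O] [Group G] [Fintype G] [Field K] [CharZero K] [Algebra O K]
  (B : GroupBlock O G)

theorem scalarProduct_eq_zero {χ χ' : G → K} (h : χ ∈ B.irr K) (h' : χ' ∈ B.irr K) (hne : χ ≠ χ') :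
    scalarProduct χ χ' = 0 := by
  obtain ⟨n, ρ, hρ, -, rfl⟩ := h
  obtain ⟨n', ρ', hρ', -, rfl⟩ := h'
  rw [scalarProduct_character]
  have : IsEmpty (Representation.Equiv ρ' ρ) :=
    ⟨fun e => hne (Representation.char_iso e).symm⟩
  rw [Module.finrank_zero_of_subsingleton, Nat.cast_zero]

theorem exists_scalarProduct_self {χ : G → K} (h : χ ∈ B.irr K) :
    ∃ m : ℕ, 0 < m ∧ scalarProduct χ χ = m := by
  obtain ⟨n, ρ, hρ, -, rfl⟩ := h
  refine ⟨_, ?_, scalarProduct_character ρ ρ⟩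
  have := hρ.nontrivial
  have h0 := one_ne_zero_intertwiningMap ρ
  have : Nontrivial (Representation.IntertwiningMap ρ ρ) := ⟨1, 0, h0⟩
  exact Module.finrank_pos

theorem finite_irr : (B.irr K).Finite := by
  have h : LinearIndependent K (fun χ : B.irr K => χ.1) := by
    refine LinearMap.linearIndependent_of_isOrthoᵢ (B := scalarForm G K) ?_ ?_
    · intro χ χ' hne
      exact B.scalarProduct_eq_zero χ.2 χ'.2 fun h => hne (Subtype.ext h)
    · intro χ h
      obtain ⟨m, hm, hm'⟩ := B.exists_scalarProduct_self χ.2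
      have h2 : scalarProduct χ.1 χ.1 = 0 := h
      rw [hm'] at h2
      exact hm.ne' (by exact_mod_cast h2)
  exact h.setFinite

/-- The elements of norm one of the character lattice. -/
theorem exists_eq_or_eq_neg {φ : G → K} (hφ : φ ∈ B.charLattice K) (h1 : scalarProduct φ φ = 1) :
    ∃ χ ∈ B.irr K, scalarProduct χ χ = 1 ∧ (φ = χ ∨ φ = -χ) := by
  classical
  have := B.finite_irr (K := K)
  have : Fintype (B.irr K) := (B.finite_irr (K := K)).fintype
  rw [charLattice, ← Submodule.span_int_eq_addSubgroupClosure, Submodule.mem_toAddSubgroup] at hφ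
  have hr : B.irr K = Set.range (fun χ : B.irr K => χ.1) := Subtype.range_coe.symm
  rw [hr, Submodule.mem_span_range_iff_exists_fun] at hφ
  obtain ⟨c, hc⟩ := hφ
  choose m hm hm' using fun χ : B.irr K => B.exists_scalarProduct_self χ.2
  -- The norm of Σ c(χ)χ is Σ c(χ)²m(χ) with positive integers m(χ), so a single coefficient
  -- survives; it is ±1 and its m(χ) is 1.
  have h2 : ∑ χ, c χ ^ 2 * (m χ : ℤ) = 1 := by
    have h3 : scalarForm G K φ φ = ∑ χ, (c χ ^ 2 * m χ : K) := by
      rw [← hc, map_sum]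
      refine Finset.sum_congr rfl fun χ _ => ?_
      rw [map_sum, LinearMap.sum_apply, Finset.sum_eq_single χ]
      · rw [map_zsmul, map_zsmul, LinearMap.smul_apply, scalarForm_apply, hm', zsmul_eq_mul,
          zsmul_eq_mul]
        ring
      · intro χ' _ hne
        rw [map_zsmul, map_zsmul, LinearMap.smul_apply, scalarForm_apply,
          B.scalarProduct_eq_zero χ'.2 χ.2 fun h => hne (Subtype.ext h), smul_zero, smul_zero]
      · simp
    rw [scalarForm_apply, h1] at h3
    exact_mod_cast h3.symm
  obtain ⟨χ, hχ⟩ : ∃ χ, c χ ≠ 0 := by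
    by_contra! h
    simp [h] at h2
  have hpos : ∀ χ, 0 ≤ c χ ^ 2 * (m χ : ℤ) := fun χ => by positivity
  have h4 : 1 ≤ c χ ^ 2 * (m χ : ℤ) := by
    have := hm χ
    have : 0 < c χ ^ 2 * (m χ : ℤ) := by positivity
    omega
  rw [← Finset.add_sum_erase _ _ (Finset.mem_univ χ)] at h2
  have h5 : 0 ≤ ∑ χ' ∈ Finset.univ.erase χ, c χ' ^ 2 * (m χ' : ℤ) :=
    Finset.sum_nonneg fun χ' _ => hpos χ'
  have h6 : ∑ χ' ∈ Finset.univ.erase χ, c χ' ^ 2 * (m χ' : ℤ) = 0 := by omega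
  have h7 : c χ ^ 2 * (m χ : ℤ) = 1 := by omega
  have h8 : ∀ χ', χ' ≠ χ → c χ' = 0 := by
    intro χ' hne
    have := (Finset.sum_eq_zero_iff_of_nonneg fun χ' _ => hpos χ').1 h6 χ' (by simp [hne])
    have h9 := (hm χ').ne'
    simpa [h9] using this
  have h9 : φ = c χ • χ.1 := by
    rw [← hc, Finset.sum_eq_single χ (fun χ' _ hne => by rw [h8 χ' hne, zero_smul]) (by simp)]
  have h10 : (m χ : ℤ) = 1 :=
    Int.eq_one_of_dvd_one (by positivity) ⟨c χ ^ 2, by rw [mul_comm, h7]⟩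
  have h11 : c χ = 1 ∨ c χ = -1 := by
    rw [h10, mul_one] at h7
    exact sq_eq_one_iff.1 h7
  refine ⟨χ.1, χ.2, ?_, ?_⟩
  · rw [hm']; exact_mod_cast h10
  · rcases h11 with h | h
    · exact Or.inl (by rw [h9, h, one_smul])
    · exact Or.inr (by rw [h9, h, neg_smul, one_smul])

end Irr

end GroupBlock

/-! ### Transfer between centres along a perfect isometry -/

theorem MonoidAlgebra.coeff_conj_of_mem_center {O G : Type*} [CommRing O] [Group G]
    {z : MonoidAlgebra O G} (hz : z ∈ Subalgebra.center O (MonoidAlgebra O G)) (x g : G) :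
    z.coeff (x * g * x⁻¹) = z.coeff g := by
  have h := congrArg (fun w => w.coeff (x * g)) (Subalgebra.mem_center_iff.1 hz (single x 1))
  rw [coeff_single_mul_eq_mul_coeff g (fun g' _ => mul_right_inj x), one_mul,
    coeff_mul_single_eq_coeff_mul (x * g * x⁻¹) (fun g' _ => by rw [eq_mul_inv_iff_mul_eq]),
    mul_one] at h
  exact h.symm

theorem MonoidAlgebra.mem_center_of_coeff_conj {O G : Type*} [CommRing O] [Group G]
    {z : MonoidAlgebra O G} (hz : ∀ x g, z.coeff (x * g * x⁻¹) = z.coeff g) :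
    z ∈ Subalgebra.center O (MonoidAlgebra O G) := by
  rw [Subalgebra.mem_center_iff]
  intro w
  induction w using MonoidAlgebra.induction_on with
  | of x =>
    rw [of_apply]
    ext y
    rw [coeff_single_mul_eq_mul_coeff (x⁻¹ * y) (fun g' _ => by rw [eq_inv_mul_iff_mul_eq]), one_mul,
      coeff_mul_single_eq_coeff_mul (y * x⁻¹) (fun g' _ => by rw [eq_mul_inv_iff_mul_eq]), mul_one,
      ← hz x]
    congr 1; group
  | add a b ha hb => rw [add_mul, mul_add, ha, hb]
  | smul r a ha => rw [smul_mul_assoc, ha, mul_smul_comm]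

/-- The class of x has |G|/|C(x)| elements and contributes f(x)/|C(x)|. -/
theorem sum_div_card_mem {G K : Type*} [Group G] [Fintype G] [Field K] [CharZero K] (S : Subring K)
    (f : G → K) (hf : ∀ x g, f (x * g * x⁻¹) = f g)
    (hS : ∀ g, f g / (Nat.card (Subgroup.centralizer {g}) : K) ∈ S) :
    (Nat.card G : K)⁻¹ * ∑ g, f g ∈ S := by
  classical
  have : Fintype (ConjClasses G) := Fintype.ofFinite _
  have h0 : (Nat.card G : K) ≠ 0 := Nat.cast_ne_zero.2 Nat.card_pos.ne'
  rw [← Finset.sum_fiberwise (Finset.univ : Finset G) ConjClasses.mk f, Finset.mul_sum]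
  refine sum_mem fun c _ => ?_
  obtain ⟨x, rfl⟩ := ConjClasses.exists_rep c
  have h1 : ∀ g ∈ Finset.univ.filter (fun g => ConjClasses.mk g = ConjClasses.mk x), f g = f x := by
    intro g hg
    rw [Finset.mem_filter, ConjClasses.mk_eq_mk_iff_isConj, isConj_iff] at hg
    obtain ⟨y, hy⟩ := hg.2
    rw [← hy, hf]
  rw [Finset.sum_congr rfl h1, Finset.sum_const, nsmul_eq_mul]
  have h2 : (Finset.univ.filter (fun g => ConjClasses.mk g = ConjClasses.mk x)).card *
      Nat.card (Subgroup.centralizer {x}) = Nat.card G := by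
    rw [Subgroup.nat_card_centralizer_nat_card_stabilizer]
    have h3 := MulAction.card_orbit_mul_card_stabilizer_eq_card_group (ConjAct G) x
    rw [← Nat.card_eq_fintype_card, ← Nat.card_eq_fintype_card, ← Nat.card_eq_fintype_card] at h3
    rw [← Fintype.card_subtype, ← Nat.card_eq_fintype_card]
    refine Eq.trans ?_ h3
    congr 1
    refine Nat.card_congr (Equiv.setCongr (Set.ext fun g => ?_))
    rw [ConjAct.orbit_eq_carrier_conjClasses, ConjClasses.mem_carrier_iff_mk_eq]
    rfl
  have h4 : (Nat.card (Subgroup.centralizer {x}) : K) ≠ 0 := Nat.cast_ne_zero.2 Nat.card_pos.ne'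
  have h5 : (Nat.card G : K)⁻¹ * (((Finset.univ.filter
      (fun g => ConjClasses.mk g = ConjClasses.mk x)).card : K) * f x) =
      f x / (Nat.card (Subgroup.centralizer {x}) : K) := by
    rw [← h2]
    rw [← h2] at h0
    push_cast at h0 ⊢
    have h6 := left_ne_zero_of_mul h0
    field_simp
  rw [h5]
  exact hS x

namespace GroupBlock

variable {O G K : Type*} [CommRing O] [Group G] [Fintype G] [Field K] [CharZero K] [Algebra O K]
  [IsIntegrallyClosedIn O K]

/-- An element of the group ring is obtained from another one by applying a kernel. -/
def IsTransfer (η : G → G → K) (z w : Subalgebra.center O (MonoidAlgebra O G)) : Prop :=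
  ∀ χ : G → K, ∑ g, algebraMap O K (w.1.coeff g) * χ g =
    ∑ h, algebraMap O K (z.1.coeff h) * scalarProduct χ (fun g => η g h)

/-- A kernel with the integrality property of perfect isometries maps the centre of the group ring
to itself. -/
theorem exists_isTransfer {η : G → G → K} (hη1 : ∀ x g h, η (x * g * x⁻¹) h = η g h)
    (hη2 : ∀ x g h, η g (x * h * x⁻¹) = η g h)
    (hint : ∀ g h, η g h / (Nat.card (Subgroup.centralizer {h}) : K) ∈ Set.range (algebraMap O K))
    (z : Subalgebra.center O (MonoidAlgebra O G)) :
    ∃ w : Subalgebra.center O (MonoidAlgebra O G), IsTransfer η z w := by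
  have hz := MonoidAlgebra.coeff_conj_of_mem_center z.2
  -- The inverse g⁻¹ matches the one in `scalarProduct`. Integrality comes from dividing η by
  -- centraliser orders, one class of h at a time.
  have hmem : ∀ g, (Nat.card G : K)⁻¹ * ∑ h, algebraMap O K (z.1.coeff h) * η g⁻¹ h ∈
      (algebraMap O K).range := by
    intro g
    refine sum_div_card_mem _ _ (fun x h => by rw [hz, hη2]) fun h => ?_
    rw [mul_div_assoc]
    exact mul_mem ⟨_, rfl⟩ (hint _ _)
  choose w hw using hmem
  have hinj : Function.Injective (algebraMap O K) :=
    IsIntegralClosure.algebraMap_injective O O K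
  refine ⟨⟨MonoidAlgebra.ofCoeff (Finsupp.equivFunOnFinite.symm w),
    MonoidAlgebra.mem_center_of_coeff_conj fun x g => hinj ?_⟩, fun χ => ?_⟩
  · change algebraMap O K (w (x * g * x⁻¹)) = algebraMap O K (w g)
    rw [hw, hw]
    have : (x * g * x⁻¹)⁻¹ = x * g⁻¹ * x⁻¹ := by group
    simp only [this, hη1]
  · change ∑ g, algebraMap O K (w g) * χ g = _
    simp only [hw, scalarProduct_eq_sum, Finset.mul_sum, Finset.sum_mul]
    rw [Finset.sum_comm]
    refine Finset.sum_congr rfl fun h _ => Finset.sum_congr rfl fun g _ => ?_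
    ring

variable {B B' : GroupBlock O G}

theorem apply_conj_of_mem_charLattice {φ : G → K} (hφ : φ ∈ B.charLattice K) (x g : G) :
    φ (x * g * x⁻¹) = φ g := by
  induction hφ using AddSubgroup.closure_induction with
  | mem φ h =>
    obtain ⟨n, ρ, -, -, rfl⟩ := h
    exact ρ.char_conj g x
  | zero => rfl
  | add a b _ _ ha hb => rw [Pi.add_apply, Pi.add_apply, ha, hb]
  | neg a _ ha => rw [Pi.neg_apply, Pi.neg_apply, ha]

theorem isometryCharacter_eq_sum [Fintype (B.irr K)] (I : B.charLattice K ≃+ B'.charLattice K)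
    (g h : G) : isometryCharacter I g h =
      ∑ χ : B.irr K, χ.1 g * (I ⟨χ.1, AddSubgroup.subset_closure χ.2⟩).1 h := by
  rw [isometryCharacter, finsum_eq_sum_of_fintype]

/-- Distinct irreducible characters are orthogonal, so pairing η with χ extracts the term I(χ). -/
theorem scalarProduct_isometryCharacter_left (I : B.charLattice K ≃+ B'.charLattice K)
    {χ : G → K} (hχ : χ ∈ B.irr K) (h1 : scalarProduct χ χ = 1) (h : G) :
    scalarProduct χ (fun g => isometryCharacter I g h) =
      (I ⟨χ, AddSubgroup.subset_closure hχ⟩).1 h := by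
  have : Fintype (B.irr K) := (B.finite_irr (K := K)).fintype
  have h2 : (fun g => isometryCharacter I g h) =
      ∑ χ : B.irr K, (I ⟨χ.1, AddSubgroup.subset_closure χ.2⟩).1 h • χ.1 := by
    ext g
    rw [isometryCharacter_eq_sum, Finset.sum_apply]
    exact Finset.sum_congr rfl fun χ _ => mul_comm _ _
  rw [h2, ← scalarForm_apply, map_sum, Finset.sum_eq_single ⟨χ, hχ⟩]
  · rw [map_smul, scalarForm_apply, h1, smul_eq_mul, mul_one]
  · intro χ' _ hne
    rw [map_smul, scalarForm_apply, B.scalarProduct_eq_zero hχ χ'.2 fun h => hne (Subtype.ext h.symm),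
      smul_zero]
  · simp

theorem scalarProduct_isometryCharacter_right {I : B.charLattice K ≃+ B'.charLattice K}
    (hI : ∀ φ ψ : B.charLattice K, scalarProduct (I φ).1 (I ψ).1 = scalarProduct φ.1 ψ.1)
    {χ : G → K} (hχ : χ ∈ B.irr K) (h1 : scalarProduct χ χ = 1) (g : G) :
    scalarProduct (I ⟨χ, AddSubgroup.subset_closure hχ⟩).1 (fun h => isometryCharacter I g h) =
      χ g := by
  have : Fintype (B.irr K) := (B.finite_irr (K := K)).fintype
  have h2 : (fun h => isometryCharacter I g h) =
      ∑ χ : B.irr K, χ.1 g • (I ⟨χ.1, AddSubgroup.subset_closure χ.2⟩).1 := by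
    ext h
    rw [isometryCharacter_eq_sum, Finset.sum_apply]
    rfl
  rw [h2, ← scalarForm_apply, map_sum, Finset.sum_eq_single ⟨χ, hχ⟩]
  · rw [map_smul, scalarForm_apply, hI, h1, smul_eq_mul, mul_one]
  · intro χ' _ hne
    rw [map_smul, scalarForm_apply, hI, B.scalarProduct_eq_zero hχ χ'.2 fun h =>
      hne (Subtype.ext h.symm), smul_zero]
  · simp

/-- The homomorphism from the centre of the group ring given by an absolutely irreducible
character. -/
theorem exists_centralHom {χ : G → K} (hχ : χ ∈ B.irr K) (h1 : scalarProduct χ χ = 1) :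
    ∃ (n : K) (Φ : Subalgebra.center O (MonoidAlgebra O G) →ₐ[O] O), n ≠ 0 ∧ χ 1 = n ∧
      (∀ z, n * algebraMap O K (Φ z) = ∑ g, algebraMap O K (z.1.coeff g) * χ g) ∧
      ∀ b, b.1 = B.e → Φ b = 1 := by
  obtain ⟨n, ρ, hρ, hb, rfl⟩ := hχ
  have := hρ.nontrivial
  have hinj : Function.Injective (algebraMap O K) :=
    IsIntegralClosure.algebraMap_injective O O K
  obtain ⟨Φ, hΦ⟩ := (hasScalarEnd_of_scalarProduct_self h1).exists_centralHom (O := O)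
  refine ⟨(Module.finrank K (Fin n → K) : K), Φ, Nat.cast_ne_zero.2 Module.finrank_pos.ne',
    ρ.char_one, fun z => ?_, fun b hbe => hinj ?_⟩
  · have h := congrArg (LinearMap.trace K (Fin n → K)) (hΦ z)
    rw [Representation.trace_asAlgebraHom, Algebra.algebraMap_eq_smul_one, map_smul,
      LinearMap.trace_one, smul_eq_mul, mul_comm] at h
    rw [← h]
    rfl
  · have h := hΦ b
    rw [hbe, hb, ← map_one (algebraMap K (Module.End K (Fin n → K)))] at h
    rw [map_one]
    exact (RingHom.injective (algebraMap K (Module.End K (Fin n → K))) h).symm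

/-- The effect of a perfect isometry on an absolutely irreducible character. -/
theorem IsPerfectIsometry.exists_centralHom {p : ℕ} {I : B.charLattice K ≃+ B'.charLattice K}
    (hI : IsPerfectIsometry p I) {χ : G → K} (hχ : χ ∈ B.irr K) (h1 : scalarProduct χ χ = 1)
    {n : K} {Φ : Subalgebra.center O (MonoidAlgebra O G) →ₐ[O] O}
    (hΦ : ∀ z, n * algebraMap O K (Φ z) = ∑ g, algebraMap O K (z.1.coeff g) * χ g) :
    ∃ (k : K) (Φ' : Subalgebra.center O (MonoidAlgebra O G) →ₐ[O] O), k ≠ 0 ∧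
      (∀ b, b.1 = B'.e → Φ' b = 1) ∧
      (∀ z w, IsTransfer (isometryCharacter I) z w →
        n * algebraMap O K (Φ w) = k * algebraMap O K (Φ' z)) ∧
      ∀ z w, IsTransfer (fun h g => isometryCharacter I g h) z w →
        k * algebraMap O K (Φ' w) = n * algebraMap O K (Φ z) := by
  have hs : scalarProduct (I ⟨χ, AddSubgroup.subset_closure hχ⟩).1
      (I ⟨χ, AddSubgroup.subset_closure hχ⟩).1 = 1 := by rw [hI.isometry]; exact h1
  -- I preserves norm one, so I(χ) = ±χ'. The sign is absorbed into k, which is ± the degree of χ'.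
  obtain ⟨χ', hχ', h1', hε⟩ := B'.exists_eq_or_eq_neg (I ⟨χ, AddSubgroup.subset_closure hχ⟩).2 hs
  obtain ⟨ε, hε0, hε⟩ : ∃ ε : K, ε * ε = 1 ∧
      (I ⟨χ, AddSubgroup.subset_closure hχ⟩).1 = ε • χ' := by
    rcases hε with h | h
    · exact ⟨1, by ring, by rw [h, one_smul]⟩
    · exact ⟨-1, by ring, by rw [h, neg_smul, one_smul]⟩
  obtain ⟨n', Φ', hn', -, hΦ', hb'⟩ := GroupBlock.exists_centralHom hχ' h1'
  refine ⟨ε * n', Φ', mul_ne_zero (left_ne_zero_of_mul_eq_one hε0) hn', hb', fun z w h => ?_,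
    fun z w h => ?_⟩
  · rw [hΦ, h, mul_assoc, hΦ', Finset.mul_sum]
    refine Finset.sum_congr rfl fun g _ => ?_
    rw [scalarProduct_isometryCharacter_left I hχ h1, hε, Pi.smul_apply, smul_eq_mul]
    ring
  · rw [mul_assoc, hΦ', h, hΦ, Finset.mul_sum]
    refine Finset.sum_congr rfl fun g _ => ?_
    have h2 := scalarProduct_isometryCharacter_right hI.isometry hχ h1 g
    rw [hε, ← scalarForm_apply, map_smul, LinearMap.smul_apply, scalarForm_apply, smul_eq_mul] at h2
    rw [← h2]
    ring

/-- The centre of the group ring has three distinct `O`-valued characters which are non-zero on the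
block and congruent to each other modulo 64. -/
def HasCongruentTriple (B : GroupBlock O G) : Prop :=
  ∃ Φ : Fin 3 → (Subalgebra.center O (MonoidAlgebra O G) →ₐ[O] O), Function.Injective Φ ∧
    (∀ i b, b.1 = B.e → Φ i b = 1) ∧ ∀ i j z, (64 : O) ∣ Φ i z - Φ j z

theorem IsPerfectIsometry.hasCongruentTriple {p : ℕ} {I : B.charLattice K ≃+ B'.charLattice K}
    (hI : IsPerfectIsometry p I) {χ : Fin 3 → G → K} (hχ : ∀ i, χ i ∈ B.irr K)
    (h1 : ∀ i, scalarProduct (χ i) (χ i) = 1) {n : Fin 3 → K} (hn : ∀ i, n i ≠ 0)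
    {Φ : Fin 3 → (Subalgebra.center O (MonoidAlgebra O G) →ₐ[O] O)}
    (hΦ : ∀ i z, n i * algebraMap O K (Φ i z) = ∑ g, algebraMap O K (z.1.coeff g) * χ i g)
    (hb : ∀ i b, b.1 = B.e → Φ i b = 1) (hinj : Function.Injective Φ)
    (hcong : ∀ i j z, (64 : O) ∣ Φ i z - Φ j z) : B'.HasCongruentTriple := by
  have hinjK : Function.Injective (algebraMap O K) :=
    IsIntegralClosure.algebraMap_injective O O K
  have : Fintype (B.irr K) := (B.finite_irr (K := K)).fintype
  have hη1 : ∀ x g h, isometryCharacter I (x * g * x⁻¹) h = isometryCharacter I g h := by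
    intro x g h
    rw [isometryCharacter_eq_sum, isometryCharacter_eq_sum]
    exact Finset.sum_congr rfl fun χ _ => by
      rw [apply_conj_of_mem_charLattice (AddSubgroup.subset_closure χ.2)]
  have hη2 : ∀ x g h, isometryCharacter I g (x * h * x⁻¹) = isometryCharacter I g h := by
    intro x g h
    rw [isometryCharacter_eq_sum, isometryCharacter_eq_sum]
    exact Finset.sum_congr rfl fun χ _ => by
      rw [apply_conj_of_mem_charLattice (I ⟨χ.1, AddSubgroup.subset_closure χ.2⟩).2]
  choose R hR using fun z => exists_isTransfer (O := O) hη1 hη2 hI.integral_right z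
  choose R' hR' using fun z => exists_isTransfer (O := O) (η := fun h g => isometryCharacter I g h)
    (fun x g h => hη2 x h g) (fun x g h => hη1 x h g) (fun g h => hI.integral_left h g) z
  choose k Φ' hk hb' hT hT' using fun i => hI.exists_centralHom (hχ i) (h1 i) (hΦ i)
  let b' : Subalgebra.center O (MonoidAlgebra O G) := ⟨B'.e, B'.central⟩
  let b : Subalgebra.center O (MonoidAlgebra O G) := ⟨B.e, B.central⟩
  -- Φ i (R b') and Φ' i (R' b) are the quotients k/n and n/k of signed degrees. Both lie in O, so
  -- they are inverse units.
  have e1 : ∀ i, n i * algebraMap O K (Φ i (R b')) = k i := fun i => by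
    rw [hT i _ _ (hR b'), hb' i b' rfl, map_one, mul_one]
  have e2 : ∀ i, k i * algebraMap O K (Φ' i (R' b)) = n i := fun i => by
    rw [hT' i _ _ (hR' b), hb i b rfl, map_one, mul_one]
  have e3 : ∀ i, Φ i (R b') * Φ' i (R' b) = 1 := fun i => hinjK <| mul_left_cancel₀ (hn i) <| by
    rw [map_mul, map_one, ← mul_assoc, e1, e2, mul_one]
  have e4 : ∀ i z, Φ' i z = Φ' i (R' b) * Φ i (R z) := fun i z => hinjK <|
    mul_left_cancel₀ (hk i) <| by
      rw [map_mul, ← mul_assoc, e2, hT i _ _ (hR z)]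
  have e5 : ∀ i z, Φ' i (R' z) = Φ' i (R' b) * Φ i z := fun i z => hinjK <|
    mul_left_cancel₀ (hk i) <| by
      rw [map_mul, ← mul_assoc, e2, hT' i _ _ (hR' z)]
  refine ⟨Φ', fun i j hij => hinj ?_, hb', fun i j z => ?_⟩
  · refine AlgHom.ext fun z => ?_
    have h3 := e5 i z
    rw [hij, e5 j z] at h3
    have h4 := congrArg (fun x => Φ j (R b') * x) h3
    simp only [← mul_assoc, e3, one_mul] at h4
    exact h4.symm
  -- Inverses of congruent units are congruent, and Φ' i is such a unit times Φ i ∘ R.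
  · have h2 : (64 : O) ∣ Φ' i (R' b) - Φ' j (R' b) := by
      obtain ⟨t, ht⟩ := hcong j i (R b')
      refine ⟨Φ' i (R' b) * Φ' j (R' b) * t, ?_⟩
      linear_combination (Φ' i (R' b) * Φ' j (R' b)) * ht - Φ' i (R' b) * e3 j + Φ' j (R' b) * e3 i
    rw [e4 i, e4 j]
    have h3 : Φ' i (R' b) * Φ i (R z) - Φ' j (R' b) * Φ j (R z) =
        (Φ' i (R' b) - Φ' j (R' b)) * Φ i (R z) + Φ' j (R' b) * (Φ i (R z) - Φ j (R z)) := by ring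
    rw [h3]
    exact dvd_add (h2.mul_right _) ((hcong i j _).mul_left _)

end GroupBlock

/-! ### Centres of block algebras -/

theorem eq_zero_of_mul_self_eq_zero_of_isSemisimpleRing {R : Type*} [Ring R] [IsSemisimpleRing R] {n : R}
    (hn : ∀ r, r * n = n * r) (h : n * n = 0) : n = 0 := by
  obtain ⟨J, hJ⟩ := exists_isCompl (Submodule.span R {n})
  have h1 : (1 : R) ∈ Submodule.span R {n} ⊔ J := by rw [hJ.sup_eq_top]; trivial
  obtain ⟨x, hx, j, hj, hxj⟩ := Submodule.mem_sup.1 h1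
  obtain ⟨r, rfl⟩ := Submodule.mem_span_singleton.1 hx
  have h2 : n = n * j := by
    calc n = n * (r • n + j) := by rw [hxj, mul_one]
      _ = n * j := by rw [mul_add, smul_eq_mul, hn, ← mul_assoc, h, zero_mul, zero_add]
  have h3 : n ∈ J := by rw [h2]; exact J.smul_mem n hj
  exact (Submodule.disjoint_def.1 hJ.disjoint) n (Submodule.mem_span_singleton_self n) h3

namespace GroupBlock

variable {O G : Type*} [CommRing O] [Group G] (B : GroupBlock O G)

/-- The inclusion of the centre of a block algebra into the centre of the group ring. -/
noncomputable def centerInclusion : Subalgebra.center O B.Alg →ₗ[O]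
    Subalgebra.center O (MonoidAlgebra O G) where
  toFun x := ⟨x.1.1, Subalgebra.mem_center_iff.2 fun y => by
    have hx := (Subsemigroup.mem_corner_iff B.idem).1 x.1.2
    have hc := Subring.mem_center_iff.1 B.central
    let y' : B.Alg := ⟨B.e * y * B.e, (Subsemigroup.mem_corner_iff B.idem).2 ⟨by
      rw [mul_assoc, ← mul_assoc B.e B.e, B.idem.eq], by rw [mul_assoc, B.idem.eq]⟩⟩
    have h : y' * x.1 = x.1 * y' := Subalgebra.mem_center_iff.1 x.2 y'
    have h' : B.e * y * B.e * x.1.1 = x.1.1 * (B.e * y * B.e) := congrArg Subtype.val h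
    rw [mul_assoc, hx.1, ← hc y, mul_assoc y, hx.1, mul_assoc y B.e B.e, B.idem.eq, hc y,
      ← mul_assoc, hx.2] at h'
    exact h'⟩
  map_add' _ _ := rfl
  map_smul' _ _ := rfl

/-- Multiplication with the block idempotent on the centre of the group ring. -/
noncomputable def centerProjection : Subalgebra.center O (MonoidAlgebra O G) →ₐ[O]
    Subalgebra.center O B.Alg :=
  have hc := Subring.mem_center_iff.1 B.central
  have hm : ∀ z : MonoidAlgebra O G, z * B.e ∈ Subsemigroup.corner B.e := fun z =>
    (Subsemigroup.mem_corner_iff B.idem).2 ⟨by rw [← mul_assoc, ← hc, mul_assoc, B.idem.eq],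
      by rw [mul_assoc, B.idem.eq]⟩
  AlgHom.ofLinearMap
    { toFun z := ⟨⟨z.1 * B.e, hm z⟩, Subalgebra.mem_center_iff.2 fun y => Subtype.ext (by
        change y.1 * (z.1 * B.e) = z.1 * B.e * y.1
        rw [← mul_assoc, Subalgebra.mem_center_iff.1 z.2, mul_assoc, mul_assoc, hc])⟩
      map_add' x y := Subtype.ext (Subtype.ext (add_mul x.1 y.1 B.e))
      map_smul' r x := Subtype.ext (Subtype.ext (smul_mul_assoc r x.1 B.e)) }
    (Subtype.ext (Subtype.ext (one_mul B.e)))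
    fun x y => Subtype.ext (Subtype.ext (by
      change x.1 * y.1 * B.e = x.1 * B.e * (y.1 * B.e)
      rw [mul_assoc x.1 B.e, ← mul_assoc B.e, ← hc y.1, mul_assoc y.1, B.idem.eq, mul_assoc]))

theorem coe_centerProjection (z : Subalgebra.center O (MonoidAlgebra O G)) :
    (B.centerProjection z).1.1 = z.1 * B.e := rfl

theorem centerProjection_centerInclusion (x : Subalgebra.center O B.Alg) :
    B.centerProjection (B.centerInclusion x) = x :=
  Subtype.ext (Subtype.ext ((Subsemigroup.mem_corner_iff B.idem).1 x.1.2).2)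

theorem centerInclusion_centerProjection {b : Subalgebra.center O (MonoidAlgebra O G)}
    (hb : b.1 = B.e) (z : Subalgebra.center O (MonoidAlgebra O G)) :
    B.centerInclusion (B.centerProjection z) = z * b :=
  Subtype.ext (by rw [MulMemClass.coe_mul, hb]; rfl)

/-- The centre embeds into that of KG, which is semisimple by Maschke and so has no central element
of square zero but 0. -/
theorem isReduced_center (K : Type*) [Field K] [CharZero K] [Algebra O K] [Finite G]
    (hinj : Function.Injective (algebraMap O K)) : IsReduced (Subalgebra.center O B.Alg) := by
  have : NeZero (Nat.card G : K) := ⟨Nat.cast_ne_zero.2 Nat.card_pos.ne'⟩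
  have hinj' : Function.Injective (MonoidAlgebra.mapRingHom G (algebraMap O K)) := by
    intro x y h
    ext g
    apply hinj
    have := congrArg (fun w => w.coeff g) h
    simpa using this
  rw [isReduced_iff_pow_one_lt 2 one_lt_two]
  intro x hx
  have h1 : x.1.1 = 0 := by
    apply hinj'
    rw [map_zero]
    refine eq_zero_of_mul_self_eq_zero_of_isSemisimpleRing (fun r => ?_) ?_
    · induction r using MonoidAlgebra.induction_on with
      | of g =>
        have := Subalgebra.mem_center_iff.1 (B.centerInclusion x).2 (MonoidAlgebra.of O G g)
        have := congrArg (MonoidAlgebra.mapRingHom G (algebraMap O K)) this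
        rw [map_mul, map_mul, show (B.centerInclusion x).1 = x.1.1 from rfl] at this
        simpa using this
      | add a b ha hb => rw [add_mul, mul_add, ha, hb]
      | smul r a ha => rw [smul_mul_assoc, ha, mul_smul_comm]
    · rw [← map_mul]
      rw [pow_two] at hx
      have := congrArg (fun y => y.1.1) hx
      rw [show x.1.1 * x.1.1 = 0 from this, map_zero]
  exact Subtype.ext (Subtype.ext h1)

/-- The characters are pulled back along Z(OG) → Z(OGb) → Z(OGb₀). Surjectivity of β keeps them
distinct, and congruences survive any pullback. -/
theorem HasCongruentTriple.of_surjective {B₀ B : GroupBlock O G} (h : B₀.HasCongruentTriple)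
    (β : Subalgebra.center O B.Alg →ₐ[O] Subalgebra.center O B₀.Alg)
    (hβ : Function.Surjective β) : B.HasCongruentTriple := by
  obtain ⟨Φ, hinj, hb, hcong⟩ := h
  let b₀ : Subalgebra.center O (MonoidAlgebra O G) := ⟨B₀.e, B₀.central⟩
  let ι : Fin 3 → (Subalgebra.center O B₀.Alg →ₐ[O] O) := fun i =>
    AlgHom.ofLinearMap ((Φ i).toLinearMap ∘ₗ B₀.centerInclusion) (hb i _ rfl)
      fun x y => map_mul (Φ i) (B₀.centerInclusion x) (B₀.centerInclusion y)
  have hι : ∀ i z, ι i (B₀.centerProjection z) = Φ i z := fun i z => by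
    change Φ i (B₀.centerInclusion (B₀.centerProjection z)) = _
    rw [B₀.centerInclusion_centerProjection (b := b₀) rfl, map_mul, hb i b₀ rfl, mul_one]
  refine ⟨fun i => (ι i).comp (β.comp B.centerProjection), fun i j hij => hinj ?_, fun i b h => ?_,
    fun i j z => hcong i j _⟩
  · refine AlgHom.ext fun z => ?_
    rw [← hι, ← hι]
    obtain ⟨y, hy⟩ := hβ (B₀.centerProjection z)
    have := AlgHom.congr_fun hij (B.centerInclusion y)
    simp only [AlgHom.comp_apply, B.centerProjection_centerInclusion, hy] at this
    exact this
  · have h1 : B.centerProjection b = 1 := Subtype.ext (Subtype.ext (by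
      rw [coe_centerProjection, h]; exact B.idem.eq))
    simp only [AlgHom.comp_apply, h1, map_one]

end GroupBlock

/-! ### From characters of the centre to central characters of the group -/

namespace MonoidAlgebra

variable {O G K : Type*} [CommRing O] [Group G] [Fintype G] [Field K] [CharZero K] [Algebra O K]

/-- The sum of the conjugates of a group element by all elements of the group. -/
noncomputable def conjSum (O : Type*) [CommRing O] (g : G) :
    Subalgebra.center O (MonoidAlgebra O G) :=
  ⟨∑ x : G, single (x * g * x⁻¹) 1, by
    rw [Subalgebra.mem_center_iff]
    intro w
    induction w using MonoidAlgebra.induction_on with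
    | of y =>
      rw [of_apply, Finset.mul_sum, Finset.sum_mul, ← Equiv.sum_comp (Equiv.mulLeft y) (fun x => single (x * g * x⁻¹) 1 * single y 1)]
      refine Finset.sum_congr rfl fun x _ => ?_
      rw [single_mul_single, single_mul_single, Equiv.coe_mulLeft]
      congr 1; group
    | add a b ha hb => rw [add_mul, mul_add, ha, hb]
    | smul r a ha => rw [smul_mul_assoc, ha, mul_smul_comm]⟩

theorem coe_conjSum (g : G) : (conjSum O g).1 = ∑ x : G, single (x * g * x⁻¹) 1 := rfl

theorem conjSum_conj (x g : G) : conjSum O (x * g * x⁻¹) = conjSum O g := by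
  apply Subtype.ext
  rw [coe_conjSum, coe_conjSum, ← Equiv.sum_comp (Equiv.mulRight x) (fun y => single (y * g * y⁻¹) 1)]
  refine Finset.sum_congr rfl fun y _ => ?_
  rw [Equiv.coe_mulRight]
  congr 1; group

theorem conjSum_one : conjSum O (1 : G) = (Fintype.card G : Subalgebra.center O (MonoidAlgebra O G)) := by
  apply Subtype.ext
  rw [coe_conjSum]
  simp only [mul_one, mul_inv_cancel, Finset.sum_const, Finset.card_univ, nsmul_eq_mul, ← one_def]
  rfl

/-- Under a character of the centre this identity becomes `IsCentralChar.mul`. -/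
theorem sum_conjSum (h g : G) :
    ∑ x, conjSum O (x * h * x⁻¹ * g) = conjSum O h * conjSum O g := by
  apply Subtype.ext
  rw [AddSubmonoidClass.coe_finsetSum, MulMemClass.coe_mul]
  simp only [coe_conjSum]
  rw [Finset.sum_comm, Finset.mul_sum]
  refine Finset.sum_congr rfl fun y _ => ?_
  rw [Finset.sum_mul, ← Equiv.sum_comp (Equiv.mulLeft y)
    (fun x => single (x * h * x⁻¹) 1 * single (y * g * y⁻¹) 1)]
  refine Finset.sum_congr rfl fun x _ => ?_
  rw [single_mul_single, Equiv.coe_mulLeft, one_mul]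
  congr 1; group

theorem card_smul_eq_sum_conjSum (z : Subalgebra.center O (MonoidAlgebra O G)) :
    (Fintype.card G : O) • z = ∑ g, z.1.coeff g • conjSum O g := by
  apply Subtype.ext
  have hz : z.1 = ∑ g, single g (z.1.coeff g) := by
    ext g
    classical
    simp [coeff_sum]
  have hc := coeff_conj_of_mem_center z.2
  rw [AddSubmonoidClass.coe_finsetSum]
  simp only [SetLike.val_smul, coe_conjSum, Finset.smul_sum, smul_single, smul_eq_mul, mul_one]
  rw [Finset.sum_comm]
  have : ∀ x : G, ∑ g, single (x * g * x⁻¹) (z.1.coeff g) = z.1 := fun x => by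
    nth_rw 2 [hz]
    rw [← (MulAut.conj x).toEquiv.sum_comp (fun g => single g (z.1.coeff g))]
    refine Finset.sum_congr rfl fun g _ => ?_
    change _ = single (x * g * x⁻¹) (z.1.coeff (x * g * x⁻¹))
    rw [hc]
  rw [Finset.sum_congr rfl fun x _ => this x, Finset.sum_const, Finset.card_univ, Nat.cast_smul_eq_nsmul]

/-- The class function given by a character of the centre of the group ring. -/
noncomputable def centralChar (K : Type*) [Field K] [Algebra O K]
    (Φ : Subalgebra.center O (MonoidAlgebra O G) →ₐ[O] O) (g : G) : K :=
  (Fintype.card G : K)⁻¹ * algebraMap O K (Φ (conjSum O g))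

theorem isCentralChar_centralChar (Φ : Subalgebra.center O (MonoidAlgebra O G) →ₐ[O] O) :
    IsCentralChar (centralChar K Φ) where
  one := by
    rw [centralChar, conjSum_one, map_natCast, map_natCast]
    exact inv_mul_cancel₀ (Nat.cast_ne_zero.2 Fintype.card_ne_zero)
  conj x g := by rw [centralChar, conjSum_conj, centralChar]
  mul h g := by
    have h0 : (Fintype.card G : K) ≠ 0 := Nat.cast_ne_zero.2 Fintype.card_ne_zero
    simp only [centralChar, ← Finset.mul_sum, ← map_sum, sum_conjSum, map_mul]
    field_simp

theorem algebraMap_eq_sum_centralChar (Φ : Subalgebra.center O (MonoidAlgebra O G) →ₐ[O] O)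
    (z : Subalgebra.center O (MonoidAlgebra O G)) :
    algebraMap O K (Φ z) = ∑ g, algebraMap O K (z.1.coeff g) * centralChar K Φ g := by
  have h0 : (Fintype.card G : K) ≠ 0 := Nat.cast_ne_zero.2 Fintype.card_ne_zero
  have h := congrArg (fun w => algebraMap O K (Φ w)) (card_smul_eq_sum_conjSum z)
  simp only [map_smul, map_sum, smul_eq_mul, map_mul, map_natCast] at h
  apply mul_left_cancel₀ h0
  rw [h, Finset.mul_sum]
  refine Finset.sum_congr rfl fun g _ => ?_
  rw [centralChar]
  field_simp

end MonoidAlgebra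

theorem IsCentralChar.comp_mulEquiv {G H K : Type*} [Group G] [Fintype G] [Group H] [Fintype H]
    [Field K] {ψ : G → K} (hψ : IsCentralChar ψ) (e : H ≃* G) : IsCentralChar (ψ ∘ e) where
  one := by rw [Function.comp_apply, map_one, hψ.one]
  conj x g := by simp only [Function.comp_apply, map_mul, map_inv, hψ.conj]
  mul h g := by
    rw [Fintype.card_congr e.toEquiv]
    simp only [Function.comp_apply, map_mul, map_inv]
    rw [← hψ.mul]
    exact e.toEquiv.sum_comp (fun x => ψ (x * e h * x⁻¹ * e g))

/-! ### Non-principal blocks have no congruent triple -/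

namespace GroupBlock

variable {O G : Type*} [CommRing O] [Group G] [Fintype G]

open MonoidAlgebra in
/-- A non-principal block of `SL₃(4)` has no triple of congruent characters. -/
theorem not_hasCongruentTriple (K : Type*) [Field K] [CharZero K] [Algebra O K]
    (hinj : Function.Injective (algebraMap O K)) (e : SL34 ≃* G) (B : GroupBlock O G)
    (hB : ¬ B.IsPrincipal) (hO : ∀ n : ℤ, (64 : O) ∣ n → (64 : ℤ) ∣ n) :
    ¬ B.HasCongruentTriple := by
  rintro ⟨Φ, hΦ, hb, hcong⟩
  let b : Subalgebra.center O (MonoidAlgebra O G) := ⟨B.e, B.central⟩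
  have hψ : ∀ i, IsCentralChar (centralChar K (Φ i) ∘ e) := fun i =>
    (isCentralChar_centralChar (Φ i)).comp_mulEquiv e
  -- The augmentation of the idempotent is its action on the trivial representation.
  have haug : ∑ g, B.e.coeff g = 0 := by
    by_contra h
    refine hB fun h' => h ?_
    have h2 := LinearMap.congr_fun h' (1 : O)
    rw [Representation.asAlgebraHom_def, lift_apply, Finsupp.sum_fintype _ _ (by simp)] at h2
    simpa using h2
  have hsum : ∀ (c : SL34 → ℕ), (∀ x g, c (x * g * x⁻¹) = c g) →
      ∃ z : Subalgebra.center O (MonoidAlgebra O G), ∀ i,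
        ∑ g, (c g : K) * (centralChar K (Φ i) ∘ e) g = algebraMap O K (Φ i z) := by
    intro c hc
    refine ⟨⟨ofCoeff (Finsupp.equivFunOnFinite.symm fun g => (c (e.symm g) : O)),
      mem_center_of_coeff_conj fun x g => ?_⟩, fun i => ?_⟩
    · change (c (e.symm (x * g * x⁻¹)) : O) = c (e.symm g)
      rw [map_mul, map_mul, map_inv, hc]
    · rw [algebraMap_eq_sum_centralChar, ← e.toEquiv.sum_comp]
      refine Finset.sum_congr rfl fun g _ => ?_
      change _ = algebraMap O K (c (e.symm (e g)) : O) * _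
      rw [e.symm_apply_apply, map_natCast]
      rfl
  have heq : ∀ i j, centralChar K (Φ i) ∘ e = centralChar K (Φ j) ∘ e → i = j := by
    intro i j h
    refine hΦ (AlgHom.ext fun z => hinj ?_)
    have h2 : centralChar K (Φ i) = centralChar K (Φ j) := by
      ext g
      have := congrFun h (e.symm g)
      simpa using this
    rw [algebraMap_eq_sum_centralChar, algebraMap_eq_sum_centralChar, h2]
  have h := SL34.eq_of_congruent (algebraMap O K).range ?_ (fun i => centralChar K (Φ i) ∘ e) hψ
    ?_ ?_ ?_
  · rcases h with h | h | h <;> exact absurd (heq _ _ h) (by decide)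
  · rintro n _ ⟨t, rfl⟩ h
    exact hO n ⟨t, hinj (by rw [map_intCast, h, map_mul, map_ofNat])⟩
  -- The trivial central character would send the block idempotent to its augmentation 0 instead of
  -- 1.
  · intro i
    by_contra! h
    have h2 := algebraMap_eq_sum_centralChar (K := K) (Φ i) b
    have h3 : ∀ g, centralChar K (Φ i) g = 1 := fun g => by
      have := h (e.symm g)
      simpa using this
    simp only [h3, mul_one, ← map_sum] at h2
    rw [haug, hb i b rfl, map_one, map_zero] at h2
    exact one_ne_zero h2
  · intro i c hc
    obtain ⟨z, hz⟩ := hsum c hc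
    rw [hz]
    exact ⟨_, rfl⟩
  · intro i j c hc
    obtain ⟨z, hz⟩ := hsum c hc
    obtain ⟨t, ht⟩ := hcong i j z
    exact ⟨_, ⟨t, rfl⟩, by rw [hz, hz, ← map_sub, ht, map_mul, map_ofNat]⟩

end GroupBlock

/-! ### The congruent triple of the principal block -/

namespace Representation

variable {K G n : Type*} [Field K] [Group G] [Fintype n] [DecidableEq n]

/-- The representation given by a homomorphism to matrices. -/
noncomputable def ofMatrix (M : G →* Matrix n n K) : Representation K G (n → K) :=
  ((Matrix.toLinAlgEquiv' : Matrix n n K ≃ₐ[K] Module.End K (n → K)) : _ →* _).comp M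

theorem character_ofMatrix (M : G →* Matrix n n K) (g : G) :
    (ofMatrix M).character g = (M g).trace :=
  Matrix.trace_toLin'_eq (M g)

theorem hasScalarEnd_ofMatrix {M : G →* Matrix n n K}
    (hM : ∀ φ, (∀ g, Commute φ (M g)) → ∃ c, φ = Matrix.scalar n c) :
    (ofMatrix M).HasScalarEnd := by
  intro T hT
  let E : Matrix n n K ≃ₐ[K] Module.End K (n → K) := Matrix.toLinAlgEquiv'
  obtain ⟨c, hc⟩ := hM (E.symm T) fun g => by
    have h : E (M g) * T = T * E (M g) := (hT g).symm
    refine E.injective ?_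
    rw [map_mul, map_mul, E.apply_symm_apply, h]
  refine ⟨c, ?_⟩
  rw [← E.apply_symm_apply T, hc, ← E.commutes]
  rfl

theorem HasScalarEnd.of_finrank_eq_one {V : Type*} [AddCommGroup V] [Module K V]
    (h : Module.finrank K V = 1) (ρ : Representation K G V) : ρ.HasScalarEnd := by
  intro T _
  obtain ⟨v, hv, h'⟩ := finrank_eq_one_iff'.1 h
  obtain ⟨c, hc⟩ := h' (T v)
  refine ⟨c, LinearMap.ext fun w => ?_⟩
  obtain ⟨d, rfl⟩ := h' w
  rw [map_smul, ← hc, Module.algebraMap_end_apply, smul_comm]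

end Representation

namespace GroupBlock

variable {O G K : Type*} [CommRing O] [Group G] [Fintype G] [Field K] [CharZero K] [Algebra O K]
  [IsIntegrallyClosedIn O K] (B : GroupBlock O G)

theorem asAlgebraHom_trivial (z : MonoidAlgebra O G) :
    (Representation.trivial O G O).asAlgebraHom z = algebraMap O _ (∑ g, z.coeff g) := by
  rw [Representation.asAlgebraHom_def, MonoidAlgebra.lift_apply, Finsupp.sum_fintype _ _ (by simp),
    map_sum]
  refine Finset.sum_congr rfl fun g _ => ?_
  ext
  simp

theorem IsPrincipal.sum_coeff_eq_one [IsDomain O] (hB : B.IsPrincipal) : ∑ g, B.e.coeff g = 1 := by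
  have h1 : IsIdempotentElem ((Representation.trivial O G O).asAlgebraHom B.e) := B.idem.map _
  rw [IsPrincipal, asAlgebraHom_trivial] at hB
  rw [asAlgebraHom_trivial] at h1
  have h2 := LinearMap.congr_fun h1 1
  simp only [Module.End.mul_apply, Module.algebraMap_end_apply, smul_eq_mul, mul_one] at h2
  refine (IsIdempotentElem.iff_eq_zero_or_one.1 h2).resolve_left fun h => hB ?_
  rw [h, map_zero]

/-- A representation whose central character is congruent to that of the trivial representation
belongs to the principal block. -/
theorem IsPrincipal.exists_centralHom [IsDomain O] (hO : ¬ IsUnit (64 : O)) (hB : B.IsPrincipal)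
    {m : ℕ} (hm : m ≠ 0) {ρ : Representation K G (Fin m → K)} (hρ : ρ.HasScalarEnd)
    (hm' : ∃ l : ℤ, (m : ℤ) = 1 + 64 * l ∨ (m : ℤ) = -1 + 64 * l)
    (hcong : ∀ z ∈ Subalgebra.center O (MonoidAlgebra O G),
      ∃ t, ∑ g, algebraMap O K (z.coeff g) * (ρ.character g - m) = 64 * algebraMap O K t) :
    ρ.character ∈ B.irr K ∧ scalarProduct ρ.character ρ.character = 1 ∧
      ∃ Φ : Subalgebra.center O (MonoidAlgebra O G) →ₐ[O] O,
        (∀ z, (m : K) * algebraMap O K (Φ z) =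
          ∑ g, algebraMap O K (z.1.coeff g) * ρ.character g) ∧
        (∀ b, b.1 = B.e → Φ b = 1) ∧ ∀ z, (64 : O) ∣ Φ z - ∑ g, z.1.coeff g := by
  have hinj : Function.Injective (algebraMap O K) :=
    IsIntegralClosure.algebraMap_injective O O K
  have : Nonempty (Fin m) := ⟨⟨0, Nat.pos_of_ne_zero hm⟩⟩
  obtain ⟨Φ, hΦ⟩ := hρ.exists_centralHom (O := O)
  have hΦ' : ∀ z, (m : K) * algebraMap O K (Φ z) =
      ∑ g, algebraMap O K (z.1.coeff g) * ρ.character g := fun z => by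
    have h := congrArg (LinearMap.trace K (Fin m → K)) (hΦ z)
    rw [Representation.trace_asAlgebraHom, Algebra.algebraMap_eq_smul_one, map_smul,
      LinearMap.trace_one, smul_eq_mul, mul_comm, Module.finrank_fin_fun] at h
    rw [← h]
    rfl
  have hc : ∀ z, (64 : O) ∣ Φ z - ∑ g, z.1.coeff g := by
    intro z
    obtain ⟨t, ht⟩ := hcong z.1 z.2
    -- The degree m is ±1 modulo 64, so it can be cancelled from the congruence.
    have h1 : (m : O) * (Φ z - ∑ g, z.1.coeff g) = 64 * t := hinj (by
      rw [map_mul, map_sub, map_mul, map_natCast, map_ofNat, ← ht, map_sum, mul_sub, hΦ',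
        Finset.mul_sum, ← Finset.sum_sub_distrib]
      exact Finset.sum_congr rfl fun g _ => by ring)
    obtain ⟨l, hl | hl⟩ := hm'
    · have hl' : (m : O) = 1 + 64 * l := by exact_mod_cast congrArg (Int.cast : ℤ → O) hl
      rw [hl'] at h1
      exact ⟨t - l * (Φ z - ∑ g, z.1.coeff g), by linear_combination h1⟩
    · have hl' : (m : O) = -1 + 64 * l := by exact_mod_cast congrArg (Int.cast : ℤ → O) hl
      rw [hl'] at h1
      exact ⟨l * (Φ z - ∑ g, z.1.coeff g) - t, by linear_combination -h1⟩
  have hb : ∀ b, b.1 = B.e → Φ b = 1 := by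
    intro b hb
    -- Φ(b) is 0 or 1, and it is congruent to the augmentation 1 modulo the non-unit 64.
    have h1 : IsIdempotentElem (Φ b) := IsIdempotentElem.map (f := Φ)
      (Subtype.ext (by rw [MulMemClass.coe_mul, hb]; exact B.idem.eq))
    refine (IsIdempotentElem.iff_eq_zero_or_one.1 h1).resolve_left fun h => hO ?_
    have h2 := hc b
    rw [h, hb, IsPrincipal.sum_coeff_eq_one B hB, zero_sub] at h2
    exact isUnit_of_dvd_one (by simpa using h2)
  refine ⟨⟨m, ρ, hρ.isIrreducible, ?_, rfl⟩, scalarProduct_self_of_hasScalarEnd hρ, Φ, hΦ', hb, hc⟩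
  have := hΦ ⟨B.e, B.central⟩
  rwa [hb _ rfl, map_one, map_one] at this

theorem sum_coeff_conjSum {χ : G → K} (hχ : ∀ x g, χ (x * g * x⁻¹) = χ g) (g : G) :
    ∑ h, algebraMap O K ((MonoidAlgebra.conjSum O g).1.coeff h) * χ h = Fintype.card G * χ g := by
  classical
  simp only [MonoidAlgebra.coe_conjSum, MonoidAlgebra.coeff_sum, Finsupp.finsetSum_apply, map_sum,
    Finset.sum_mul]
  rw [Finset.sum_comm]
  simp [Finsupp.single_apply, hχ]

end GroupBlock

namespace Ico

variable {K : Type*} [Field K] [CharZero K] {G : Type*} [Group G]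

/-- The representations of degree 63. -/
noncomputable def rep (f : GoldenInt →+* K) (e : G ≃* SL34) : Representation K G (Fin 63 → K) :=
  Representation.ofMatrix (((Matrix.reindexAlgEquiv K K
    (Fintype.equivFinOfCardEq (by decide : Fintype.card (SL34.Pt × Fin 3) = 63)) : _ ≃ₐ[K] _) :
      _ →* Matrix (Fin 63) (Fin 63) K).comp ((mat f).comp (e : G →* SL34)))

theorem character_rep (f : GoldenInt →+* K) (e : G ≃* SL34) (g : G) :
    (rep f e).character g = (mat f (e g)).trace := by
  rw [rep, Representation.character_ofMatrix]
  exact Equiv.sum_comp (Fintype.equivFinOfCardEq _).symm (fun i => mat f (e g) i i)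

theorem hasScalarEnd_rep (f : GoldenInt →+* K) (e : G ≃* SL34) : (rep f e).HasScalarEnd := by
  refine Representation.hasScalarEnd_ofMatrix fun φ hφ => ?_
  let ε := Fintype.equivFinOfCardEq (by decide : Fintype.card (SL34.Pt × Fin 3) = 63)
  let E : Matrix (SL34.Pt × Fin 3) (SL34.Pt × Fin 3) K ≃ₐ[K] Matrix (Fin 63) (Fin 63) K :=
    Matrix.reindexAlgEquiv K K ε
  obtain ⟨c, hc⟩ := eq_scalar_of_commute_mat f (E.symm φ) fun g => by
    have h : φ * E (mat f g) = E (mat f g) * φ := by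
      have := hφ (e.symm g)
      simp only [MonoidHom.comp_apply, MonoidHom.coe_coe, e.apply_symm_apply] at this
      exact this
    refine E.injective ?_
    rw [map_mul, map_mul, E.apply_symm_apply, h]
  refine ⟨c, ?_⟩
  rw [← E.apply_symm_apply φ, hc]
  exact E.commutes c

end Ico

namespace GroupBlock

variable {O G K : Type*} [CommRing O] [IsDomain O] [Group G] [Fintype G] [Field K] [CharZero K]
  [Algebra O K] [IsIntegrallyClosedIn O K]

/-- The characters of degree 1 and 63 of the principal block of `SL₃(4)`. -/
theorem IsPrincipal.exists_congruent_characters {B : GroupBlock O G} (hB : B.IsPrincipal)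
    (hO : ¬ IsUnit (64 : O)) (e : G ≃* SL34) {γ : O} (hγ : γ * γ = 1 + γ) :
    ∃ (χ : Fin 3 → G → K) (n : Fin 3 → K)
      (Φ : Fin 3 → (Subalgebra.center O (MonoidAlgebra O G) →ₐ[O] O)),
      (∀ i, χ i ∈ B.irr K) ∧ (∀ i, scalarProduct (χ i) (χ i) = 1) ∧ (∀ i, n i ≠ 0) ∧
      (∀ i z, n i * algebraMap O K (Φ i z) = ∑ g, algebraMap O K (z.1.coeff g) * χ i g) ∧
      (∀ i b, b.1 = B.e → Φ i b = 1) ∧ Function.Injective Φ ∧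
      ∀ i j z, (64 : O) ∣ Φ i z - Φ j z := by
  have hfield : ∀ x : O, x * x = 1 + x → ∃ f : GoldenInt →+* K,
      f ⟨0, 1⟩ = algebraMap O K x ∧ ∀ v, f v ∈ (algebraMap O K).range := by
    intro x hx
    refine ⟨(QuadraticAlgebra.lift ⟨algebraMap O K x, ?_⟩ : GoldenInt →ₐ[ℤ] K).toRingHom, ?_, ?_⟩
    · rw [one_smul, one_smul, ← map_mul, hx, map_add, map_one]
    · simp
    · intro v
      refine ⟨v.re • 1 + v.im • x, ?_⟩
      simp
  obtain ⟨f₁, hf₁, hr₁⟩ := hfield γ hγ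
  -- The other root of x² = x + 1 gives the second character of degree 63.
  obtain ⟨f₂, hf₂, hr₂⟩ := hfield (1 - γ) (by linear_combination hγ)
  have h63 : ∀ f : GoldenInt →+* K, (∀ v, f v ∈ (algebraMap O K).range) →
      ∀ z ∈ Subalgebra.center O (MonoidAlgebra O G),
        ∃ t, ∑ g, algebraMap O K (z.coeff g) * ((Ico.rep f e).character g - (63 : ℕ)) =
          64 * algebraMap O K t := by
    intro f hf z hz
    obtain ⟨_, ⟨t, rfl⟩, ht⟩ := Ico.sum_trace_mat_sub f
      (fun g => algebraMap O K (z.coeff (e.symm g))) (fun x g => by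
        rw [map_mul e.symm, map_mul e.symm, map_inv e.symm, MonoidAlgebra.coeff_conj_of_mem_center hz])
      (algebraMap O K).range (fun g => ⟨_, rfl⟩) hf
    refine ⟨t, ?_⟩
    rw [← ht, ← e.toEquiv.sum_comp]
    refine Finset.sum_congr rfl fun g _ => ?_
    rw [Ico.character_rep]
    change _ = algebraMap O K (z.coeff (e.symm (e g))) * ((Ico.mat f (e g)).trace - 63)
    rw [e.symm_apply_apply, Nat.cast_ofNat]
  obtain ⟨i0, n0, Φ0, a0, b0, c0⟩ := IsPrincipal.exists_centralHom B hO hB one_ne_zero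
    (Representation.HasScalarEnd.of_finrank_eq_one (by simp)
      (Representation.trivial K G (Fin 1 → K))) ⟨0, by norm_num⟩
    fun z _ => ⟨0, by simp [Representation.character]⟩
  obtain ⟨i1, n1, Φ1, a1, b1, c1⟩ := IsPrincipal.exists_centralHom B hO hB (by norm_num : 63 ≠ 0)
    (Ico.hasScalarEnd_rep f₁ e) ⟨1, by norm_num⟩ (h63 f₁ hr₁)
  obtain ⟨i2, n2, Φ2, a2, b2, c2⟩ := IsPrincipal.exists_centralHom B hO hB (by norm_num : 63 ≠ 0)
    (Ico.hasScalarEnd_rep f₂ e) ⟨1, by norm_num⟩ (h63 f₂ hr₂)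
  -- Elements of order five separate the three characters: up to the factor |G| the values are 1,
  -- γ/63 and (1-γ)/63.
  let x := MonoidAlgebra.conjSum O (e.symm (SL34.rep 5))
  have hx : ∀ {m : ℕ} (ρ : Representation K G (Fin m → K))
      {Φ : Subalgebra.center O (MonoidAlgebra O G) →ₐ[O] O}
      (_ : ∀ z, (m : K) * algebraMap O K (Φ z) =
        ∑ g, algebraMap O K (z.1.coeff g) * ρ.character g),
      (m : K) * algebraMap O K (Φ x) = Fintype.card G * ρ.character (e.symm (SL34.rep 5)) := by
    intro m ρ Φ h
    rw [h, sum_coeff_conjSum fun x g => ρ.char_conj g x]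
  have h0 := hx _ a0
  have h1 := hx _ a1
  have h2 := hx _ a2
  have hG : (Fintype.card G : K) ≠ 0 := Nat.cast_ne_zero.2 Fintype.card_ne_zero
  have hχ0 : (Representation.trivial K G (Fin 1 → K)).character (e.symm (SL34.rep 5)) = 1 := by
    simp [Representation.character]
  rw [hχ0] at h0
  rw [Ico.character_rep, e.apply_symm_apply, Ico.trace_mat_rep_five, hf₁] at h1
  rw [Ico.character_rep, e.apply_symm_apply, Ico.trace_mat_rep_five, hf₂, map_sub, map_one] at h2
  have hγK : algebraMap O K γ * algebraMap O K γ = 1 + algebraMap O K γ := by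
    rw [← map_mul, hγ, map_add, map_one]
  push_cast at h0 h1 h2
  generalize algebraMap O K γ = c at *
  have k1 : Φ0 ≠ Φ1 := by
    rintro rfl
    have h3 : (Fintype.card G : K) * c = Fintype.card G * 63 := by linear_combination 63 * h0 - h1
    have h4 := mul_left_cancel₀ hG h3
    rw [h4] at hγK
    norm_num at hγK
  have k2 : Φ0 ≠ Φ2 := by
    rintro rfl
    have h3 : (Fintype.card G : K) * c = Fintype.card G * (-62) := by linear_combination h2 - 63 * h0
    have h4 := mul_left_cancel₀ hG h3
    rw [h4] at hγK
    norm_num at hγK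
  have k3 : Φ1 ≠ Φ2 := by
    rintro rfl
    have h3 : (Fintype.card G : K) * c = Fintype.card G * (1 - c) := by linear_combination h2 - h1
    have h4 := mul_left_cancel₀ hG h3
    have h5 : (5 : K) = 0 := by linear_combination (2 * c + 1 - 2) * h4 - 4 * hγK
    norm_num at h5
  refine ⟨![(Representation.trivial K G (Fin 1 → K)).character, (Ico.rep f₁ e).character,
    (Ico.rep f₂ e).character], ![1, 63, 63], ![Φ0, Φ1, Φ2], ?_, ?_, ?_, ?_, ?_, ?_, ?_⟩
  · intro i; fin_cases i; exacts [i0, i1, i2]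
  · intro i; fin_cases i; exacts [n0, n1, n2]
  · intro i; fin_cases i; exacts [one_ne_zero, by norm_num, by norm_num]
  · intro i; fin_cases i
    exacts [by simpa using a0, by simpa using a1, by simpa using a2]
  · intro i; fin_cases i; exacts [b0, b1, b2]
  · intro i j h
    fin_cases i <;> fin_cases j <;>
      first | rfl | exact absurd h k1 | exact absurd h k2 | exact absurd h k3 |
        exact absurd h.symm k1 | exact absurd h.symm k2 | exact absurd h.symm k3
  · have h : ∀ i z, (64 : O) ∣ (![Φ0, Φ1, Φ2] : Fin 3 → _) i z - ∑ g, z.1.coeff g := by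
      intro i; fin_cases i; exacts [c0, c1, c2]
    intro i j z
    have := dvd_sub (h i z) (h j z)
    rwa [sub_sub_sub_cancel_right] at this

end GroupBlock

/-! ### Identification of the group, 2-adic integers and conclusion -/

theorem exists_mulEquiv_SL34 : Nonempty (Matrix.SpecialLinearGroup (Fin 3) (GaloisField 2 2) ≃* SL34) := by
  have : Fintype (GaloisField 2 2) := Fintype.ofFinite _
  have e : GaloisField 2 2 ≃+* F4 := FiniteField.ringEquivOfCardEq (by
    rw [← Nat.card_eq_fintype_card, GaloisField.card 2 2 two_ne_zero]; rfl)
  refine ⟨MulEquiv.ofBijective (Matrix.SpecialLinearGroup.map (e : GaloisField 2 2 →+* F4)) ?_⟩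
  refine Function.bijective_iff_has_inverse.2
    ⟨Matrix.SpecialLinearGroup.map (e.symm : F4 →+* GaloisField 2 2), fun s => ?_, fun s => ?_⟩
  · ext i j; exact e.symm_apply_apply _
  · ext i j; exact e.apply_symm_apply _

theorem five_dvd_card_SL34 : 5 ∣ Nat.card SL34 := by
  rw [Nat.card_eq_fintype_card, SL34.flagRep_transversal.card_eq]
  exact Dvd.dvd.mul_left (by decide) _

section Padic

variable {K : Type*} [Field K] [Algebra ℚ_[2] K] [Algebra ℤ_[2] K] [IsScalarTower ℤ_[2] ℚ_[2] K]

/-- If 64 divides n, then n/64 is a rational number integral over ℤ₂, hence lies in ℤ₂. -/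
theorem dvd_of_dvd_integralClosure (n : ℤ) (h : (64 : integralClosure ℤ_[2] K) ∣ n) :
    (64 : ℤ) ∣ n := by
  have : CharZero K := charZero_of_injective_algebraMap (algebraMap ℚ_[2] K).injective
  obtain ⟨t, ht⟩ := h
  have h1 : (n : K) = 64 * t.1 := congrArg Subtype.val ht
  have h2 : t.1 = algebraMap ℚ_[2] K (n / 64) := by
    rw [map_div₀, map_intCast, map_ofNat, h1]
    field_simp
  have h3 : IsIntegral ℤ_[2] ((n : ℚ_[2]) / 64) := by
    have := t.2
    rw [mem_integralClosure_iff, h2] at this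
    exact (isIntegral_algebraMap_iff (algebraMap ℚ_[2] K).injective).1 this
  obtain ⟨y, hy⟩ := IsIntegrallyClosed.isIntegral_iff.1 h3
  have h4 : (n : ℤ_[2]) = 2 ^ 6 * y := by
    apply IsFractionRing.injective ℤ_[2] ℚ_[2]
    rw [map_intCast, map_mul, hy, map_pow, map_ofNat]
    norm_num
    field_simp
  have h5 : ‖(n : ℤ_[2])‖ ≤ (2 : ℕ) ^ (-(6 : ℕ) : ℤ) := by
    rw [PadicInt.norm_le_pow_iff_mem_span_pow, Ideal.mem_span_singleton]
    exact ⟨y, by exact_mod_cast h4⟩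
  exact_mod_cast PadicInt.norm_int_le_pow_iff_dvd.1 h5

/-- For a primitive fifth root of unity z, the element -(z + z⁻¹) is a root of x² = x + 1. -/
theorem exists_golden {N : ℕ} (hN : N ≠ 0) (h5 : 5 ∣ N) (hK : ∃ ζ : K, IsPrimitiveRoot ζ N) :
    ∃ γ : integralClosure ℤ_[2] K, γ * γ = 1 + γ := by
  obtain ⟨ζ, hζ⟩ := hK
  obtain ⟨m, rfl⟩ := h5
  have h1 : IsPrimitiveRoot (ζ ^ m) 5 := hζ.pow (Nat.pos_of_ne_zero hN) (mul_comm 5 m)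
  have h2 : IsIntegral ℤ_[2] (ζ ^ m) := IsIntegral.of_pow (n := 5) (by norm_num) (by
    rw [h1.pow_eq_one]; exact isIntegral_one)
  have h3 := h1.geom_sum_eq_zero (by norm_num)
  have h4 := h1.pow_eq_one
  generalize ζ ^ m = z at *
  simp only [Finset.sum_range_succ, Finset.sum_range_zero] at h3
  refine ⟨⟨-(z + z ^ 4), (h2.add (h2.pow 4)).neg⟩, Subtype.ext ?_⟩
  change -(z + z ^ 4) * -(z + z ^ 4) = 1 + -(z + z ^ 4)
  linear_combination h3 + (2 + z ^ 3) * h4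

end Padic

theorem mainTheorem3 {K : Type u} [Field K] [Algebra ℚ_[2] K] [FiniteDimensional ℚ_[2] K]
    [Algebra ℤ_[2] K] [IsScalarTower ℤ_[2] ℚ_[2] K]
    (hK : ∃ ζ : K, IsPrimitiveRoot ζ
      (Nat.card (Matrix.SpecialLinearGroup (Fin 3) (GaloisField 2 2))))
    (B₀ B : GroupBlock (integralClosure ℤ_[2] K)
      (Matrix.SpecialLinearGroup (Fin 3) (GaloisField 2 2)))
    (hB₀ : B₀.IsPrincipal) (hB : ¬ B.IsPrincipal) (hdef : B.HasPositiveDefect) :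
    (¬ ∃ I : B₀.charLattice K ≃+ B.charLattice K, GroupBlock.IsPerfectIsometry 2 I) ∧
    ¬ DerivedEquivalentOver (integralClosure ℤ_[2] K) B₀.Alg B.Alg := by
  classical
  have : CharZero K := charZero_of_injective_algebraMap (algebraMap ℚ_[2] K).injective
  have : Fintype (Matrix.SpecialLinearGroup (Fin 3) (GaloisField 2 2)) := Fintype.ofFinite _
  obtain ⟨e⟩ := exists_mulEquiv_SL34
  have h64 : ¬ IsUnit (64 : integralClosure ℤ_[2] K) := fun h => by
    have := dvd_of_dvd_integralClosure (K := K) 1 (by simpa using h.dvd)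
    omega
  obtain ⟨γ, hγ⟩ := exists_golden Nat.card_pos.ne'
    (by rw [Nat.card_congr e.toEquiv]; exact five_dvd_card_SL34) hK
  obtain ⟨χ, n, Φ, hχ, h1, hn, hΦ, hb, hinj, hcong⟩ :=
    hB₀.exists_congruent_characters (K := K) h64 e hγ
  have hB' : ¬ B.HasCongruentTriple :=
    GroupBlock.not_hasCongruentTriple K (FaithfulSMul.algebraMap_injective _ K) e.symm B hB
      dvd_of_dvd_integralClosure
  refine ⟨fun ⟨I, hI⟩ => hB' (hI.hasCongruentTriple hχ h1 hn hΦ hb hinj hcong), fun h => hB' ?_⟩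
  have := B₀.isReduced_center K (FaithfulSMul.algebraMap_injective _ K)
  obtain ⟨β, hβ⟩ := h.exists_surjective_center_hom
  exact GroupBlock.HasCongruentTriple.of_surjective ⟨Φ, hinj, hb, hcong⟩ β hβ
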